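/- Let $M$ be a complex surface (a complex manifold of complex dimension two, Hausdorff and second countable, not necessarily compact) with holomorphic tangent sheaf $\Theta$, let $\omega$ be a Kähler form on $M$, and let $\beta\in H^0(M,\wedge^2\Theta)$ be a nonzero holomorphic Poisson structure. Let $D$ be the divisor defined by the section $\beta$ of the line bundle $\wedge^2\Theta$; its support is the zero locus of $\beta$. Let $\beta\cdot\omega$ be the $T^{1,0}$-valued form of type $(0,1)$ obtained by contracting $\beta$ with $\omega$: if locally $\beta=b\,\frac{\partial}{\partial z_1}\wedge\frac{\partial}{\partial z_2}$ and $\omega=\sum_{i,j}a_{ij}\,dz_i\wedge d\bar z_j$, then $$\beta\cdot\omega=b\sum_{j}\Bigl(a_{2j}\frac{\partial}{\partial z_1}-a_{1j}\frac{\partial}{\partial z_2}\Bigr)\otimes d\bar z_j .$$ Suppose that there is a compact curve $C$ in $M$ (a nonempty compact subset which near each of its points is the zero locus of a holomorphic function that does not vanish identically near that point; $C$ may be singular or reducible) with $C\cap\operatorname{supp}D=\emptyset$. Then $\beta\cdot\omega$ is $\bar\partial$-closed, and its Dolbeault class $[\beta\cdot\omega]\in H^1(M,\Theta)$ is nonzero,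 i.e. there is no smooth vector field $\xi$ of type $(1,0)$ on $M$ with $\bar\partial\xi=\beta\cdot\omega$. -/

import Mathlib

open scoped Manifold ContDiff Topology

noncomputable section

namespace KaehlerPoisson

section Linear

theorem alt_add_right {R V W : Type*} [Ring R] [AddCommGroup V] [Module R V] [TopologicalSpace V]
    [AddCommGroup W] [Module R W] [TopologicalSpace W] (b : V [⋀^Fin 2]→L[R] W) (l m m' : V) :
    b ![l, m + m'] = b ![l, m] + b ![l, m'] := by
  have hu : ∀ x : V, Function.update ![l, 0] 1 x = ![l, x] := fun x => by
    ext i; fin_cases i <;> simp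
  have h := b.map_update_add ![l, 0] 1 m m'
  rwa [hu, hu, hu] at h

theorem alt_smul_right {R V W : Type*} [Ring R] [AddCommGroup V] [Module R V] [TopologicalSpace V]
    [AddCommGroup W] [Module R W] [TopologicalSpace W] (b : V [⋀^Fin 2]→L[R] W) (c : R) (l m : V) :
    b ![l, c • m] = c • b ![l, m] := by
  have hu : ∀ x : V, Function.update ![l, 0] 1 x = ![l, x] := fun x => by
    ext i; fin_cases i <;> simp
  have h := b.map_update_smul ![l, 0] 1 c m
  rwa [hu, hu] at h

theorem alt_add_left {R V W : Type*} [Ring R] [AddCommGroup V] [Module R V] [TopologicalSpace V]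
    [AddCommGroup W] [Module R W] [TopologicalSpace W] (b : V [⋀^Fin 2]→L[R] W) (l l' m : V) :
    b ![l + l', m] = b ![l, m] + b ![l', m] := by
  have hu : ∀ x : V, Function.update ![0, m] 0 x = ![x, m] := fun x => by
    ext i; fin_cases i <;> simp
  have h := b.map_update_add ![0, m] 0 l l'
  rwa [hu, hu, hu] at h

theorem alt_smul_left {R V W : Type*} [Ring R] [AddCommGroup V] [Module R V] [TopologicalSpace V]
    [AddCommGroup W] [Module R W] [TopologicalSpace W] (b : V [⋀^Fin 2]→L[R] W) (c : R) (l m : V) :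
    b ![c • l, m] = c • b ![l, m] := by
  have hu : ∀ x : V, Function.update ![0, m] 0 x = ![x, m] := fun x => by
    ext i; fin_cases i <;> simp
  have h := b.map_update_smul ![0, m] 0 c l
  rwa [hu, hu] at h

variable {E : Type*} [AddCommGroup E] [Module ℂ E]

theorem complex_smul_eq (c : ℂ) (v : E) : c • v = c.re • v + c.im • (Complex.I • v) := by
  conv_lhs => rw [← Complex.re_add_im c]
  rw [add_smul, mul_smul]
  rfl

variable [TopologicalSpace E] [IsTopologicalAddGroup E] [ContinuousSMul ℂ E] [T2Space E]
  [FiniteDimensional ℂ E]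

/-- The image `β♯ l ∈ E` of a covector `l` under a bivector `β ∈ ⋀² E`, where bivectors are regarded
as alternating bilinear forms on the dual space, `(θ ∧ θ')(l, m) = l(θ) m(θ') - l(θ') m(θ)`.
The vector `β♯ l` is determined by `m (β♯ l) = β (l, m)` for all covectors `m`
(see `apply_sharp`). -/
def sharp (β : (E →L[ℂ] ℂ) [⋀^Fin 2]→L[ℂ] ℂ) (l : E →L[ℂ] ℂ) : E :=
  (Module.evalEquiv ℂ E).symm
    { toFun := fun m => β ![l, LinearMap.toContinuousLinearMap m]
      map_add' := fun m m' => by rw [map_add, alt_add_right]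
      map_smul' := fun c m => by rw [map_smul, alt_smul_right]; rfl }

theorem apply_sharp (β : (E →L[ℂ] ℂ) [⋀^Fin 2]→L[ℂ] ℂ) (l m : E →L[ℂ] ℂ) :
    m (sharp β l) = β ![l, m] :=
  Module.apply_evalEquiv_symm_apply (R := ℂ) (M := E) (m : E →ₗ[ℂ] ℂ) _

theorem eq_of_forall_dual {x y : E} (h : ∀ m : E →L[ℂ] ℂ, m x = m y) : x = y := by
  refine sub_eq_zero.1 ((Module.forall_dual_apply_eq_zero_iff ℂ (x - y)).1 fun m => ?_)
  have := h (LinearMap.toContinuousLinearMap m)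
  simp only [LinearMap.coe_toContinuousLinearMap'] at this
  rw [map_sub, this, sub_self]

/-- Contraction of a real 2-form `w` with the antiholomorphic part of `v`: the complex linear
functional `u ↦ w(v⁰¹, u¹⁰)`, where `w` is extended complex bilinearly and
`v⁰¹ = (v + i Jv) / 2`, `u¹⁰ = (u - i Ju) / 2`, with `J` the multiplication by `i` on `E`. -/
def contract01 (w : E [⋀^Fin 2]→L[ℝ] ℝ) (v : E) : E →L[ℂ] ℂ :=
  LinearMap.toContinuousLinearMap
    { toFun := fun u => (1 / 4 : ℂ) *
        ((w ![v, u] : ℂ) - Complex.I * w ![v, Complex.I • u]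
          + Complex.I * w ![Complex.I • v, u] + w ![Complex.I • v, Complex.I • u])
      map_add' := fun u u' => by
        simp only [smul_add, alt_add_right, Complex.ofReal_add]
        ring
      map_smul' := fun c u => by
        have h1 : Complex.I • c • u = (-c.im) • u + c.re • (Complex.I • u) := by
          rw [smul_smul, complex_smul_eq (Complex.I * c) u]; simp
        rw [h1, complex_smul_eq c u]
        simp only [alt_add_right, alt_smul_right, smul_eq_mul, RingHom.id_apply]
        push_cast
        conv_rhs => rw [← Complex.re_add_im c]
        ring_nf
        simp only [Complex.I_sq]
        ring }

theorem contract01_apply (w : E [⋀^Fin 2]→L[ℝ] ℝ) (v u : E) :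
    contract01 w v u = (1 / 4 : ℂ) *
        ((w ![v, u] : ℂ) - Complex.I * w ![v, Complex.I • u]
          + Complex.I * w ![Complex.I • v, u] + w ![Complex.I • v, Complex.I • u]) := rfl

theorem contract01_add (w : E [⋀^Fin 2]→L[ℝ] ℝ) (v v' : E) :
    contract01 w (v + v') = contract01 w v + contract01 w v' := by
  ext u
  simp only [add_apply, contract01_apply, smul_add, alt_add_left,
    Complex.ofReal_add]
  ring

theorem contract01_smul (w : E [⋀^Fin 2]→L[ℝ] ℝ) (c : ℂ) (v : E) :
    contract01 w (c • v) = (starRingEnd ℂ c) • contract01 w v := by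
  ext u
  have h1 : Complex.I • c • v = (-c.im) • v + c.re • (Complex.I • v) := by
    rw [smul_smul, complex_smul_eq (Complex.I * c) v]; simp
  have h2 : (starRingEnd ℂ) c = c.re - c.im * Complex.I := by
    apply Complex.ext <;> simp
  simp only [smul_apply, contract01_apply]
  rw [h1, complex_smul_eq c v, h2]
  simp only [alt_add_left, alt_smul_left, smul_eq_mul]
  push_cast
  ring_nf
  simp only [Complex.I_sq]
  ring

/-- The contraction `β · w` of a bivector `β` by a real 2-form `w`, as a conjugate linear map
`v ↦ β♯ (w(v⁰¹, ·))`, i.e. as an element of `T¹⁰ ⊗ ⋀⁰¹`. -/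
def contraction (β : (E →L[ℂ] ℂ) [⋀^Fin 2]→L[ℂ] ℂ) (w : E [⋀^Fin 2]→L[ℝ] ℝ) : E →L⋆[ℂ] E :=
  let f : E →ₗ⋆[ℂ] E :=
    { toFun := fun v => sharp β (contract01 w v)
      map_add' := fun v v' => eq_of_forall_dual fun m => by
        rw [map_add, apply_sharp, apply_sharp, apply_sharp, contract01_add, alt_add_left]
      map_smul' := fun c v => eq_of_forall_dual fun m => by
        rw [map_smul, apply_sharp, apply_sharp, contract01_smul, alt_smul_left] }
  { f with
    cont := by
      have : ContinuousSMul ℝ E := ⟨by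
        have h : Continuous fun x : ℝ × E => ((x.1 : ℂ)) • x.2 := by fun_prop
        exact h⟩
      have : FiniteDimensional ℝ E := FiniteDimensional.complexToReal E
      let g : E →ₗ[ℝ] E :=
        { toFun := f
          map_add' := f.map_add
          map_smul' := fun c v => by
            have h := f.map_smulₛₗ (c : ℂ) v
            rw [Complex.conj_ofReal] at h
            exact h }
      exact g.continuous_of_finiteDimensional }

theorem contraction_apply (β : (E →L[ℂ] ℂ) [⋀^Fin 2]→L[ℂ] ℂ) (w : E [⋀^Fin 2]→L[ℝ] ℝ) (v : E) :
    contraction β w v = sharp β (contract01 w v) := rfl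

end Linear

section Dbar

theorem differentiableAt_of_target {M E F : Type*} [TopologicalSpace M] [NormedAddCommGroup E]
    [NormedSpace ℝ E] [NormedAddCommGroup F] [NormedSpace ℝ F]
    {e : OpenPartialHomeomorph M E} {f : E → F}
    (hf : ContDiffOn ℝ ∞ f e.target) {x : E} (hx : x ∈ e.target) : DifferentiableAt ℝ f x :=
  (hf.contDiffAt (e.open_target.mem_nhds hx)).differentiableAt (by simp)

variable {E F : Type*} [NormedAddCommGroup E] [NormedSpace ℂ E]
  [NormedAddCommGroup F] [NormedSpace ℂ F]

/-- The value on `v` of the antiholomorphic part of the real derivative of `f` at `x`: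
`∂̄f (v) = (Df(v) + i Df(iv)) / 2`. -/
def dbar (f : E → F) (x v : E) : F :=
  (1 / 2 : ℂ) • (fderiv ℝ f x v + Complex.I • fderiv ℝ f x (Complex.I • v))

theorem dbar_add {f g : E → F} {x : E} (hf : DifferentiableAt ℝ f x) (hg : DifferentiableAt ℝ g x)
    (v : E) : dbar (fun y => f y + g y) x v = dbar f x v + dbar g x v := by
  simp only [dbar, fderiv_fun_add hf hg, add_apply, smul_add]
  abel

theorem dbar_const_smul {f : E → F} {x : E} (hf : DifferentiableAt ℝ f x) (c : ℂ) (v : E) :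
    dbar (fun y => c • f y) x v = c • dbar f x v := by
  have h : fderiv ℝ (fun y => c • f y) x = c • fderiv ℝ f x := fderiv_fun_const_smul hf c
  simp only [dbar, h, smul_apply]
  rw [smul_comm Complex.I c, ← smul_add, smul_comm]

theorem dbar_zero (x v : E) : dbar (fun _ : E => (0 : F)) x v = 0 := by
  simp [dbar]

end Dbar

section Manifold

variable {E : Type*} [NormedAddCommGroup E] [NormedSpace ℂ E]
  {M : Type*} [TopologicalSpace M] [ChartedSpace E M]

/-! For a complex manifold `M` modelled on `E`, the complex vector space
`TangentSpace 𝓘(ℂ, E) p` is the fibre at `p` of the holomorphic tangent bundle; it is also the real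
tangent space, with the complex structure `J` given by multiplication by `i`. -/

/-- The coordinate expression in the chart `e` of a field of tangent vectors. -/
def vecInChart (e : OpenPartialHomeomorph M E) (ξ : ∀ p : M, TangentSpace 𝓘(ℂ, E) p) (x : E) : E :=
  mfderiv 𝓘(ℂ, E) 𝓘(ℂ, E) e (e.symm x) (ξ (e.symm x))

variable (E M) in
/-- Fields of (not necessarily smooth) `T¹⁰`-valued `(0,1)`-forms: conjugate linear maps
`T_p M → T_p M`. -/
abbrev VecForm01 : Type _ :=
  ∀ p : M, TangentSpace 𝓘(ℂ, E) p →L⋆[ℂ] TangentSpace 𝓘(ℂ, E) p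

/-- The coordinate expression in the chart `e` of a tangent-vector valued `(0,1)`-form. -/
def form01InChart (e : OpenPartialHomeomorph M E) (η : VecForm01 E M) (x : E) : E →L⋆[ℂ] E :=
  (mfderiv 𝓘(ℂ, E) 𝓘(ℂ, E) e (e.symm x)).comp
    ((η (e.symm x)).comp (mfderiv 𝓘(ℂ, E) 𝓘(ℂ, E) e.symm x))

/-- The coordinate expression in the chart `e` of a real 2-form. -/
def form2InChart (e : OpenPartialHomeomorph M E)
    (w : ∀ p : M, TangentSpace 𝓘(ℂ, E) p [⋀^Fin 2]→L[ℝ] ℝ) (x : E) : E [⋀^Fin 2]→L[ℝ] ℝ :=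
  (w (e.symm x)).compContinuousLinearMap
    ((mfderiv 𝓘(ℂ, E) 𝓘(ℂ, E) e.symm x).restrictScalars ℝ)

/-- The coordinate expression in the chart `e` of a field of bivectors, i.e. of alternating bilinear
forms on the cotangent spaces. -/
def bivectorInChart (e : OpenPartialHomeomorph M E)
    (β : ∀ p : M, (TangentSpace 𝓘(ℂ, E) p →L[ℂ] ℂ) [⋀^Fin 2]→L[ℂ] ℂ) (x : E) :
    (E →L[ℂ] ℂ) [⋀^Fin 2]→L[ℂ] ℂ :=
  (β (e.symm x)).compContinuousLinearMap
    (ContinuousLinearMap.precomp ℂ (mfderiv 𝓘(ℂ, E) 𝓘(ℂ, E) e (e.symm x)))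

variable (E M) in
/-- A Kähler form: a smooth closed real 2-form `ω` of type `(1,1)`, i.e. `ω(Ju, Jv) = ω(u, v)`,
which is positive, i.e. `ω(v, Jv) > 0` for `v ≠ 0`. -/
structure KaehlerForm where
  /-- The underlying field of alternating forms. -/
  toFun : ∀ p : M, TangentSpace 𝓘(ℂ, E) p [⋀^Fin 2]→L[ℝ] ℝ
  smooth : ∀ e ∈ atlas E M, ContDiffOn ℝ ∞ (form2InChart e toFun) e.target
  closed : ∀ e ∈ atlas E M, ∀ x ∈ e.target, extDeriv (form2InChart e toFun) x = 0
  invariant : ∀ (p : M) (u v : TangentSpace 𝓘(ℂ, E) p),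
    toFun p ![Complex.I • u, Complex.I • v] = toFun p ![u, v]
  positive : ∀ (p : M) (v : TangentSpace 𝓘(ℂ, E) p), v ≠ 0 → 0 < toFun p ![v, Complex.I • v]

variable (E M) in
/-- A holomorphic bivector field, i.e. a holomorphic section of `⋀² Θ`. In complex dimension two
this is the same as a holomorphic Poisson structure, because the Schouten bracket `[β, β]` is a
section of `⋀³ Θ = 0`. -/
structure HolomorphicBivector where
  /-- The underlying field of bivectors. -/
  toFun : ∀ p : M, (TangentSpace 𝓘(ℂ, E) p →L[ℂ] ℂ) [⋀^Fin 2]→L[ℂ] ℂ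
  holomorphic : ∀ e ∈ atlas E M, AnalyticOnNhd ℂ (bivectorInChart e toFun) e.target

/-- The support of the divisor defined by `β`: in complex dimension two `⋀² Θ` is a line bundle,
and the support of the divisor of a section is its zero locus. -/
def HolomorphicBivector.divisorSupport (β : HolomorphicBivector E M) : Set M :=
  {p | β.toFun p = 0}

variable (E) in
/-- A compact curve in a complex surface `M`: a nonempty compact subset which near each of its
points is the zero locus of a holomorphic function that does not vanish identically near that
point (singular and reducible curves are allowed). -/
structure IsCompactCurve (C : Set M) : Prop where
  nonempty : C.Nonempty
  isCompact : IsCompact C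
  exists_equation : ∀ p ∈ C, ∃ (U : Set M) (h : M → ℂ), IsOpen U ∧ p ∈ U ∧
    ContMDiffOn 𝓘(ℂ, E) 𝓘(ℂ, ℂ) ω h U ∧ (∀ q ∈ U, q ∈ C ↔ h q = 0) ∧ ¬ ∀ᶠ q in 𝓝 p, h q = 0

/-- Smooth vector fields of type `(1,0)`. -/
def IsSmoothVec (ξ : ∀ p : M, TangentSpace 𝓘(ℂ, E) p) : Prop :=
  ∀ e ∈ atlas E M, ContDiffOn ℝ ∞ (vecInChart e ξ) e.target

/-- Smooth `T¹⁰`-valued `(0,1)`-forms. -/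
def IsSmoothForm01 (η : VecForm01 E M) : Prop :=
  ∀ e ∈ atlas E M, ContDiffOn ℝ ∞ (form01InChart e η) e.target

/-- `∂̄η = 0` for a `T¹⁰`-valued `(0,1)`-form `η`: in each chart
`(∂̄η)(u, v) = (∂̄_u η)(v) - (∂̄_v η)(u)` vanishes. -/
def IsDbarClosed (η : VecForm01 E M) : Prop :=
  ∀ e ∈ atlas E M, ∀ x ∈ e.target, ∀ u v : E,
    dbar (form01InChart e η) x u v - dbar (form01InChart e η) x v u = 0

/-- `η = ∂̄ξ` for a vector field `ξ` of type `(1,0)`, expressed in each chart. -/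
def IsDbarOf (η : VecForm01 E M) (ξ : ∀ p : M, TangentSpace 𝓘(ℂ, E) p) : Prop :=
  ∀ e ∈ atlas E M, ∀ x ∈ e.target, ∀ v : E, form01InChart e η x v = dbar (vecInChart e ξ) x v

theorem form01InChart_add (e : OpenPartialHomeomorph M E) (η η' : VecForm01 E M) :
    form01InChart e (η + η') = fun x => form01InChart e η x + form01InChart e η' x := by
  funext x
  ext v
  exact map_add (mfderiv 𝓘(ℂ, E) 𝓘(ℂ, E) e (e.symm x)) _ _

theorem form01InChart_smul (e : OpenPartialHomeomorph M E) (c : ℂ) (η : VecForm01 E M) :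
    form01InChart e (c • η) = fun x => c • form01InChart e η x := by
  funext x
  ext v
  exact map_smul (mfderiv 𝓘(ℂ, E) 𝓘(ℂ, E) e (e.symm x)) _ _

theorem form01InChart_zero (e : OpenPartialHomeomorph M E) :
    form01InChart e (0 : VecForm01 E M) = fun _ => 0 := by
  funext x
  ext v
  exact map_zero (mfderiv 𝓘(ℂ, E) 𝓘(ℂ, E) e (e.symm x))

theorem vecInChart_add (e : OpenPartialHomeomorph M E)
    (ξ ξ' : ∀ p : M, TangentSpace 𝓘(ℂ, E) p) :
    vecInChart e (ξ + ξ') = fun x => vecInChart e ξ x + vecInChart e ξ' x := by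
  funext x
  exact map_add (mfderiv 𝓘(ℂ, E) 𝓘(ℂ, E) e (e.symm x)) _ _

theorem vecInChart_smul (e : OpenPartialHomeomorph M E) (c : ℂ)
    (ξ : ∀ p : M, TangentSpace 𝓘(ℂ, E) p) :
    vecInChart e (c • ξ) = fun x => c • vecInChart e ξ x := by
  funext x
  exact map_smul (mfderiv 𝓘(ℂ, E) 𝓘(ℂ, E) e (e.symm x)) _ _

theorem vecInChart_zero (e : OpenPartialHomeomorph M E) :
    vecInChart e (0 : ∀ p : M, TangentSpace 𝓘(ℂ, E) p) = fun _ => 0 := by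
  funext x
  exact map_zero (mfderiv 𝓘(ℂ, E) 𝓘(ℂ, E) e (e.symm x))

variable (E M) in
/-- The space of smooth `∂̄`-closed `T¹⁰`-valued `(0,1)`-forms. -/
def dolbeaultCocycles : Submodule ℂ (VecForm01 E M) where
  carrier := {η | IsSmoothForm01 η ∧ IsDbarClosed η}
  add_mem' := by
    rintro η η' ⟨hs, hc⟩ ⟨hs', hc'⟩
    refine ⟨fun e he => ?_, fun e he x hx u v => ?_⟩
    · rw [form01InChart_add]
      exact (hs e he).add (hs' e he)
    · have hd := differentiableAt_of_target (hs e he) hx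
      have hd' := differentiableAt_of_target (hs' e he) hx
      have h := hc e he x hx u v
      have h' := hc' e he x hx u v
      rw [form01InChart_add, dbar_add hd hd', dbar_add hd hd', add_apply,
        add_apply, add_sub_add_comm, h, h', add_zero]
  zero_mem' := by
    refine ⟨fun e he => ?_, fun e he x hx u v => ?_⟩
    · rw [form01InChart_zero]
      exact contDiffOn_const
    · rw [form01InChart_zero, dbar_zero, dbar_zero]
      simp
  smul_mem' := by
    rintro c η ⟨hs, hc⟩
    refine ⟨fun e he => ?_, fun e he x hx u v => ?_⟩
    · rw [form01InChart_smul]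
      exact (hs e he).const_smul c
    · have hd := differentiableAt_of_target (hs e he) hx
      have h := hc e he x hx u v
      rw [form01InChart_smul, dbar_const_smul hd, dbar_const_smul hd,
        smul_apply, smul_apply, ← smul_sub, h, smul_zero]

variable (E M) in
/-- The space of forms `∂̄ξ`, with `ξ` a smooth vector field of type `(1,0)`. -/
def dolbeaultCoboundaries : Submodule ℂ (VecForm01 E M) where
  carrier := {η | ∃ ξ : ∀ p : M, TangentSpace 𝓘(ℂ, E) p, IsSmoothVec ξ ∧ IsDbarOf η ξ}
  add_mem' := by
    rintro η η' ⟨ξ, hs, hc⟩ ⟨ξ', hs', hc'⟩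
    refine ⟨ξ + ξ', fun e he => ?_, fun e he x hx v => ?_⟩
    · rw [vecInChart_add]
      exact (hs e he).add (hs' e he)
    · have hd := differentiableAt_of_target (hs e he) hx
      have hd' := differentiableAt_of_target (hs' e he) hx
      rw [form01InChart_add, vecInChart_add, dbar_add hd hd', add_apply,
        hc e he x hx, hc' e he x hx]
  zero_mem' := by
    refine ⟨0, fun e he => ?_, fun e he x hx v => ?_⟩
    · rw [vecInChart_zero]
      exact contDiffOn_const
    · rw [form01InChart_zero, vecInChart_zero, dbar_zero]
      simp
  smul_mem' := by
    rintro c η ⟨ξ, hs, hc⟩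
    refine ⟨c • ξ, fun e he => ?_, fun e he x hx v => ?_⟩
    · rw [vecInChart_smul]
      exact (hs e he).const_smul c
    · have hd := differentiableAt_of_target (hs e he) hx
      rw [form01InChart_smul, vecInChart_smul, dbar_const_smul hd,
        smul_apply, hc e he x hx]

variable (E M) in
/-- The cohomology group `H¹(M, Θ)` of the holomorphic tangent sheaf, computed by the Dolbeault
complex of `T¹⁰`-valued forms of type `(0, •)`: closed forms modulo exact ones. -/
abbrev H1Theta : Type _ :=
  dolbeaultCocycles E M ⧸ (dolbeaultCoboundaries E M).comap (dolbeaultCocycles E M).subtype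

/-- The class in `H¹(M, Θ)` of a smooth `∂̄`-closed form. -/
def dolbeaultClass (η : dolbeaultCocycles E M) : H1Theta E M :=
  Submodule.Quotient.mk η

instance instT2TangentSpace (p : M) : T2Space (TangentSpace 𝓘(ℂ, E) p) :=
  inferInstanceAs (T2Space E)

instance instFiniteDimensionalTangentSpace [FiniteDimensional ℂ E] (p : M) :
    FiniteDimensional ℂ (TangentSpace 𝓘(ℂ, E) p) :=
  inferInstanceAs (FiniteDimensional ℂ E)

/-- The `T¹⁰`-valued `(0,1)`-form `β · ω`. -/
def betaOmega [FiniteDimensional ℂ E] (β : HolomorphicBivector E M) (w : KaehlerForm E M) :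
    VecForm01 E M :=
  fun p => contraction (β.toFun p) (w.toFun p)

end Manifold

end KaehlerPoisson

end

/-! Near `C` the bivector has no zeros, so its inverse `σ` is a holomorphic symplectic form there.
By adjunction `σ` identifies the normal bundle of `C` with its canonical bundle: if `P` is a local
equation of `C`, a vector field `ξ` gives the `(1,0)`-form on `C` which is the Poincaré residue of
`dP(ξ) σ / P`. If `∂̄ξ = β · ω`, then `∂̄` of this form is a nonzero constant multiple of `ω`
restricted to `C`. Stokes' theorem on the compact curve would then make the area of `C` zero,
against the positivity of `ω`.

Since `C` may be singular, nothing is integrated over `C` itself. The residue is replaced by `R(f,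
g) = ∫ (b P)⁻¹ ∂̄g ∧ ∂̄(f dP(ξ))` over an open set of coordinates (`resDensity`, `pairing`), with
`b` the coefficient of `β`. It converges because `dP / P` is locally integrable. For functions
supported in a common domain, `R` depends neither on the chart nor on the equation
(`IsCurveChart.pairing_eq`), and it vanishes if near each point of `C` one of `f`, `g` is zero. For
a partition of unity `ψ_i` near `C`, therefore, `∑ R(1, ψ_i) = ∑∑ R(ψ_k, ψ_i) = ∑ R(ψ_k, 1) = 0`
(`sum_pairing_eq_zero`).

On the other hand, replacing `1 / P` by `P̄ / (|P|² + ε)` and integrating by parts turns `R(1, ψ)`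
into `-i` times a limit of nonnegative integrals of `ψ` and `ω` against kernels concentrating on
`C`. They stay away from zero if `ψ > 0` at some point of `C` (`integral_resDensity_im`). The
imaginary parts thus add up to a negative number, a contradiction.

All this needs reduced local equations (`IsReducedEquation`): `P` must generate the ideal of `C`,
and `dP` must be nonzero on a dense part of `C`. They are obtained as polynomials in one variable
whose zeros are the distinct zeros of a given equation in the slices (`exists_isReducedFamily`).
That `β · ω` is `∂̄`-closed follows from the holomorphy of `b` and from `dω = 0` in type `(1,2)`
(`dbar_contract01_comm`). -/

noncomputable section

namespace KaehlerPoisson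

/-! ### Zeros and logarithmic derivatives of holomorphic functions in a disc. -/

section OneVariable

open Metric Set

/-- A circle integral depending on a parameter is as differentiable as its integrand. -/
theorem contDiffOn_circleIntegral_nat {H : Type} [NormedAddCommGroup H] [NormedSpace ℂ H]
    [ProperSpace H] {U : Set H} (hU : IsOpen U) {c : ℂ} {R : ℝ} (hR : 0 ≤ R) {O : Set (H × ℂ)}
    (hO : IsOpen O) (hUO : U ×ˢ sphere c R ⊆ O) (n : ℕ) :
    ∀ {G : Type} [NormedAddCommGroup G] [NormedSpace ℂ G] [CompleteSpace G]
      {F : H × ℂ → G}, ContDiffOn ℂ ∞ F O →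
      ContDiffOn ℂ n (fun x => ∮ ζ in C(c, R), F (x, ζ)) U := by
  have hcont : ∀ {G : Type} [NormedAddCommGroup G] [NormedSpace ℂ G] {F : H × ℂ → G},
      ContinuousOn F O → ∀ x ∈ U, Continuous fun θ => F (x, circleMap c R θ) := by
    intro G _ _ F hF x hx
    refine hF.comp_continuous (by fun_prop) fun θ => hUO ⟨hx, circleMap_mem_sphere c hR θ⟩
  have hderiv : ∀ {G : Type} [NormedAddCommGroup G] [NormedSpace ℂ G] [CompleteSpace G]
      {F : H × ℂ → G}, ContDiffOn ℂ ∞ F O → ∀ x ∈ U,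
      HasFDerivAt (fun x => ∮ ζ in C(c, R), F (x, ζ))
        (∮ ζ in C(c, R), (fderiv ℂ F (x, ζ)).comp (ContinuousLinearMap.inl ℂ H ℂ)) x := by
    intro G _ _ _ F hF x hx
    have hF' : ContinuousOn
        (fun y => (fderiv ℂ F y).comp (ContinuousLinearMap.inl ℂ H ℂ)) O :=
      (hF.continuousOn_fderiv_of_isOpen hO (by simp)).clm_comp continuousOn_const
    obtain ⟨ρ, hρ, hρU⟩ := Metric.nhds_basis_closedBall.mem_iff.1 (hU.mem_nhds hx)
    have hK : IsCompact (closedBall x ρ ×ˢ sphere c R) :=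
      (isCompact_closedBall x ρ).prod (isCompact_sphere c R)
    obtain ⟨B, hB⟩ := hK.exists_bound_of_continuousOn
      (hF'.mono ((prod_mono_left hρU).trans hUO))
    have hd : Continuous fun θ => deriv (circleMap c R) θ := by
      simp only [deriv_circleMap]
      fun_prop
    refine intervalIntegral.hasFDerivAt_integral_of_dominated_of_fderiv_le
      (F := fun x θ => deriv (circleMap c R) θ • F (x, circleMap c R θ))
      (F' := fun x θ => deriv (circleMap c R) θ •
        (fderiv ℂ F (x, circleMap c R θ)).comp (ContinuousLinearMap.inl ℂ H ℂ))
      (bound := fun _ => |R| * B)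
      (ball_mem_nhds x hρ) ?_ ?_ ?_ ?_ ?_ ?_
    · filter_upwards [hU.mem_nhds hx] with y hy
      exact (hd.smul (hcont hF.continuousOn y hy)).aestronglyMeasurable
    · exact (hd.smul (hcont hF.continuousOn x hx)).intervalIntegrable _ _
    · exact (hd.smul (hcont hF' x hx)).aestronglyMeasurable
    · refine Filter.Eventually.of_forall fun θ _ y hy => ?_
      rw [norm_smul]
      gcongr
      · simp
      · exact hB (y, circleMap c R θ) ⟨ball_subset_closedBall hy, circleMap_mem_sphere c hR θ⟩
    · exact intervalIntegrable_const
    · refine Filter.Eventually.of_forall fun θ _ y hy => ?_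
      have hyO : (y, circleMap c R θ) ∈ O :=
        hUO ⟨hρU (ball_subset_closedBall hy), circleMap_mem_sphere c hR θ⟩
      have h1 : HasFDerivAt F (fderiv ℂ F (y, circleMap c R θ)) (y, circleMap c R θ) :=
        ((hF.contDiffAt (hO.mem_nhds hyO)).differentiableAt (by simp)).hasFDerivAt
      exact (h1.comp y (hasFDerivAt_prodMk_left y _)).const_smul _
  -- `G` stays quantified, since the induction hypothesis is applied to the derivative of `F` along
  -- `H`, which takes values in `H →L[ℂ] G`.
  induction n with
  | zero =>
    intro G _ _ _ F hF
    rw [Nat.cast_zero, contDiffOn_zero]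
    exact fun x hx => (hderiv hF x hx).continuousAt.continuousWithinAt
  | succ n ih =>
    intro G _ _ _ F hF
    rw [Nat.cast_succ, contDiffOn_succ_iff_fderiv_of_isOpen hU]
    refine ⟨fun x hx => (hderiv hF x hx).differentiableAt.differentiableWithinAt, by simp, ?_⟩
    refine ContDiffOn.congr (ih (F := fun y => (fderiv ℂ F y).comp
      (ContinuousLinearMap.inl ℂ H ℂ)) ?_) fun x hx => (hderiv hF x hx).fderiv
    exact (hF.fderiv_of_isOpen hO (by simp)).clm_comp contDiffOn_const

theorem contDiffOn_circleIntegral {H : Type} [NormedAddCommGroup H] [NormedSpace ℂ H]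
    [ProperSpace H] {U : Set H} (hU : IsOpen U) {c : ℂ} {R : ℝ} (hR : 0 ≤ R) {O : Set (H × ℂ)}
    (hO : IsOpen O) (hUO : U ×ˢ sphere c R ⊆ O)
    {G : Type} [NormedAddCommGroup G] [NormedSpace ℂ G] [CompleteSpace G]
    {F : H × ℂ → G} (hF : ContDiffOn ℂ ∞ F O) :
    ContDiffOn ℂ ∞ (fun x => ∮ ζ in C(c, R), F (x, ζ)) U :=
  contDiffOn_infty.2 fun n => contDiffOn_circleIntegral_nat hU hR hO hUO n hF

/-- A holomorphic function without zeros on the boundary of a disc is a product of finitely many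
linear factors, with zeros in the disc, and of a function without zeros. -/
theorem exists_multiset_factorization {f : ℂ → ℂ} {c : ℂ} {R : ℝ} (hR : 0 < R)
    (hf : AnalyticOnNhd ℂ f (closedBall c R)) (h0 : ∀ w ∈ sphere c R, f w ≠ 0) :
    ∃ (s : Multiset ℂ) (q : ℂ → ℂ), (∀ a ∈ s, a ∈ ball c R) ∧
      AnalyticOnNhd ℂ q (closedBall c R) ∧ (∀ w ∈ closedBall c R, q w ≠ 0) ∧
      ∀ w ∈ closedBall c R, f =ᶠ[𝓝 w] fun w => (s.map fun a => w - a).prod * q w := by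
  set U := closedBall c R with hUdef
  have hfm : MeromorphicOn f U := fun x hx => (hf x hx).meromorphicAt
  obtain ⟨w₀, hw₀⟩ := (NormedSpace.sphere_nonempty (x := c)).2 hR.le
  have hw₀U : w₀ ∈ U := sphere_subset_closedBall hw₀
  have hconn : IsConnected U := (convex_closedBall c R).isConnected ⟨w₀, hw₀U⟩
  -- A zero of infinite order would spread over the connected disc and reach the boundary, where `f`
  -- has no zeros.
  have htop : ∀ u : U, meromorphicOrderAt f u ≠ ⊤ := by
    intro u
    refine hfm.meromorphicOrderAt_ne_top_of_isPreconnected (x := w₀) hconn.isPreconnected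
      hw₀U u.2 ?_
    rw [(hf w₀ hw₀U).meromorphicOrderAt_eq, (hf w₀ hw₀U).analyticOrderAt_eq_zero.2 (h0 w₀ hw₀)]
    simp
  have hfin : (MeromorphicOn.divisor f U).support.Finite :=
    (MeromorphicOn.divisor f U).finiteSupport (isCompact_closedBall c R)
  obtain ⟨q, hq, hq0, hfq⟩ := hfm.extract_zeros_poles htop hfin
  set d := MeromorphicOn.divisor f U with hd
  have hd0 : ∀ u, 0 ≤ d u := fun u => (MeromorphicOn.AnalyticOnNhd.divisor_nonneg hf) u
  set s : Multiset ℂ := ∑ u ∈ hfin.toFinset, Multiset.replicate (d u).toNat u with hs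
  have hprod : ∀ w, (∏ᶠ u, (· - u) ^ d u : ℂ → ℂ) w = (s.map fun a => w - a).prod := by
    intro w
    rw [Function.FactorizedRational.finprod_eq_fun hfin]
    change ∏ᶠ u, (w - u) ^ d u = _
    rw [finprod_eq_prod_of_mulSupport_subset (s := hfin.toFinset)]
    · rw [hs, ← Multiset.coe_mapAddMonoidHom, map_sum, Multiset.prod_sum]
      simp only [Multiset.coe_mapAddMonoidHom]
      refine Finset.prod_congr rfl fun u _ => ?_
      rw [Multiset.map_replicate, Multiset.prod_replicate, ← zpow_natCast,
        Int.toNat_of_nonneg (hd0 u)]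
    · intro u hu
      simp only [Finite.coe_toFinset, Function.mem_support]
      rintro h
      simp [h] at hu
  -- The factorization so far holds off a discrete set. Both sides are analytic, so the identity
  -- theorem extends it to full neighbourhoods.
  have heq : ∀ w ∈ U, f =ᶠ[𝓝 w] fun w => (s.map fun a => w - a).prod * q w := by
    intro w hw
    have hana : AnalyticAt ℂ (fun w => (s.map fun a => w - a).prod * q w) w := by
      refine AnalyticAt.mul ?_ (hq w hw)
      induction s using Multiset.induction with
      | empty => simpa using analyticAt_const
      | cons a s ih =>
        simp only [Multiset.map_cons, Multiset.prod_cons]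
        exact (analyticAt_id.sub analyticAt_const).mul ih
    have hnt : U.Nontrivial := by
      refine ⟨w₀, hw₀U, c, mem_closedBall_self hR.le, ?_⟩
      rintro rfl
      simp [hR.ne] at hw₀
    have hacc : AccPt w (Filter.principal U) :=
      hconn.isPreconnected.preperfect_of_nontrivial hnt w hw
    refine ((hf w hw).frequently_eq_iff_eventually_eq hana).1 ?_
    have hmem := Filter.disjoint_principal_right.1 ((mem_codiscreteWithin.1 hfq) w hw)
    have hfr : ∃ᶠ y in 𝓝[≠] w, y ∈ U := accPt_iff_frequently_nhdsNE.1 hacc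
    refine (hfr.and_eventually hmem).mono fun y hy => ?_
    have h1 : f y = ((∏ᶠ u, (· - u) ^ d u : ℂ → ℂ) • q) y := by
      by_contra hne
      exact hy.2 ⟨hy.1, hne⟩
    rw [h1, ← hprod y]
    rfl
  refine ⟨s, q, fun a ha => ?_, hq, fun w hw => hq0 ⟨w, hw⟩, heq⟩
  have haU : a ∈ U := by
    rw [hs, Multiset.mem_sum] at ha
    obtain ⟨u, hu, hau⟩ := ha
    rw [Multiset.eq_of_mem_replicate hau]
    exact d.supportWithinDomain (by simpa using hu)
  by_contra hab
  have has : a ∈ sphere c R := by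
    rw [hUdef, ← ball_union_sphere] at haU
    exact haU.resolve_left hab
  refine h0 a has ?_
  rw [(heq a haU).eq_of_nhds, Multiset.prod_eq_zero (Multiset.mem_map.2 ⟨a, ha, sub_self a⟩),
    zero_mul]

/-- The logarithmic derivative of a factorization. -/
theorem deriv_div_eq_of_factorization {f q : ℂ → ℂ} {s : Multiset ℂ} {w : ℂ}
    (hf : f =ᶠ[𝓝 w] fun w => (s.map fun a => w - a).prod * q w) (hq : DifferentiableAt ℂ q w)
    (hfw : f w ≠ 0) :
    deriv f w / f w = (s.map fun a => (w - a)⁻¹).sum + deriv q w / q w := by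
  have hprod : ∀ s : Multiset ℂ, Differentiable ℂ (fun w => (s.map fun a => w - a).prod) ∧
      ((s.map fun a => w - a).prod ≠ 0 →
      deriv (fun w => (s.map fun a => w - a).prod) w =
        (s.map fun a => w - a).prod * (s.map fun a => (w - a)⁻¹).sum) := by
    intro s
    induction s using Multiset.induction with
    | empty => simp
    | cons a s ih =>
      simp only [Multiset.map_cons, Multiset.prod_cons, Multiset.sum_cons]
      refine ⟨by have := ih.1; fun_prop, fun h => ?_⟩
      have h1 := left_ne_zero_of_mul h
      have h2 := ih.2 (right_ne_zero_of_mul h)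
      rw [deriv_fun_mul (by fun_prop) (ih.1 w), h2]
      simp only [deriv_sub_const_fun, deriv_id'']
      field_simp
  have hfw' := hf.eq_of_nhds
  rw [hfw'] at hfw ⊢
  have h1 := left_ne_zero_of_mul hfw
  have h2 := right_ne_zero_of_mul hfw
  rw [hf.deriv_eq, deriv_fun_mul ((hprod s).1 w) hq, (hprod s).2 h1]
  field_simp

/-- The power sums of the zeros of a holomorphic function in a disc are given by integrals of its
logarithmic derivative. -/
theorem circleIntegral_pow_mul_logDeriv {f q : ℂ → ℂ} {c : ℂ} {R : ℝ} (hR : 0 < R)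
    {s : Multiset ℂ} (hs : ∀ a ∈ s, a ∈ ball c R)
    (h0 : ∀ w ∈ sphere c R, f w ≠ 0)
    (hq : AnalyticOnNhd ℂ q (closedBall c R)) (hq0 : ∀ w ∈ closedBall c R, q w ≠ 0)
    (hfq : ∀ w ∈ closedBall c R, f =ᶠ[𝓝 w] fun w => (s.map fun a => w - a).prod * q w) (m : ℕ) :
    (∮ w in C(c, R), w ^ m * (deriv f w / f w)) =
      2 * Real.pi * Complex.I * (s.map fun a => a ^ m).sum := by
  have h1 : (∮ w in C(c, R), w ^ m * (deriv f w / f w)) =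
      ∮ w in C(c, R), ((s.map fun a => w ^ m * (w - a)⁻¹).sum + w ^ m * (deriv q w / q w)) := by
    refine circleIntegral.integral_congr hR.le fun w hw => ?_
    have hw' := sphere_subset_closedBall hw
    rw [deriv_div_eq_of_factorization (hfq w hw') (hq w hw').differentiableAt (h0 w hw), mul_add,
      Multiset.sum_map_mul_left]
  have hqq : AnalyticOnNhd ℂ (fun w => w ^ m * (deriv q w / q w)) (closedBall c R) := fun w hw =>
    (analyticAt_id.pow m).mul (((hq w hw).deriv).div (hq w hw) (hq0 w hw))
  have h2 : (∮ w in C(c, R), w ^ m * (deriv q w / q w)) = 0 := by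
    refine DiffContOnCl.circleIntegral_eq_zero hR.le ⟨?_, ?_⟩
    · exact hqq.differentiableOn.mono ball_subset_closedBall
    · rw [closure_ball c hR.ne']
      exact hqq.continuousOn
  have h3 : ∀ a ∈ ball c R, (∮ w in C(c, R), w ^ m * (w - a)⁻¹) =
      2 * Real.pi * Complex.I * a ^ m := by
    intro a ha
    have hd : Differentiable ℂ fun w : ℂ => w ^ m := by fun_prop
    have := hd.diffContOnCl.circleIntegral_sub_inv_smul (R := R) (c := c) (w := a) ha
    simp only [smul_eq_mul] at this
    rw [← this]
    simp only [mul_comm]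
  have hci : ∀ a ∈ ball c R, CircleIntegrable (fun w => w ^ m * (w - a)⁻¹) c R := by
    intro a ha
    refine ContinuousOn.circleIntegrable hR.le fun w hw => ?_
    have : w - a ≠ 0 := by
      rintro h
      rw [sub_eq_zero] at h
      subst h
      exact absurd (mem_sphere.1 hw) (mem_ball.1 ha).ne
    exact (ContinuousAt.mul (by fun_prop) ((by fun_prop : ContinuousAt (fun w => w - a) w).inv₀
      this)).continuousWithinAt
  have h4 : ∀ s : Multiset ℂ, (∀ a ∈ s, a ∈ ball c R) →
      CircleIntegrable (fun w => (s.map fun a => w ^ m * (w - a)⁻¹).sum) c R ∧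
      (∮ w in C(c, R), (s.map fun a => w ^ m * (w - a)⁻¹).sum) =
        2 * Real.pi * Complex.I * (s.map fun a => a ^ m).sum := by
    intro s
    induction s using Multiset.induction with
    | empty => simp [circleIntegral]
    | cons a s ih =>
      intro hs
      simp only [Multiset.mem_cons, forall_eq_or_imp] at hs
      obtain ⟨i1, i2⟩ := ih hs.2
      simp only [Multiset.map_cons, Multiset.sum_cons]
      refine ⟨(hci a hs.1).add i1, ?_⟩
      rw [circleIntegral.integral_add (hci a hs.1) i1, h3 a hs.1, i2, mul_add]
  rw [h1, circleIntegral.integral_add (h4 s hs).1, h2, (h4 s hs).2, add_zero]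
  exact (hqq.continuousOn.mono sphere_subset_closedBall).circleIntegrable hR.le

end OneVariable

/-! ### Uniform integrability of logarithmic derivatives in one variable. -/

section OneVariable
open Metric Set MeasureTheory
open scoped ENNReal

/-- A holomorphic function which is larger on the boundary of a disc than at the centre has a zero
in the disc. -/
theorem exists_zero_of_norm_lt {g : ℂ → ℂ} {c : ℂ} {R m : ℝ} (hR : 0 < R)
    (hg : DifferentiableOn ℂ g (closedBall c R)) (hm : ∀ w ∈ sphere c R, m ≤ ‖g w‖)
    (hc : ‖g c‖ < m) : ∃ w ∈ ball c R, g w = 0 := by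
  by_contra! h
  have hm0 : 0 < m := (norm_nonneg _).trans_lt hc
  have hne : ∀ w ∈ closedBall c R, g w ≠ 0 := by
    intro w hw
    rw [← ball_union_sphere] at hw
    rcases hw with hw | hw
    · exact h w hw
    · exact norm_pos_iff.1 (hm0.trans_le (hm w hw))
  -- If `g` had no zeros, `1 / g` would be larger at the centre than on the boundary, against the
  -- maximum principle.
  have hd : DiffContOnCl ℂ (fun w => (g w)⁻¹) (ball c R) := by
    refine DifferentiableOn.diffContOnCl ?_
    rw [closure_ball c hR.ne']
    exact hg.inv hne
  have h1 := Complex.norm_le_of_forall_mem_frontier_norm_le (C := m⁻¹) isBounded_ball hd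
    (fun w hw => by
      rw [frontier_ball c hR.ne'] at hw
      rw [norm_inv]
      exact inv_anti₀ hm0 (hm w hw)) (subset_closure (mem_ball_self hR))
  rw [norm_inv, inv_le_inv₀ (norm_pos_iff.2 (h c (mem_ball_self hR))) hm0] at h1
  exact absurd hc (not_lt.2 h1)

theorem lintegral_ball_inv_lt_top (R : ℝ) :
    ∫⁻ w in ball (0 : ℂ) R, ‖w⁻¹‖ₑ < ⊤ := by
  have h := integrableOn_ball_of_norm_le_rpow (E := ℂ) (F := ℂ) (μ := volume)
    (f := fun w => w⁻¹) (C := 1) (α := 1) (r := R) (by simp) (by simp)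
    (Filter.Eventually.of_forall fun w => by simp [Real.rpow_neg_one])
    (by fun_prop)
  exact h.2

/-- A bound for the integral of a logarithmic derivative which depends only on bounds for the
function and its derivative. -/
theorem exists_lintegral_logDeriv_bound {R m B : ℝ} (hR : 0 < R) (hm : 0 < m) (hB : 0 ≤ B) :
    ∃ K : ℝ≥0∞, K < ⊤ ∧ ∀ (g : ℂ → ℂ) (c : ℂ), AnalyticOnNhd ℂ g (closedBall c R) →
      (∀ w ∈ closedBall c R, R / 2 ≤ dist w c → m ≤ ‖g w‖) →
      (∀ w ∈ closedBall c R, ‖deriv g w‖ ≤ B) →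
      ∫⁻ w in ball c (R / 2), ‖deriv g w / g w‖ₑ ≤ K := by
  set κ := ∫⁻ w in ball (0 : ℂ) R, ‖w⁻¹‖ₑ with hκ
  -- On the circle `|g' / g| ≤ B / m`, so by the argument principle `g` has at most `N` zeros. `K₁`
  -- bounds `q' / q`, where `q` is the zero-free factor: on the circle each zero contributes at most
  -- `(R / 2)⁻¹` to the difference from `g' / g`, and the maximum principle carries the bound
  -- inside.
  set N : ℝ := R * (B / m) with hN
  set K₁ : ℝ := B / m + N * (R / 2)⁻¹ with hK₁
  have hN0 : 0 ≤ N := by positivity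
  refine ⟨ENNReal.ofReal N * κ + ENNReal.ofReal K₁ * volume (ball (0 : ℂ) (R / 2)), ?_, ?_⟩
  · refine ENNReal.add_lt_top.2 ⟨ENNReal.mul_lt_top ENNReal.ofReal_lt_top
      (lintegral_ball_inv_lt_top R), ENNReal.mul_lt_top ENNReal.ofReal_lt_top measure_ball_lt_top⟩
  intro g c hg hgm hgB
  have h0 : ∀ w ∈ sphere c R, g w ≠ 0 := fun w hw => norm_pos_iff.1 (hm.trans_le
    (hgm w (sphere_subset_closedBall hw) (by rw [mem_sphere.1 hw]; linarith)))
  have hlog : ∀ w ∈ sphere c R, ‖deriv g w / g w‖ ≤ B / m := fun w hw => by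
    rw [norm_div]
    exact div_le_div₀ hB (hgB w (sphere_subset_closedBall hw)) hm
      (hgm w (sphere_subset_closedBall hw) (by rw [mem_sphere.1 hw]; linarith))
  obtain ⟨s, q, hs, hq, hq0, hgq⟩ := exists_multiset_factorization hR hg h0
  have hcard : (Multiset.card s : ℝ) ≤ N := by
    have h1 := circleIntegral_pow_mul_logDeriv hR hs h0 hq hq0 hgq 0
    have h2 := circleIntegral.norm_integral_le_of_norm_le_const hR.le hlog
    simp only [pow_zero, one_mul, Multiset.map_const', Multiset.sum_replicate, nsmul_eq_mul,
      mul_one] at h1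
    rw [h1] at h2
    simp only [norm_mul, Complex.norm_I, Complex.norm_real, Complex.norm_natCast,
      Complex.norm_ofNat, Real.norm_eq_abs, abs_of_pos Real.pi_pos, mul_one] at h2
    have : 0 < 2 * Real.pi := by positivity
    rw [mul_assoc (2 * Real.pi)] at h2
    exact le_of_mul_le_mul_left h2 this
  have hs' : ∀ a ∈ s, dist a c < R / 2 := by
    intro a ha
    by_contra! hlt
    have haU := ball_subset_closedBall (hs a ha)
    have := hgm a haU hlt
    rw [(hgq a haU).eq_of_nhds, Multiset.prod_eq_zero (Multiset.mem_map.2 ⟨a, ha, sub_self a⟩),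
      zero_mul, norm_zero] at this
    linarith
  have hnorm : ∀ s : Multiset ℂ, ∀ r : ℝ, ∀ w, (∀ a ∈ s, r ≤ dist w a) → 0 < r →
      ‖(s.map fun a => (w - a)⁻¹).sum‖ ≤ Multiset.card s * r⁻¹ := by
    intro s r w h hr
    refine (norm_multiset_sum_le _).trans ?_
    refine (Multiset.sum_le_card_nsmul _ r⁻¹ ?_).trans (by simp)
    intro y hy
    simp only [Multiset.map_map, Multiset.mem_map, Function.comp] at hy
    obtain ⟨a, ha, rfl⟩ := hy
    rw [norm_inv, ← dist_eq_norm]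
    exact inv_anti₀ hr (h a ha)
  have hqq : AnalyticOnNhd ℂ (fun w => deriv q w / q w) (closedBall c R) := fun w hw =>
    ((hq w hw).deriv).div (hq w hw) (hq0 w hw)
  have hqb : ∀ w ∈ closedBall c R, ‖deriv q w / q w‖ ≤ K₁ := by
    have hd : DiffContOnCl ℂ (fun w => deriv q w / q w) (ball c R) := by
      refine DifferentiableOn.diffContOnCl ?_
      rw [closure_ball c hR.ne']
      exact hqq.differentiableOn
    intro w hw
    rw [← closure_ball c hR.ne'] at hw
    refine Complex.norm_le_of_forall_mem_frontier_norm_le isBounded_ball hd (fun w hw => ?_) hw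
    rw [frontier_ball c hR.ne'] at hw
    have hw' := sphere_subset_closedBall hw
    have h1 := deriv_div_eq_of_factorization (hgq w hw') (hq w hw').differentiableAt (h0 w hw)
    have h2 : deriv q w / q w = deriv g w / g w - (s.map fun a => (w - a)⁻¹).sum := by
      rw [h1]; ring
    rw [h2, hK₁]
    refine (norm_sub_le _ _).trans (add_le_add (hlog w hw) ?_)
    refine (hnorm s (R / 2) w (fun a ha => ?_) (by positivity)).trans (by gcongr)
    have := hs' a ha
    have h3 := dist_triangle_right w c a
    have h4 := dist_triangle w a c
    rw [mem_sphere.1 hw] at h4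
    linarith
  have hpt : ∀ w ∈ ball c (R / 2), ‖deriv g w / g w‖ₑ ≤
      (s.map fun a => ‖(w - a)⁻¹‖ₑ).sum + ENNReal.ofReal K₁ := by
    intro w hw
    have hwU : w ∈ closedBall c R := closedBall_subset_closedBall (by linarith)
      (ball_subset_closedBall hw)
    -- At a zero of `g` the quotient is `0` by convention.
    by_cases hgw : g w = 0
    · simp [hgw]
    rw [deriv_div_eq_of_factorization (hgq w hwU) (hq w hwU).differentiableAt hgw]
    refine (enorm_add_le _ _).trans (add_le_add ?_ ?_)
    · clear hs hgq hcard hs'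
      induction s using Multiset.induction with
      | empty => simp
      | cons a s ih =>
        simp only [Multiset.map_cons, Multiset.sum_cons]
        exact (enorm_add_le _ _).trans (by gcongr)
    · rw [← ofReal_norm]
      exact ENNReal.ofReal_le_ofReal (hqb w hwU)
  refine (setLIntegral_mono' measurableSet_ball hpt).trans ?_
  have hmeas : ∀ s : Multiset ℂ, Measurable fun w => (s.map fun a => ‖(w - a)⁻¹‖ₑ).sum := by
    intro s
    induction s using Multiset.induction with
    | empty => simp
    | cons a s ih =>
      simp only [Multiset.map_cons, Multiset.sum_cons]
      fun_prop
  rw [lintegral_add_left (hmeas s), lintegral_const, Measure.restrict_apply MeasurableSet.univ,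
    univ_inter]
  refine add_le_add ?_ (by rw [Measure.addHaar_ball_center])
  have hone : ∀ a, dist a c < R / 2 → ∫⁻ w in ball c (R / 2), ‖(w - a)⁻¹‖ₑ ≤ κ := by
    intro a ha
    have h1 : ball c (R / 2) ⊆ ball a R := fun w hw => by
      have := dist_triangle_right w a c
      rw [mem_ball] at hw ⊢
      linarith
    refine (lintegral_mono_set h1).trans ?_
    have h2 : ball a R = (fun w => w - a) ⁻¹' ball 0 R := by
      ext w; simp [dist_eq_norm]
    rw [h2, hκ]
    exact ((measurePreserving_sub_right volume a).setLIntegral_comp_preimage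
      measurableSet_ball (f := fun w => ‖w⁻¹‖ₑ) (by fun_prop)).le
  have hsum : ∀ s : Multiset ℂ, (∀ a ∈ s, dist a c < R / 2) →
      ∫⁻ w in ball c (R / 2), (s.map fun a => ‖(w - a)⁻¹‖ₑ).sum ≤ Multiset.card s * κ := by
    intro s
    induction s using Multiset.induction with
    | empty => simp
    | cons a s ih =>
      intro hs
      simp only [Multiset.mem_cons, forall_eq_or_imp] at hs
      simp only [Multiset.map_cons, Multiset.sum_cons, Multiset.card_cons]
      rw [lintegral_add_left (by fun_prop)]
      push_cast
      rw [add_mul, add_comm, one_mul]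
      exact add_le_add (ih hs.2) (hone a hs.1)
  refine (hsum s hs').trans ?_
  gcongr
  rw [← ENNReal.ofReal_natCast]
  exact ENNReal.ofReal_le_ofReal hcard

end OneVariable

/-! ### Recovering the distinct elements of a multiset from its power sums. -/

section Hankel
open Polynomial

/-- The sum of the `n`-th powers of the elements of a multiset. -/
def powerSum (s : Multiset ℂ) (n : ℕ) : ℂ := (s.map fun a => a ^ n).sum

/-- The Hankel matrix of a sequence. -/
def hankel (p : ℕ → ℂ) (k : ℕ) : Matrix (Fin k) (Fin k) ℂ :=
  Matrix.of fun i j => p (i + j)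

/-- The monic polynomial with simple zeros at the elements of a finite set. -/
def simplePoly (t : Finset ℂ) : ℂ[X] := ∏ a ∈ t, (X - C a)

theorem simplePoly_monic (t : Finset ℂ) : (simplePoly t).Monic :=
  monic_prod_of_monic _ _ fun a _ => monic_X_sub_C a

theorem simplePoly_natDegree (t : Finset ℂ) : (simplePoly t).natDegree = t.card := by
  rw [simplePoly, natDegree_prod_of_monic _ _ fun a _ => monic_X_sub_C a]
  simp

theorem simplePoly_eval (t : Finset ℂ) (w : ℂ) :
    (simplePoly t).eval w = ∏ a ∈ t, (w - a) := by
  simp [simplePoly, eval_prod]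

/-- Collecting the terms of each element `a` gives `∑ aⁱ p(a)`. Hence the coefficient vector of a
polynomial vanishing on `s` is in the kernel of every large enough Hankel matrix. -/
theorem sum_coeff_mul_powerSum (s : Multiset ℂ) (i n : ℕ) (p : ℂ[X]) (hp : p.natDegree < n)
    (h0 : ∀ a ∈ s, p.eval a = 0) :
    ∑ j ∈ Finset.range n, powerSum s (i + j) * p.coeff j = 0 := by
  have h1 : ∑ j ∈ Finset.range n, powerSum s (i + j) * p.coeff j
      = (s.map fun a => a ^ i * p.eval a).sum := by
    simp only [powerSum, ← Multiset.sum_map_mul_right]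
    rw [← Multiset.sum_map_sum]
    congr 1
    refine Multiset.map_congr rfl fun a _ => ?_
    rw [eval_eq_sum_range' hp, Finset.mul_sum]
    refine Finset.sum_congr rfl fun j _ => by ring
  rw [h1]
  refine Multiset.sum_eq_zero fun x hx => ?_
  obtain ⟨a, ha, rfl⟩ := Multiset.mem_map.1 hx
  rw [h0 a ha, mul_zero]

theorem simplePoly_eval_eq_zero {s : Multiset ℂ} {a : ℂ} (ha : a ∈ s) :
    (simplePoly s.toFinset).eval a = 0 := by
  rw [simplePoly_eval]
  exact Finset.prod_eq_zero (Multiset.mem_toFinset.2 ha) (sub_self a)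

/-- If there are fewer than `k` distinct elements, the coefficients of their monic polynomial,
padded by zeros, form a kernel vector with an entry `1`. -/
theorem card_ge_of_det_hankel_ne_zero {s : Multiset ℂ} {k : ℕ}
    (h : (hankel (powerSum s) k).det ≠ 0) : k ≤ s.toFinset.card := by
  by_contra! hlt
  refine h (Matrix.exists_mulVec_eq_zero_iff.1
    ⟨fun j => (simplePoly s.toFinset).coeff j, fun hc => ?_, ?_⟩)
  · have h1 := congrFun hc ⟨s.toFinset.card, hlt⟩
    have h2 := simplePoly_monic s.toFinset
    rw [Monic, leadingCoeff, simplePoly_natDegree] at h2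
    simp [h2] at h1
  · ext i
    have h1 := sum_coeff_mul_powerSum s i k (simplePoly s.toFinset)
      (by rwa [simplePoly_natDegree]) fun a ha => simplePoly_eval_eq_zero ha
    rw [← Fin.sum_univ_eq_sum_range (fun j => powerSum s (i + j) *
      (simplePoly s.toFinset).coeff j)] at h1
    exact h1

/-- The Hankel matrix is `Vᵀ D V`, with `V` the Vandermonde matrix of the distinct elements and `D`
the diagonal matrix of their multiplicities. -/
theorem det_hankel_ne_zero {s : Multiset ℂ} {k : ℕ} (hk : s.toFinset.card = k) :
    (hankel (powerSum s) k).det ≠ 0 := by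
  classical
  let e : Fin k ≃ s.toFinset := (s.toFinset.equivFinOfCardEq hk).symm
  let a : Fin k → ℂ := fun i => e i
  have hinj : Function.Injective a := Subtype.val_injective.comp e.injective
  have hH : hankel (powerSum s) k = (Matrix.vandermonde a).transpose *
      Matrix.diagonal (fun i => (s.count (a i) : ℂ)) * Matrix.vandermonde a := by
    ext i j
    rw [Matrix.mul_apply]
    simp only [hankel, Matrix.of_apply, Matrix.mul_diagonal,
      Matrix.transpose_apply, Matrix.vandermonde_apply]
    rw [powerSum, Finset.sum_multiset_map_count]
    rw [← Finset.sum_coe_sort, ← e.sum_comp]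
    refine Finset.sum_congr rfl fun x _ => ?_
    simp only [a, nsmul_eq_mul]
    ring
  rw [hH, Matrix.det_mul, Matrix.det_mul, Matrix.det_transpose, Matrix.det_diagonal]
  have hV := Matrix.det_vandermonde_ne_zero_iff.2 hinj
  refine mul_ne_zero (mul_ne_zero hV (Finset.prod_ne_zero_iff.2 fun i _ => ?_)) hV
  rw [Nat.cast_ne_zero, Multiset.count_ne_zero]
  exact Multiset.mem_toFinset.1 (e i).2

/-- The coefficients of the monic polynomial whose zeros are the distinct elements of a multiset
are rational functions of its power sums. -/
theorem simplePoly_coeff_eq {s : Multiset ℂ} {k : ℕ} (hk : s.toFinset.card = k) (j : Fin k) :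
    (simplePoly s.toFinset).coeff j = -((hankel (powerSum s) k).det⁻¹ *
      ((hankel (powerSum s) k).updateCol j fun i => powerSum s (i + k)).det) := by
  have hdet := det_hankel_ne_zero hk
  set H := hankel (powerSum s) k
  set c : Fin k → ℂ := fun j => (simplePoly s.toFinset).coeff j
  -- Since the leading coefficient is `1`, the relations between power sums become an inhomogeneous
  -- linear system for the other coefficients, solved by Cramer's rule.
  have h1 : H.mulVec c = fun i : Fin k => -powerSum s (i + k) := by
    ext i
    have h1 := sum_coeff_mul_powerSum s i (k + 1) (simplePoly s.toFinset)
      (by rw [simplePoly_natDegree, hk]; exact Nat.lt_succ_self k)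
      fun a ha => simplePoly_eval_eq_zero ha
    have h2 := simplePoly_monic s.toFinset
    rw [Monic, leadingCoeff, simplePoly_natDegree, hk] at h2
    rw [Finset.sum_range_succ, h2, mul_one, ← Fin.sum_univ_eq_sum_range (fun j =>
      powerSum s (i + j) * (simplePoly s.toFinset).coeff j)] at h1
    exact eq_neg_of_add_eq_zero_left h1
  have h2 : H.cramer (fun i : Fin k => -powerSum s (i + k)) = H.det • c := by
    rw [← h1, Matrix.cramer_eq_adjugate_mulVec, Matrix.mulVec_mulVec, Matrix.adjugate_mul,
      Matrix.smul_mulVec, Matrix.one_mulVec]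
  have h3 := congrFun h2 j
  have h4 : (fun i : Fin k => -powerSum s (i + k)) = -fun i : Fin k => powerSum s (i + k) := rfl
  rw [h4, map_neg, Pi.neg_apply, Matrix.cramer_apply, Pi.smul_apply, smul_eq_mul] at h3
  change c j = _
  field_simp
  rw [h3]
  ring

/-- Bounded zeros give bounded coefficients; this makes the singularity of the coefficients at an
exceptional slice removable. -/
theorem simplePoly_coeff_norm_le {t : Finset ℂ} {k : ℕ} (hk : t.card = k) {B : ℝ}
    (hB : ∀ a ∈ t, ‖a‖ ≤ B) (i : ℕ) :
    ‖(simplePoly t).coeff i‖ ≤ max B 1 ^ k * k.choose (k / 2) := by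
  have h := coeff_bdd_of_roots_le (B := B) (d := k) (RingHom.id ℂ) (simplePoly_monic t)
    (IsAlgClosed.splits _) (by rw [simplePoly_natDegree, hk]) (fun z hz => ?_) i
  · simpa using h
  · rw [Polynomial.map_id, simplePoly, roots_prod_X_sub_C] at hz
    exact hB z hz

theorem simplePoly_derivative_ne_zero {t : Finset ℂ} {a : ℂ} (ha : (simplePoly t).eval a = 0) :
    (derivative (simplePoly t)).eval a ≠ 0 := by
  have hsep : (simplePoly t).Separable :=
    separable_prod_X_sub_C_iff'.2 fun x _ y _ h => h
  simpa using hsep.aeval_derivative_ne_zero (x := a) (by simpa using ha)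

theorem differentiableOn_det {k : ℕ} {A : ℂ → Matrix (Fin k) (Fin k) ℂ} {U : Set ℂ}
    (h : ∀ i j, DifferentiableOn ℂ (fun z => A z i j) U) :
    DifferentiableOn ℂ (fun z => (A z).det) U := by
  simp only [Matrix.det_apply]
  refine DifferentiableOn.fun_sum fun σ _ => DifferentiableOn.const_smul ?_ _
  exact DifferentiableOn.fun_finsetProd fun i _ => h _ _

end Hankel

/-! ### Families of polynomials with simple zeros generate the ideal of their zero locus. -/

section TwoVariables
open Metric Set Filter Polynomial

variable {H : Type*} [NormedAddCommGroup H] [NormedSpace ℂ H]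

theorem slice_differentiableAt {F : H × ℂ → ℂ} {O : Set (H × ℂ)} (hO : IsOpen O)
    (hF : ContDiffOn ℂ ∞ F O) {z : H} {w : ℂ} (h : (z, w) ∈ O) :
    HasDerivAt (fun w => F (z, w)) (fderiv ℂ F (z, w) (0, 1)) w := by
  have h1 : HasFDerivAt F (fderiv ℂ F (z, w)) (z, w) :=
    ((hF.contDiffAt (hO.mem_nhds h)).differentiableAt (by simp)).hasFDerivAt
  exact (h1.comp w (hasFDerivAt_prodMk_right z w)).hasDerivAt

theorem slice_analyticAt {F : H × ℂ → ℂ} {O : Set (H × ℂ)} (hO : IsOpen O)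
    (hF : ContDiffOn ℂ ∞ F O) {z : H} {w : ℂ} (h : (z, w) ∈ O) :
    AnalyticAt ℂ (fun w => F (z, w)) w := by
  have hpre : IsOpen ((fun w => (z, w)) ⁻¹' O) := hO.preimage (by fun_prop)
  refine DifferentiableOn.analyticAt (s := (fun w => (z, w)) ⁻¹' O) (fun y hy => ?_)
    (hpre.mem_nhds h)
  exact (slice_differentiableAt hO hF hy).differentiableAt.differentiableWithinAt

/-- A small circle on which a function with an isolated zero has no zeros. -/
theorem exists_radius {O : Set (H × ℂ)} (hO : IsOpen O) {F : H × ℂ → ℂ} (hF : ContDiffOn ℂ ∞ F O)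
    {z₀ : H} {w₀ : ℂ} (hx : (z₀, w₀) ∈ O) (hne : ¬ ∀ᶠ w in 𝓝 w₀, F (z₀, w) = 0) :
    ∃ r > 0, (∀ w ∈ closedBall w₀ r, (z₀, w) ∈ O) ∧
      ∀ w ∈ closedBall w₀ r, w ≠ w₀ → F (z₀, w) ≠ 0 := by
  have h1 := (slice_analyticAt hO hF hx).eventually_eq_zero_or_eventually_ne_zero.resolve_left hne
  have h2 : ∀ᶠ w in 𝓝 w₀, (z₀, w) ∈ O :=
    (by fun_prop : ContinuousAt (fun w => (z₀, w)) w₀).eventually_mem (hO.mem_nhds hx)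
  rw [eventually_nhdsWithin_iff] at h1
  obtain ⟨r, hr, h⟩ := Metric.nhds_basis_closedBall.eventually_iff.1 (h1.and h2)
  exact ⟨r, hr, fun w hw => (h hw).2, fun w hw hww => (h hw).1 hww⟩

/-- The tube lemma: an open condition on a compact part of one slice persists in the nearby slices.
-/
theorem eventually_forall_of_isCompact {Y : Type*} [TopologicalSpace Y] {K : Set ℂ}
    (hK : IsCompact K) {z₀ : Y} {W : Set (Y × ℂ)} (hW : IsOpen W) (h : ∀ w ∈ K, (z₀, w) ∈ W) :
    ∀ᶠ z in 𝓝 z₀, ∀ w ∈ K, (z, w) ∈ W :=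
  hK.eventually_forall_of_forall_eventually fun w hw => hW.mem_nhds (h w hw)

/-- Zeros of a holomorphic function of two variables persist in the nearby slices. -/
theorem eventually_exists_zero {O : Set (H × ℂ)} (hO : IsOpen O) {F : H × ℂ → ℂ}
    (hF : ContDiffOn ℂ ∞ F O) {z₀ : H} {w₀ : ℂ} (hx : (z₀, w₀) ∈ O) (h0 : F (z₀, w₀) = 0)
    (hne : ¬ ∀ᶠ w in 𝓝 w₀, F (z₀, w) = 0) {N : Set (H × ℂ)} (hN : N ∈ 𝓝 (z₀, w₀)) :
    ∀ᶠ z in 𝓝 z₀, ∃ w, (z, w) ∈ N ∧ F (z, w) = 0 := by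
  -- Intersecting with the interior of `N` puts the whole disc, and so the zero to be found, inside
  -- `N`.
  obtain ⟨r, hr, hrO, hrF⟩ := exists_radius (O := O ∩ interior N) (hO.inter isOpen_interior)
    (hF.mono inter_subset_left) ⟨hx, mem_interior_iff_mem_nhds.2 hN⟩ hne
  have hcont : ContinuousOn F O := hF.continuousOn
  have hsub : ∀ w ∈ sphere w₀ r, (z₀, w) ∈ O := fun w hw =>
    (hrO w (sphere_subset_closedBall hw)).1
  have hFs : ContinuousOn (fun w => ‖F (z₀, w)‖) (sphere w₀ r) :=
    (hcont.comp (by fun_prop) hsub).norm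
  obtain ⟨w₁, hw₁, hmin⟩ := (isCompact_sphere w₀ r).exists_isMinOn
    ((NormedSpace.sphere_nonempty (x := w₀)).2 hr.le) hFs
  set m := ‖F (z₀, w₁)‖ with hm
  have hm0 : 0 < m := norm_pos_iff.2 (hrF w₁ (sphere_subset_closedBall hw₁) (by
    rintro rfl; simp [hr.ne] at hw₁))
  -- In the nearby slices `‖F‖ > m / 2` on the circle and `‖F‖ < m / 2` at the centre, as
  -- `exists_zero_of_norm_lt` requires.
  have hW : IsOpen (O ∩ {y | m / 2 < ‖F y‖}) :=
    hcont.norm.isOpen_inter_preimage hO isOpen_Ioi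
  have hW' : IsOpen (O ∩ {y | ‖F y‖ < m / 2}) :=
    hcont.norm.isOpen_inter_preimage hO isOpen_Iio
  have e1 := eventually_forall_of_isCompact (isCompact_sphere w₀ r) hW fun w hw =>
    ⟨hsub w hw, by have := hmin hw; simp only [mem_ofPred_eq] at this ⊢; linarith⟩
  have e2 := eventually_forall_of_isCompact (isCompact_closedBall w₀ r)
    (hO.inter isOpen_interior) hrO
  have e3 := eventually_forall_of_isCompact isCompact_singleton hW' (z₀ := z₀) (K := {w₀})
    (by rintro w rfl; exact ⟨hx, by simp only [mem_ofPred_eq, h0, norm_zero]; linarith⟩)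
  filter_upwards [e1, e2, e3] with z h1 h2 h3
  obtain ⟨w, hw, hw0⟩ := exists_zero_of_norm_lt (g := fun w => F (z, w)) (m := m / 2) hr
    (fun w hw => (slice_differentiableAt hO hF (h2 w hw).1).differentiableAt.differentiableWithinAt)
    (fun w hw => (h1 w hw).2.le) (h3 w₀ rfl).2
  exact ⟨w, interior_subset (h2 w (ball_subset_closedBall hw)).2, hw0⟩

/-- A family of polynomials in `w`, holomorphic in `z`, with simple zeros for `z ≠ z₀`. -/
structure IsReducedFamily (z₀ : ℂ) (δ : ℝ) (P : ℂ × ℂ → ℂ) : Prop where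
  smooth : ContDiffOn ℂ ∞ P (ball z₀ δ ×ˢ univ)
  exists_poly : ∀ z ∈ ball z₀ δ, ∃ p : ℂ[X], p ≠ 0 ∧ ∀ w, P (z, w) = p.eval w
  exists_simple : ∀ z ∈ ball z₀ δ, z ≠ z₀ → ∃ t, ∀ w, P (z, w) = (simplePoly t).eval w

namespace IsReducedFamily

variable {z₀ : ℂ} {δ : ℝ} {P : ℂ × ℂ → ℂ}

theorem not_eventually_zero (hP : IsReducedFamily z₀ δ P) {z : ℂ} (hz : z ∈ ball z₀ δ) (w : ℂ) :
    ¬ ∀ᶠ w' in 𝓝 w, P (z, w') = 0 := by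
  obtain ⟨p, hp, hpP⟩ := hP.exists_poly z hz
  intro h
  refine hp (p.eq_zero_of_infinite_isRoot ((infinite_of_mem_nhds w h).mono fun y hy => ?_))
  exact (hpP y).symm.trans hy

theorem isOpen (z₀ : ℂ) (δ : ℝ) :
    IsOpen (ball z₀ δ ×ˢ (univ : Set ℂ)) := isOpen_ball.prod isOpen_univ

/-- Points with nonzero derivative are dense in the zero locus. -/
theorem exists_regular (hP : IsReducedFamily z₀ δ P) {x : ℂ × ℂ} (hx : x.1 ∈ ball z₀ δ)
    (h0 : P x = 0) {N : Set (ℂ × ℂ)} (hN : N ∈ 𝓝 x) :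
    ∃ y ∈ N, P y = 0 ∧ fderiv ℂ P y (0, 1) ≠ 0 := by
  have h1 := eventually_exists_zero (isOpen z₀ δ) hP.smooth (z₀ := x.1) (w₀ := x.2)
    ⟨hx, mem_univ _⟩ h0 (hP.not_eventually_zero hx x.2) hN
  -- Zeros may be multiple in the slice `z₀` only, so it suffices to move to a zero in another
  -- slice.
  have h2 : ∃ᶠ z in 𝓝 x.1, z ≠ z₀ := by
    by_cases hxz : x.1 = z₀
    · rw [hxz]
      exact (Filter.Eventually.frequently (f := 𝓝[≠] z₀) eventually_mem_nhdsWithin).filter_mono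
        nhdsWithin_le_nhds
    · exact (eventually_ne_nhds hxz).frequently
  obtain ⟨z, hz, ⟨w, hw, hw0⟩, hzb⟩ :=
    (h2.and_eventually (h1.and (isOpen_ball.mem_nhds hx))).exists
  refine ⟨(z, w), hw, hw0, ?_⟩
  obtain ⟨t, ht⟩ := hP.exists_simple z hzb hz
  have hd := slice_differentiableAt (isOpen z₀ δ) hP.smooth (z := z) (w := w) ⟨hzb, mem_univ _⟩
  have hd' := (simplePoly t).hasDerivAt w
  simp only [ht] at hd
  rw [hd.unique hd']
  exact simplePoly_derivative_ne_zero (by rw [← ht, hw0])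

end IsReducedFamily

/-- A holomorphic function of one variable vanishing on a finite set is divisible by the polynomial
with simple zeros there. -/
theorem exists_eq_simplePoly_mul {U : Set ℂ} (t : Finset ℂ) {f : ℂ → ℂ}
    (hf : AnalyticOnNhd ℂ f U) (h0 : ∀ a ∈ t, a ∈ U → f a = 0) :
    ∃ g, AnalyticOnNhd ℂ g U ∧ ∀ w ∈ U, f w = (simplePoly t).eval w * g w := by
  induction t using Finset.induction_on with
  | empty => exact ⟨f, hf, fun w _ => by simp [simplePoly]⟩
  | insert a t ha ih =>
    obtain ⟨g, hg, hfg⟩ := ih fun b hb => h0 b (Finset.mem_insert_of_mem hb)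
    have hmul : ∀ w, (simplePoly (insert a t)).eval w = (w - a) * (simplePoly t).eval w := by
      intro w
      simp only [simplePoly_eval, Finset.prod_insert ha]
    by_cases haU : a ∈ U
    · have hga : g a = 0 := by
        have h1 := h0 a (Finset.mem_insert_self a t) haU
        rw [hfg a haU] at h1
        refine (mul_eq_zero.1 h1).resolve_left ?_
        rw [simplePoly_eval, ← ne_eq, Finset.prod_ne_zero_iff]
        intro b hb hab
        rw [sub_eq_zero.1 hab] at ha
        exact ha hb
      refine ⟨dslope g a, fun w hw => ?_, fun w hw => ?_⟩
      · have hopen := isOpen_analyticAt ℂ g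
        have hd : DifferentiableOn ℂ g {x | AnalyticAt ℂ g x} := fun x hx =>
          AnalyticAt.differentiableAt hx |>.differentiableWithinAt
        exact ((Complex.differentiableOn_dslope (hopen.mem_nhds (hg a haU))).2 hd).analyticAt
          (hopen.mem_nhds (hg w hw))
      · have h1 := sub_smul_dslope g a w
        rw [hga, sub_zero, smul_eq_mul] at h1
        rw [hfg w hw, hmul, ← h1]
        ring
    · refine ⟨fun w => g w / (w - a), fun w hw => ?_, fun w hw => ?_⟩
      · refine (hg w hw).div (analyticAt_id.sub analyticAt_const) ?_
        simp only [ne_eq, sub_eq_zero]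
        rintro rfl
        exact haU hw
      · have : w - a ≠ 0 := by
          rw [ne_eq, sub_eq_zero]
          rintro rfl
          exact haU hw
        rw [hfg w hw, hmul]
        field_simp

/-- Cauchy's formula for the quotient of a holomorphic function by a polynomial with simple zeros at
which the function vanishes. -/
theorem eq_circleIntegral_div_mul {c : ℂ} {r : ℝ} (hr : 0 < r) (t : Finset ℂ) {f p : ℂ → ℂ}
    (hp : ∀ w, p w = (simplePoly t).eval w) (hf : AnalyticOnNhd ℂ f (closedBall c r))
    (h0 : ∀ w ∈ closedBall c r, p w = 0 → f w = 0) (hp0 : ∀ w ∈ sphere c r, p w ≠ 0) {w : ℂ}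
    (hw : w ∈ ball c r) :
    f w = (2 * Real.pi * Complex.I : ℂ)⁻¹ * (∮ ζ in C(c, r), f ζ / p ζ / (ζ - w)) * p w := by
  obtain ⟨g, hg, hfg⟩ := exists_eq_simplePoly_mul (U := closedBall c r) t hf
    (fun a ha haU => h0 a haU (by
      rw [hp, simplePoly_eval]; exact Finset.prod_eq_zero ha (sub_self a)))
  have h1 : DiffContOnCl ℂ g (ball c r) := by
    refine DifferentiableOn.diffContOnCl ?_
    rw [closure_ball c hr.ne']
    exact hg.differentiableOn
  have h2 := h1.two_pi_i_inv_smul_circleIntegral_sub_inv_smul hw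
  have h3 : (∮ ζ in C(c, r), f ζ / p ζ / (ζ - w)) = ∮ ζ in C(c, r), (ζ - w)⁻¹ • g ζ := by
    refine circleIntegral.integral_congr hr.le fun ζ hζ => ?_
    have h4 := hfg ζ (sphere_subset_closedBall hζ)
    rw [← hp] at h4
    simp only [h4, smul_eq_mul]
    rw [mul_div_cancel_left₀ _ (hp0 ζ hζ), div_eq_inv_mul]
  rw [smul_eq_mul] at h2
  rw [h3, h2, hp, mul_comm]
  exact hfg w (ball_subset_closedBall hw)

namespace IsReducedFamily

variable {z₀ : ℂ} {δ : ℝ} {P : ℂ × ℂ → ℂ}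

/-- Every holomorphic function vanishing on the zero locus of a reduced family is divisible by
it. -/
theorem exists_eq_mul (hP : IsReducedFamily z₀ δ P) {x : ℂ × ℂ} (hx : x.1 ∈ ball z₀ δ)
    {N : Set (ℂ × ℂ)} (hN : IsOpen N) (hxN : x ∈ N) {f : ℂ × ℂ → ℂ} (hf : ContDiffOn ℂ ∞ f N)
    (hf0 : ∀ y ∈ N, P y = 0 → f y = 0) :
    ∃ (N' : Set (ℂ × ℂ)) (q : ℂ × ℂ → ℂ), IsOpen N' ∧ x ∈ N' ∧ ContDiffOn ℂ ∞ q N' ∧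
      ∀ y ∈ N', f y = q y * P y := by
  obtain ⟨z₁, w₁⟩ := x
  set O := (ball z₀ δ ×ˢ (univ : Set ℂ)) ∩ N with hOdef
  have hO : IsOpen O := (isOpen z₀ δ).inter hN
  have hxO : (z₁, w₁) ∈ O := ⟨⟨hx, mem_univ _⟩, hxN⟩
  have hPO : ContDiffOn ℂ ∞ P O := hP.smooth.mono inter_subset_left
  have hfO : ContDiffOn ℂ ∞ f O := hf.mono inter_subset_right
  obtain ⟨r, hr, hrO, hrP⟩ := exists_radius hO hPO hxO (hP.not_eventually_zero hx w₁)
  set O' := O ∩ {y | P y ≠ 0} with hO'def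
  have hO' : IsOpen O' := hPO.continuousOn.isOpen_inter_preimage hO isOpen_ne
  have e1 := eventually_forall_of_isCompact (isCompact_closedBall w₁ r) hO hrO
  have e2 := eventually_forall_of_isCompact (isCompact_sphere w₁ r) hO' fun w hw =>
    ⟨hrO w (sphere_subset_closedBall hw), hrP w (sphere_subset_closedBall hw) (by
      rintro rfl; simp [hr.ne] at hw)⟩
  obtain ⟨ρ, hρ, h⟩ := Metric.nhds_basis_ball.eventually_iff.1 (e1.and e2)
  set N' := ball z₁ ρ ×ˢ ball w₁ r with hN'
  have hN'o : IsOpen N' := isOpen_ball.prod isOpen_ball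
  -- Cauchy's integral for the quotient `f / P` uses its values on the circle only, where `P ≠ 0`.
  -- It is therefore holomorphic over `z₀` too, where the slice of `P` may have multiple zeros.
  set q : ℂ × ℂ → ℂ := fun y => (2 * Real.pi * Complex.I : ℂ)⁻¹ *
    ∮ ζ in C(w₁, r), f (y.1, ζ) / P (y.1, ζ) / (ζ - y.2) with hq
  have hqs : ContDiffOn ℂ ∞ q N' := by
    set Q : Set ((ℂ × ℂ) × ℂ) := {y | (y.1.1, y.2) ∈ O' ∧ y.2 - y.1.2 ≠ 0} with hQ
    have hQo : IsOpen Q := (hO'.preimage (by fun_prop)).inter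
      (isOpen_ne.preimage (f := fun y : (ℂ × ℂ) × ℂ => y.2 - y.1.2) (by fun_prop))
    have hmap : MapsTo (fun y : (ℂ × ℂ) × ℂ => (y.1.1, y.2)) Q O' := fun y hy => hy.1
    have hmapO : MapsTo (fun y : (ℂ × ℂ) × ℂ => (y.1.1, y.2)) Q O := fun y hy => hy.1.1
    have hsm : ContDiffOn ℂ ∞ (fun y : (ℂ × ℂ) × ℂ => (y.1.1, y.2)) Q := by fun_prop
    refine contDiffOn_const.mul (contDiffOn_circleIntegral hN'o hr.le hQo ?_
      (F := fun y => f (y.1.1, y.2) / P (y.1.1, y.2) / (y.2 - y.1.2)) ?_)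
    · rintro ⟨⟨z, w⟩, ζ⟩ ⟨⟨hz, hw⟩, hζ⟩
      refine ⟨(h hz).2 ζ hζ, fun h0 => ?_⟩
      rw [sub_eq_zero] at h0
      simp only at h0 hw
      rw [mem_sphere] at hζ
      rw [← h0, mem_ball] at hw
      exact hw.ne hζ
    · exact ((hfO.comp hsm hmapO).div (hPO.comp hsm hmapO) fun y hy => hy.1.2).div
        (by fun_prop) fun y hy => hy.2
  have hgen : ∀ y ∈ N', y.1 ≠ z₀ → f y = q y * P y := by
    rintro ⟨z, w⟩ ⟨hz, hw⟩ hne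
    simp only at hz hw hne
    have hzO := fun w hw => (h hz).1 w hw
    have hzb : z ∈ ball z₀ δ := (hzO w₁ (mem_closedBall_self hr.le)).1.1
    obtain ⟨t, ht⟩ := hP.exists_simple z hzb hne
    exact eq_circleIntegral_div_mul hr t ht
      (fun w hw => slice_analyticAt hO hfO (hzO w hw))
      (fun w hw hPw => hf0 _ (hzO w hw).2 hPw) (fun w hw => ((h hz).2 w hw).2) hw
  refine ⟨N', q, hN'o, ⟨mem_ball_self hρ, mem_ball_self hr⟩, hqs, fun y hy => ?_⟩
  -- Over `z₀` the identity follows by continuity from the other slices.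
  by_cases hyz : y.1 = z₀
  · have hyO : y ∈ O := (h hy.1).1 y.2 (ball_subset_closedBall hy.2)
    have c1 : ContinuousAt f y := (hfO.continuousOn.continuousAt (hO.mem_nhds hyO))
    have c2 : ContinuousAt (fun y => q y * P y) y :=
      ((hqs.continuousOn.continuousAt (hN'o.mem_nhds hy))).mul
        (hPO.continuousOn.continuousAt (hO.mem_nhds hyO))
    have c3 : Tendsto (fun z => (z, y.2)) (𝓝[≠] y.1) (𝓝 y) :=
      ((by fun_prop : ContinuousAt (fun z => (z, y.2)) y.1)).mono_left nhdsWithin_le_nhds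
    refine tendsto_nhds_unique ((c1.tendsto.comp c3).congr' ?_) (c2.tendsto.comp c3)
    have hm := c3.eventually (hN'o.mem_nhds hy)
    filter_upwards [hm, eventually_mem_nhdsWithin] with z hz hzne
    exact hgen _ hz (by simpa [hyz] using hzne)
  · exact hgen y hy hyz

end IsReducedFamily

end TwoVariables

/-! ### Construction of reduced families of polynomials for plane curves. -/

section TwoVariables
open Metric Set Filter Polynomial

/-- The zeros of a holomorphic function of two variables in the slices near a point, given by
multisets whose power sums depend holomorphically on the slice. -/
theorem exists_zeros_multiset {O : Set (ℂ × ℂ)} (hO : IsOpen O) {h : ℂ × ℂ → ℂ}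
    (hh : ContDiffOn ℂ ∞ h O) {z₀ w₀ : ℂ} {r : ℝ} (hr : 0 < r)
    (hrO : ∀ w ∈ closedBall w₀ r, (z₀, w) ∈ O)
    (hrh : ∀ w ∈ sphere w₀ r, h (z₀, w) ≠ 0) :
    ∃ δ > 0, ∃ s : ℂ → Multiset ℂ,
      (∀ z ∈ ball z₀ δ, ∀ w ∈ closedBall w₀ r, (z, w) ∈ O) ∧
      (∀ z ∈ ball z₀ δ, ∀ a ∈ s z, a ∈ ball w₀ r) ∧
      (∀ z ∈ ball z₀ δ, ∀ w ∈ closedBall w₀ r, h (z, w) = 0 ↔ w ∈ s z) ∧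
      (∀ n, DifferentiableOn ℂ (fun z => powerSum (s z) n) (ball z₀ δ)) ∧
      ∃ B : ℕ, ∀ z ∈ ball z₀ δ, Multiset.card (s z) ≤ B := by
  set O' := O ∩ {y | h y ≠ 0} with hO'def
  have hO' : IsOpen O' := hh.continuousOn.isOpen_inter_preimage hO isOpen_ne
  have e1 := eventually_forall_of_isCompact (isCompact_closedBall w₀ r) hO hrO
  have e2 := eventually_forall_of_isCompact (isCompact_sphere w₀ r) hO' fun w hw =>
    ⟨hrO w (sphere_subset_closedBall hw), hrh w hw⟩
  obtain ⟨δ₀, hδ₀, hδ⟩ := Metric.nhds_basis_ball.eventually_iff.1 (e1.and e2)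
  -- The multisets are chosen slice by slice, without any continuity. Their power sums are contour
  -- integrals, and this is what makes them holomorphic in `z`.
  have hfac : ∀ z ∈ ball z₀ δ₀, ∃ s : Multiset ℂ, (∀ a ∈ s, a ∈ ball w₀ r) ∧
      (∀ w ∈ closedBall w₀ r, h (z, w) = 0 ↔ w ∈ s) ∧
      ∀ n, powerSum s n = (2 * Real.pi * Complex.I : ℂ)⁻¹ *
        ∮ w in C(w₀, r), w ^ n * (fderiv ℂ h (z, w) (0, 1) / h (z, w)) := by
    intro z hz
    have h0 : ∀ w ∈ sphere w₀ r, h (z, w) ≠ 0 := fun w hw => ((hδ hz).2 w hw).2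
    obtain ⟨s, q, hs, hq, hq0, hsq⟩ := exists_multiset_factorization (f := fun w => h (z, w)) hr
      (fun w hw => slice_analyticAt hO hh ((hδ hz).1 w hw)) h0
    refine ⟨s, hs, fun w hw => ?_, fun n => ?_⟩
    · have h1 := (hsq w hw).eq_of_nhds
      rw [h1, mul_eq_zero, or_iff_left (hq0 w hw), Multiset.prod_eq_zero_iff, Multiset.mem_map]
      constructor
      · rintro ⟨a, ha, hwa⟩
        rwa [sub_eq_zero.1 hwa]
      · exact fun hw => ⟨w, hw, sub_self w⟩
    · have h1 := circleIntegral_pow_mul_logDeriv hr hs h0 hq hq0 hsq n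
      have h2 : (∮ w in C(w₀, r), w ^ n * (fderiv ℂ h (z, w) (0, 1) / h (z, w))) =
          ∮ w in C(w₀, r), w ^ n * (deriv (fun w => h (z, w)) w / h (z, w)) := by
        refine circleIntegral.integral_congr hr.le fun w hw => ?_
        simp only [(slice_differentiableAt hO hh
          ((hδ hz).1 w (sphere_subset_closedBall hw))).deriv]
      rw [h2, h1, inv_mul_cancel_left₀ Complex.two_pi_I_ne_zero]
      rfl
  choose! s hs1 hs2 hs3 using hfac
  have hsm : ∀ n, DifferentiableOn ℂ (fun z => powerSum (s z) n) (ball z₀ δ₀) := by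
    intro n
    have h1 : ContDiffOn ℂ ∞ (fun z => (2 * Real.pi * Complex.I : ℂ)⁻¹ *
        ∮ w in C(w₀, r), w ^ n * (fderiv ℂ h (z, w) (0, 1) / h (z, w))) (ball z₀ δ₀) := by
      refine contDiffOn_const.mul (contDiffOn_circleIntegral isOpen_ball hr.le hO' ?_
        (F := fun y => y.2 ^ n * (fderiv ℂ h y (0, 1) / h y)) ?_)
      · rintro ⟨z, w⟩ ⟨hz, hw⟩
        exact (hδ hz).2 w hw
      · refine ContDiffOn.mul (by fun_prop) (ContDiffOn.div ?_ (hh.mono inter_subset_left)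
          fun y hy => hy.2)
        exact ((hh.fderiv_of_isOpen hO (by simp)).mono inter_subset_left).clm_apply
          contDiffOn_const
    exact (h1.differentiableOn (by simp)).congr fun z hz => hs3 z hz n
  -- Halving the radius makes the closed disc of slices compact, so that the zeroth power sum, which
  -- counts the zeros, is bounded.
  have hsub : closedBall z₀ (δ₀ / 2) ⊆ ball z₀ δ₀ := closedBall_subset_ball (by linarith)
  obtain ⟨B, hB⟩ := (isCompact_closedBall z₀ (δ₀ / 2)).exists_bound_of_continuousOn
    ((hsm 0).continuousOn.mono hsub)
  have hsub' : ball z₀ (δ₀ / 2) ⊆ ball z₀ δ₀ := ball_subset_closedBall.trans hsub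
  refine ⟨δ₀ / 2, by positivity, s, fun z hz => (hδ (hsub' hz)).1, fun z hz => hs1 z (hsub' hz),
    fun z hz => hs2 z (hsub' hz), fun n => (hsm n).mono hsub', ⌈B⌉₊, fun z hz => ?_⟩
  have h1 := hB z (ball_subset_closedBall hz)
  simp only [powerSum, pow_zero, Multiset.map_const', Multiset.sum_replicate, nsmul_eq_mul,
    mul_one, Complex.norm_natCast] at h1
  exact_mod_cast h1.trans (Nat.le_ceil B)

/-- Near a point of a curve in `ℂ × ℂ` which does not contain the vertical line through the point,
the curve is the zero locus of a reduced family of polynomials. -/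
theorem exists_isReducedFamily {O : Set (ℂ × ℂ)} (hO : IsOpen O) {h : ℂ × ℂ → ℂ}
    (hh : ContDiffOn ℂ ∞ h O) {z₀ w₀ : ℂ} (hx : (z₀, w₀) ∈ O) (h0 : h (z₀, w₀) = 0)
    (hne : ¬ ∀ᶠ w in 𝓝 w₀, h (z₀, w) = 0) :
    ∃ (δ : ℝ) (r : ℝ) (P : ℂ × ℂ → ℂ), 0 < δ ∧ 0 < r ∧ IsReducedFamily z₀ δ P ∧
      ball z₀ δ ×ˢ ball w₀ r ⊆ O ∧ ∀ x ∈ ball z₀ δ ×ˢ ball w₀ r, P x = 0 ↔ h x = 0 := by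
  obtain ⟨r, hr, hrO, hrh⟩ := exists_radius hO hh hx hne
  obtain ⟨δ₁, hδ₁, s, hsO, hs1, hs2, hsm, B, hB⟩ := exists_zeros_multiset hO hh hr hrO
    fun w hw => hrh w (sphere_subset_closedBall hw) (by rintro rfl; simp [hr.ne] at hw)
  -- The generic number `k` of distinct zeros is the largest one that occurs.
  obtain ⟨z', hz', hmax⟩ : ∃ z' ∈ ball z₀ δ₁, ∀ z ∈ ball z₀ δ₁,
      (s z).toFinset.card ≤ (s z').toFinset.card := by
    set T := (fun z => (s z).toFinset.card) '' ball z₀ δ₁ with hT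
    have hTne : T.Nonempty := ⟨_, z₀, mem_ball_self hδ₁, rfl⟩
    have hTb : BddAbove T := ⟨B, by
      rintro _ ⟨z, hz, rfl⟩
      exact (Multiset.toFinset_card_le _).trans (hB z hz)⟩
    obtain ⟨z', hz', he⟩ := Nat.sSup_mem hTne hTb
    exact ⟨z', hz', fun z hz => by
      simp only at he
      rw [he]
      exact le_csSup hTb ⟨z, hz, rfl⟩⟩
  set k := (s z').toFinset.card with hk
  have hDd : DifferentiableOn ℂ (fun z => (hankel (powerSum (s z)) k).det) (ball z₀ δ₁) :=
    differentiableOn_det fun i j => hsm (i + j)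
  have hDan := hDd.analyticOnNhd isOpen_ball
  -- The Hankel determinant is holomorphic and nonzero at `z'`, so its zeros are isolated. Where it
  -- does not vanish there are at least `k` distinct zeros, hence exactly `k`.
  have hDne : ∀ᶠ z in 𝓝[≠] z₀, (hankel (powerSum (s z)) k).det ≠ 0 := by
    by_contra hcon
    have hfr : ∃ᶠ z in 𝓝[≠] z₀, (hankel (powerSum (s z)) k).det = 0 := by
      simpa only [not_eventually, not_not, ne_eq] using hcon
    exact det_hankel_ne_zero hk.symm (hDan.eqOn_zero_of_preconnected_of_frequently_eq_zero
      (convex_ball z₀ δ₁).isPreconnected (mem_ball_self hδ₁) hfr hz')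
  rw [eventually_nhdsWithin_iff] at hDne
  obtain ⟨δ, hδ, hδD⟩ := Metric.nhds_basis_ball.eventually_iff.1
    (hDne.and (ball_mem_nhds z₀ hδ₁))
  have hcard : ∀ z ∈ ball z₀ δ, z ≠ z₀ → (s z).toFinset.card = k := fun z hz hzz =>
    le_antisymm (hmax z (hδD hz).2) (card_ge_of_det_hankel_ne_zero ((hδD hz).1 hzz))
  set c : Fin k → ℂ → ℂ := fun j z => (simplePoly (s z).toFinset).coeff j with hc
  have hcd : ∀ j, DifferentiableOn ℂ (c j) (ball z₀ δ \ {z₀}) := by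
    intro j
    have hsub : ball z₀ δ \ {z₀} ⊆ ball z₀ δ₁ := fun z hz => (hδD hz.1).2
    have h1 : DifferentiableOn ℂ (fun z => -((hankel (powerSum (s z)) k).det⁻¹ *
        ((hankel (powerSum (s z)) k).updateCol j fun i => powerSum (s z) (i + k)).det))
        (ball z₀ δ \ {z₀}) := by
      refine ((hDd.mono hsub).inv fun z hz => (hδD hz.1).1 hz.2).mul
        (differentiableOn_det fun i l => ?_) |>.neg
      simp only [Matrix.updateCol_apply]
      split_ifs
      · exact (hsm _).mono hsub
      · exact (hsm _).mono hsub
    exact h1.congr fun z hz => simplePoly_coeff_eq (hcard z hz.1 hz.2) j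
  -- The zeros stay in a fixed disc, so the coefficients are bounded and extend over `z₀` by
  -- Riemann's theorem; the extensions are `c'`.
  have hcb : ∀ j, BddAbove (norm ∘ c j '' (ball z₀ δ \ {z₀})) := by
    intro j
    refine ⟨max (‖w₀‖ + r) 1 ^ k * k.choose (k / 2), ?_⟩
    rintro _ ⟨z, hz, rfl⟩
    refine simplePoly_coeff_norm_le (hcard z hz.1 hz.2) (fun a ha => ?_) j
    have h1 := hs1 z (hδD hz.1).2 a (Multiset.mem_toFinset.1 ha)
    rw [mem_ball, dist_eq_norm] at h1
    have h2 := norm_add_le w₀ (a - w₀)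
    rw [add_sub_cancel] at h2
    linarith
  set c' : Fin k → ℂ → ℂ := fun j =>
    Function.update (c j) z₀ (limUnder (𝓝[≠] z₀) (c j)) with hc'
  have hc'd : ∀ j, DifferentiableOn ℂ (c' j) (ball z₀ δ) := fun j =>
    Complex.differentiableOn_update_limUnder_of_bddAbove (ball_mem_nhds z₀ hδ) (hcd j) (hcb j)
  have hc'c : ∀ j z, z ≠ z₀ → c' j z = c j z := fun j z hz => Function.update_of_ne hz _ _
  set P : ℂ × ℂ → ℂ := fun x => x.2 ^ k + ∑ j : Fin k, c' j x.1 * x.2 ^ (j : ℕ) with hPdef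
  have hPs : ∀ z ∈ ball z₀ δ, z ≠ z₀ → ∀ w, P (z, w) = (simplePoly (s z).toFinset).eval w := by
    intro z hz hzz w
    have hlead := simplePoly_monic (s z).toFinset
    have hdeg := simplePoly_natDegree (s z).toFinset
    rw [hcard z hz hzz] at hdeg
    rw [Monic, leadingCoeff, hdeg] at hlead
    rw [eval_eq_sum_range, hdeg, Finset.sum_range_succ, hlead, one_mul, add_comm,
      ← Fin.sum_univ_eq_sum_range (fun j => (simplePoly (s z).toFinset).coeff j * w ^ j)]
    simp only [hPdef, hc'c _ z hzz, hc]
  have hfam : IsReducedFamily z₀ δ P := by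
    refine ⟨?_, fun z _ => ?_, fun z hz hzz => ⟨_, hPs z hz hzz⟩⟩
    · refine ContDiffOn.add (by fun_prop) (ContDiffOn.sum fun j _ => ContDiffOn.mul ?_
        (by fun_prop))
      exact ((hc'd j).contDiffOn isOpen_ball).comp contDiffOn_fst fun x hx => hx.1
    · refine ⟨X ^ k + ∑ j : Fin k, C (c' j z) * X ^ (j : ℕ), Monic.ne_zero ?_, fun w => ?_⟩
      · refine monic_X_pow_add ?_
        refine (degree_sum_fin_lt fun j => c' j z)
      · simp [hPdef, eval_finsetSum]
  have hsub : ball z₀ δ ×ˢ ball w₀ r ⊆ O := fun x hx =>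
    hsO x.1 (hδD hx.1).2 x.2 (ball_subset_closedBall hx.2)
  refine ⟨δ, r, P, hδ, hr, hfam, hsub, ?_⟩
  have hgen : ∀ z ∈ ball z₀ δ, z ≠ z₀ → ∀ w ∈ ball w₀ r, P (z, w) = 0 ↔ h (z, w) = 0 := by
    intro z hz hzz w hw
    rw [hPs z hz hzz w, hs2 z (hδD hz).2 w (ball_subset_closedBall hw), simplePoly_eval,
      Finset.prod_eq_zero_iff]
    constructor
    · rintro ⟨a, ha, hwa⟩
      rw [sub_eq_zero.1 hwa]
      exact Multiset.mem_toFinset.1 ha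
    · exact fun hw => ⟨w, Multiset.mem_toFinset.2 hw, sub_self w⟩
  have hV : IsOpen (ball z₀ δ ×ˢ ball w₀ r) := isOpen_ball.prod isOpen_ball
  -- A zero in the slice `z₀`, if isolated there, is a limit of zeros in other slices. An inclusion
  -- of zero loci over `z ≠ z₀` therefore passes to `z₀`.
  have hlim : ∀ {F G : ℂ × ℂ → ℂ}, ContDiffOn ℂ ∞ F (ball z₀ δ ×ˢ ball w₀ r) →
      ContDiffOn ℂ ∞ G (ball z₀ δ ×ˢ ball w₀ r) →
      (∀ z ∈ ball z₀ δ, z ≠ z₀ → ∀ w ∈ ball w₀ r, F (z, w) = 0 → G (z, w) = 0) →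
      ∀ w ∈ ball w₀ r, (¬ ∀ᶠ w' in 𝓝 w, F (z₀, w') = 0) → F (z₀, w) = 0 → G (z₀, w) = 0 := by
    intro F G hF hG himp w hw hFne hFw
    by_contra hGw
    have hx : (z₀, w) ∈ ball z₀ δ ×ˢ ball w₀ r := ⟨mem_ball_self hδ, hw⟩
    have hN : (ball z₀ δ ×ˢ ball w₀ r) ∩ {y | G y ≠ 0} ∈ 𝓝 (z₀, w) :=
      (hG.continuousOn.isOpen_inter_preimage hV isOpen_ne).mem_nhds ⟨hx, hGw⟩
    have h1 := eventually_exists_zero hV hF hx hFw hFne hN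
    obtain ⟨z, ⟨w', hw', hFw'⟩, hzz⟩ := ((h1.filter_mono nhdsWithin_le_nhds).and
      (eventually_mem_nhdsWithin (a := z₀) (s := {z₀}ᶜ))).exists
    exact hw'.2 (himp z hw'.1.1 hzz w' hw'.1.2 hFw')
  have hPV := hfam.smooth.mono (prod_mono_right (subset_univ (ball w₀ r)) (s := ball z₀ δ))
  rintro ⟨z, w⟩ ⟨hz, hw⟩
  by_cases hzz : z = z₀
  · subst hzz
    constructor
    · exact hlim hPV (hh.mono hsub) (fun z hz hzz w hw => (hgen z hz hzz w hw).1) w hw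
        (hfam.not_eventually_zero hz w)
    · intro hw0
      refine hlim (hh.mono hsub) hPV (fun z hz hzz w hw => (hgen z hz hzz w hw).2) w hw ?_ hw0
      -- The radius was chosen so that `w₀` is the only zero of `h` in the central slice of the
      -- disc.
      have : w = w₀ := by
        by_contra hww
        exact hrh w (ball_subset_closedBall hw) hww hw0
      rwa [this]
  · exact hgen z hz hzz w hw

end TwoVariables

/-! ### From estimates on parallel complex lines to estimates on open sets. -/

section Averaging
open Metric Set Filter MeasureTheory
open scoped ENNReal

theorem setLIntegral_eq_shift {E : Type*} [NormedAddCommGroup E] [MeasurableSpace E] [BorelSpace E]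
    (μ : Measure E) [μ.IsAddRightInvariant] {Φ : E → ℝ≥0∞} {B : Set E} (hB : MeasurableSet B)
    (u : E) :
    ∫⁻ x in B, Φ x ∂μ = ∫⁻ x in (fun x => x + u) ⁻¹' B, Φ (x + u) ∂μ := by
  rw [← lintegral_indicator hB, ← lintegral_indicator (hB.preimage (measurable_add_const u)),
    ← lintegral_add_right_eq_self _ u]
  rfl

theorem measurable_indicator_of_continuousOn {E : Type*} [TopologicalSpace E] [MeasurableSpace E]
    [BorelSpace E] {f : E → ℂ} {O : Set E} (hO : IsOpen O)
    (hf : ContinuousOn f O) : Measurable (O.indicator f) := by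
  classical
  rw [← piecewise_eq_indicator]
  exact hf.measurable_piecewise continuousOn_const hO.measurableSet

variable {E : Type*} [NormedAddCommGroup E] [NormedSpace ℂ E]

theorem contDiffOn_line {f : E → ℂ} {O : Set E} (hf : ContDiffOn ℂ ∞ f O) (v : E) :
    ContDiffOn ℂ ∞ (fun y : E × ℂ => f (y.1 + y.2 • v)) ((fun y : E × ℂ => y.1 + y.2 • v) ⁻¹' O) :=
  hf.comp (by fun_prop) fun _ h => h

theorem isOpen_line {O : Set E} (hO : IsOpen O) (v : E) :
    IsOpen ((fun y : E × ℂ => y.1 + y.2 • v) ⁻¹' O) := hO.preimage (by fun_prop)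

theorem hasDerivAt_line {f : E → ℂ} {O : Set E} (hO : IsOpen O) (hf : ContDiffOn ℂ ∞ f O) (x v : E)
    {t : ℂ} (ht : x + t • v ∈ O) :
    HasDerivAt (fun t => f (x + t • v)) (fderiv ℂ f (x + t • v) v) t := by
  have h1 : HasFDerivAt f (fderiv ℂ f (x + t • v)) (x + t • v) :=
    ((hf.contDiffAt (hO.mem_nhds ht)).differentiableAt (by simp)).hasFDerivAt
  have h2 : HasDerivAt (fun t : ℂ => x + t • v) v t := by
    simpa using ((hasDerivAt_id t).smul_const v).const_add x
  exact h1.comp_hasDerivAt t h2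

variable [FiniteDimensional ℂ E] [MeasurableSpace E] [BorelSpace E] (μ : Measure E)
  [μ.IsAddHaarMeasure]

/-- Comparison of an integral with the integrals over complex lines. -/
theorem volume_mul_setLIntegral_le {Φ : E → ℝ≥0∞} (hΦ : Measurable Φ) {B B' : Set E}
    (hB : MeasurableSet B) (v : E) {η : ℝ} {K : ℝ≥0∞}
    (hBB' : ∀ t ∈ ball (0 : ℂ) η, ∀ x, x + t • v ∈ B → x ∈ B')
    (hK : ∀ x ∈ B', ∫⁻ t in ball (0 : ℂ) η, Φ (x + t • v) ≤ K) :
    volume (ball (0 : ℂ) η) * ∫⁻ x in B, Φ x ∂μ ≤ K * μ B' := by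
  have : SFinite μ := inferInstance
  -- The integral over `B` is averaged over translations by `t • v`; Tonelli's theorem then leaves
  -- integrals along lines in the direction `v`.
  calc volume (ball (0 : ℂ) η) * ∫⁻ x in B, Φ x ∂μ
      = ∫⁻ _ in ball (0 : ℂ) η, ∫⁻ x in B, Φ x ∂μ := by
        rw [lintegral_const, Measure.restrict_apply MeasurableSet.univ, univ_inter, mul_comm]
    _ ≤ ∫⁻ t in ball (0 : ℂ) η, ∫⁻ x in B', Φ (x + t • v) ∂μ := by
        refine setLIntegral_mono' measurableSet_ball fun t ht => ?_
        rw [setLIntegral_eq_shift μ hB (t • v)]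
        exact lintegral_mono_set fun x hx => hBB' t ht x hx
    _ = ∫⁻ x in B', (∫⁻ t in ball (0 : ℂ) η, Φ (x + t • v)) ∂μ := by
        refine lintegral_lintegral_swap (f := fun t x => Φ (x + t • v)) ?_
        exact (hΦ.comp (by fun_prop)).aemeasurable
    _ ≤ ∫⁻ _ in B', K ∂μ := setLIntegral_mono measurable_const hK
    _ = K * μ B' := by
        rw [lintegral_const, Measure.restrict_apply MeasurableSet.univ, univ_inter]

theorem mul_measure_le_volume_mul_setLIntegral {Φ : E → ℝ≥0∞} (hΦ : Measurable Φ) {B B' : Set E}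
    (hB : MeasurableSet B) (hB' : MeasurableSet B') (v : E) {η : ℝ} {c : ℝ≥0∞}
    (hBB' : ∀ t ∈ ball (0 : ℂ) η, ∀ x ∈ B, x + t • v ∈ B')
    (hc : ∀ x ∈ B, c ≤ ∫⁻ t in ball (0 : ℂ) η, Φ (x + t • v)) :
    c * μ B ≤ volume (ball (0 : ℂ) η) * ∫⁻ x in B', Φ x ∂μ := by
  calc c * μ B = ∫⁻ _ in B, c ∂μ := by
        rw [lintegral_const, Measure.restrict_apply MeasurableSet.univ, univ_inter]
    _ ≤ ∫⁻ x in B, (∫⁻ t in ball (0 : ℂ) η, Φ (x + t • v)) ∂μ := setLIntegral_mono' hB hc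
    _ = ∫⁻ t in ball (0 : ℂ) η, ∫⁻ x in B, Φ (x + t • v) ∂μ := by
        refine lintegral_lintegral_swap (f := fun x t => Φ (x + t • v)) ?_
        exact (hΦ.comp (by fun_prop)).aemeasurable
    _ ≤ ∫⁻ _ in ball (0 : ℂ) η, ∫⁻ x in B', Φ x ∂μ := by
        refine setLIntegral_mono' measurableSet_ball fun t ht => ?_
        rw [setLIntegral_eq_shift μ hB' (t • v)]
        exact lintegral_mono_set fun x hx => hBB' t ht x hx
    _ = volume (ball (0 : ℂ) η) * ∫⁻ x in B', Φ x ∂μ := by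
        rw [lintegral_const, Measure.restrict_apply MeasurableSet.univ, univ_inter, mul_comm]

/-- The logarithmic derivative of a holomorphic function in a direction in which it does not vanish
identically is integrable. -/
theorem exists_nhds_lintegral_logDeriv_lt_top {f : E → ℂ} {O : Set E} (hO : IsOpen O)
    (hf : ContDiffOn ℂ ∞ f O) {x₀ v : E} (hx₀ : x₀ ∈ O)
    (hne : ¬ ∀ᶠ t : ℂ in 𝓝 0, f (x₀ + t • v) = 0) :
    ∃ B ∈ 𝓝 x₀, ∫⁻ x in B, ‖fderiv ℂ f x v / f x‖ₑ ∂μ < ⊤ := by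
  set F : E × ℂ → ℂ := fun y => f (y.1 + y.2 • v) with hF
  have hFs := contDiffOn_line hf v
  have hOo := isOpen_line hO v
  set O' := (fun y : E × ℂ => y.1 + y.2 • v) ⁻¹' O with hO'
  obtain ⟨R, hR, hRO, hRF⟩ := exists_radius hOo hFs (z₀ := x₀) (w₀ := 0)
    (by simpa [hO'] using hx₀) hne
  -- On this annulus `f` has no zeros along the line through `x₀`; this yields the lower bound
  -- required by `exists_lintegral_logDeriv_bound`.
  set A : Set ℂ := closedBall 0 R ∩ {t | R / 2 ≤ dist t 0} with hA
  have hAc : IsCompact A := (isCompact_closedBall 0 R).inter_right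
    (isClosed_le continuous_const (by fun_prop))
  have hAne : A.Nonempty := by
    refine ⟨(R : ℂ), ?_, ?_⟩ <;> simp [abs_of_pos hR]
    linarith
  have hFc : ContinuousOn F O' := hFs.continuousOn
  obtain ⟨t₁, ht₁, hmin⟩ := hAc.exists_isMinOn hAne
    (f := fun t => ‖F (x₀, t)‖) (hFc.comp (by fun_prop) fun t ht => hRO t ht.1).norm
  set m := ‖F (x₀, t₁)‖ with hm
  have hm0 : 0 < m := norm_pos_iff.2 (hRF t₁ ht₁.1 (by
    rintro rfl
    have := ht₁.2
    simp only [mem_ofPred_eq, dist_self] at this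
    linarith))
  have hdc : ContinuousOn (fun y : E × ℂ => fderiv ℂ f (y.1 + y.2 • v) v) O' := by
    have h1 : ContinuousOn (fun x => fderiv ℂ f x v) O :=
      (hf.continuousOn_fderiv_of_isOpen hO (by simp)).clm_apply continuousOn_const
    exact h1.comp (by fun_prop) fun _ h => h
  obtain ⟨b, hb⟩ := (isCompact_closedBall (0 : ℂ) R).exists_bound_of_continuousOn
    (f := fun t => fderiv ℂ f (x₀ + t • v) v)
    (hdc.comp (f := fun t : ℂ => (x₀, t)) (by fun_prop) fun t ht => hRO t ht)
  have hb0 : 0 ≤ b := (norm_nonneg _).trans (hb 0 (mem_closedBall_self hR.le))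
  -- Halving `m` and adding `1` to `b` leaves room for the bounds to hold on all nearby parallel
  -- lines, with the same `K`.
  obtain ⟨K, hK, hKb⟩ := exists_lintegral_logDeriv_bound (m := m / 2) (B := b + 1) hR
    (by positivity) (by positivity)
  have hW1 : IsOpen (O' ∩ {y | m / 2 < ‖F y‖}) := hFc.norm.isOpen_inter_preimage hOo isOpen_Ioi
  have hW2 : IsOpen (O' ∩ {y | ‖fderiv ℂ f (y.1 + y.2 • v) v‖ < b + 1}) :=
    hdc.norm.isOpen_inter_preimage hOo isOpen_Iio
  have e1 := eventually_forall_of_isCompact hAc hW1 (z₀ := x₀) fun t ht =>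
    ⟨hRO t ht.1, by have := hmin ht; simp only [mem_ofPred_eq] at this ⊢; linarith⟩
  have e2 := eventually_forall_of_isCompact (isCompact_closedBall (0 : ℂ) R) hW2 (z₀ := x₀)
    fun t ht => ⟨hRO t ht, by have := hb t ht; simp only [mem_ofPred_eq]; linarith⟩
  obtain ⟨ρ, hρ, hρb⟩ := Metric.nhds_basis_ball.eventually_iff.1 (e1.and e2)
  set Φ : E → ℝ≥0∞ := fun x =>
    ‖O.indicator (fun x => fderiv ℂ f x v) x / O.indicator f x‖ₑ with hΦ
  have hΦm : Measurable Φ :=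
    ((measurable_indicator_of_continuousOn hO
      ((hf.continuousOn_fderiv_of_isOpen hO (by simp)).clm_apply continuousOn_const)).div
      (measurable_indicator_of_continuousOn hO hf.continuousOn)).enorm
  have hρO : ball x₀ ρ ⊆ O := fun x hx => by
    have := ((hρb hx).2 0 (mem_closedBall_self hR.le)).1
    simpa [hO'] using this
  have hΦf : ∀ x ∈ O, Φ x = ‖fderiv ℂ f x v / f x‖ₑ := fun x hx => by
    simp only [hΦ, indicator_of_mem hx]
  -- The first bound keeps `t` in the inner disc of the one-variable estimate; the second keeps the
  -- translation by `t • v` within `ρ / 2`.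
  set η := min (R / 2) (ρ / 2 / (‖v‖ + 1)) with hη
  have hv1 : 0 < ‖v‖ + 1 := by positivity
  have hη0 : 0 < η := by positivity
  have havg := volume_mul_setLIntegral_le μ hΦm (B := ball x₀ (ρ / 2)) (B' := ball x₀ ρ)
    measurableSet_ball v (η := η) (K := K) (fun t ht x hx => ?_) (fun x hx => ?_)
  · refine ⟨ball x₀ (ρ / 2), ball_mem_nhds x₀ (by positivity), ?_⟩
    have h1 : ∫⁻ x in ball x₀ (ρ / 2), ‖fderiv ℂ f x v / f x‖ₑ ∂μ =
        ∫⁻ x in ball x₀ (ρ / 2), Φ x ∂μ :=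
      setLIntegral_congr_fun measurableSet_ball fun x hx =>
        (hΦf x (hρO (ball_subset_ball (by linarith) hx))).symm
    rw [h1]
    have h2 : K * μ (ball x₀ ρ) < ⊤ := ENNReal.mul_lt_top hK measure_ball_lt_top
    have h3 : volume (ball (0 : ℂ) η) ≠ 0 := (measure_ball_pos volume 0 hη0).ne'
    by_contra htop
    rw [not_lt, top_le_iff] at htop
    rw [htop, ENNReal.mul_top h3, top_le_iff] at havg
    exact h2.ne havg
  · rw [mem_ball, dist_eq_norm] at hx ⊢
    have h1 : ‖t • v‖ ≤ ρ / 2 := by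
      rw [norm_smul]
      have ht' : ‖t‖ ≤ ρ / 2 / (‖v‖ + 1) := by
        have := mem_ball_zero_iff.1 ht
        exact this.le.trans (min_le_right _ _)
      calc ‖t‖ * ‖v‖ ≤ ρ / 2 / (‖v‖ + 1) * (‖v‖ + 1) := by gcongr; linarith
        _ = ρ / 2 := by field_simp
    have h2 := norm_sub_le (x + t • v - x₀) (t • v)
    rw [show x + t • v - x₀ - t • v = x - x₀ by abel] at h2
    linarith
  · have hana : AnalyticOnNhd ℂ (fun t : ℂ => f (x + t • v)) (closedBall 0 R) := fun t ht =>
      slice_analyticAt hOo hFs ((hρb hx).2 t ht).1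
    have hder : ∀ t ∈ closedBall (0 : ℂ) R,
        deriv (fun t : ℂ => f (x + t • v)) t = fderiv ℂ f (x + t • v) v := fun t ht =>
      (hasDerivAt_line hO hf x v ((hρb hx).2 t ht).1).deriv
    refine le_trans ?_ (hKb (fun t : ℂ => f (x + t • v)) 0 hana
      (fun t ht hRt => ((hρb hx).1 t ⟨ht, hRt⟩).2.le)
      (fun t ht => by rw [hder t ht]; exact ((hρb hx).2 t ht).2.le))
    have hsub : ball (0 : ℂ) η ⊆ ball 0 (R / 2) := ball_subset_ball (min_le_left _ _)
    refine le_trans (le_of_eq ?_) (lintegral_mono_set hsub)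
    refine setLIntegral_congr_fun measurableSet_ball fun t ht => ?_
    have ht' : t ∈ closedBall (0 : ℂ) R :=
      closedBall_subset_closedBall (by linarith) (ball_subset_closedBall (hsub ht))
    rw [hder t ht', hΦf _ ((hρb hx).2 t ht').1]

/-- The zero locus of a holomorphic function is a null set near a point at which the function does
not vanish identically in some direction. -/
theorem exists_nhds_measure_zeros_eq_zero {f : E → ℂ} {O : Set E} (hO : IsOpen O)
    (hf : ContDiffOn ℂ ∞ f O) {x₀ v : E} (hx₀ : x₀ ∈ O)
    (hne : ¬ ∀ᶠ t : ℂ in 𝓝 0, f (x₀ + t • v) = 0) :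
    ∃ B ∈ 𝓝 x₀, μ (B ∩ (O ∩ {x | f x = 0})) = 0 := by
  have hFs := contDiffOn_line hf v
  have hOo := isOpen_line hO v
  obtain ⟨R, hR, hRO, hRF⟩ := exists_radius hOo hFs (z₀ := x₀) (w₀ := 0)
    (by simpa using hx₀) hne
  have hW := hFs.continuousOn.isOpen_inter_preimage hOo (isOpen_ne (x := (0 : ℂ)))
  have e1 := eventually_forall_of_isCompact (isCompact_closedBall (0 : ℂ) R) hOo hRO
  have e2 := eventually_forall_of_isCompact (isCompact_sphere (0 : ℂ) R) hW fun t ht =>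
    ⟨hRO t (sphere_subset_closedBall ht), hRF t (sphere_subset_closedBall ht) (by
      rintro rfl; simp [hR.ne] at ht)⟩
  obtain ⟨ρ, hρ, hρb⟩ := Metric.nhds_basis_ball.eventually_iff.1 (e1.and e2)
  have hT : MeasurableSet (O ∩ {x | f x = 0}) := by
    have h1 : O ∩ {x | f x = 0} = O ∩ O.indicator f ⁻¹' {0} := by
      ext x
      refine and_congr_right fun hx => ?_
      simp [indicator_of_mem hx]
    rw [h1]
    exact hO.measurableSet.inter
      (measurable_indicator_of_continuousOn hO hf.continuousOn (measurableSet_singleton 0))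
  -- Each line near `x₀` meets the zero locus in finitely many points, so the line integrals of this
  -- indicator are zero and the comparison applies with `K = 0`.
  set Φ : E → ℝ≥0∞ := (O ∩ {x | f x = 0}).indicator 1 with hΦ
  have hΦm : Measurable Φ := measurable_one.indicator hT
  set η := min R (ρ / 2 / (‖v‖ + 1)) with hη
  have hv1 : 0 < ‖v‖ + 1 := by positivity
  have hη0 : 0 < η := by positivity
  have havg := volume_mul_setLIntegral_le μ hΦm (B := ball x₀ (ρ / 2)) (B' := ball x₀ ρ)
    measurableSet_ball v (η := η) (K := 0) (fun t ht x hx => ?_) (fun x hx => ?_)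
  · refine ⟨ball x₀ (ρ / 2), ball_mem_nhds x₀ (by positivity), ?_⟩
    rw [zero_mul, nonpos_iff_eq_zero, mul_eq_zero,
      or_iff_right (measure_ball_pos volume (0 : ℂ) hη0).ne', hΦ, lintegral_indicator_one hT,
      Measure.restrict_apply hT] at havg
    rwa [inter_comm]
  · rw [mem_ball, dist_eq_norm] at hx ⊢
    have h1 : ‖t • v‖ ≤ ρ / 2 := by
      rw [norm_smul]
      have ht' : ‖t‖ ≤ ρ / 2 / (‖v‖ + 1) := by
        have := mem_ball_zero_iff.1 ht
        exact this.le.trans (min_le_right _ _)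
      calc ‖t‖ * ‖v‖ ≤ ρ / 2 / (‖v‖ + 1) * (‖v‖ + 1) := by gcongr; linarith
        _ = ρ / 2 := by field_simp
    have h2 := norm_sub_le (x + t • v - x₀) (t • v)
    rw [show x + t • v - x₀ - t • v = x - x₀ by abel] at h2
    linarith
  · obtain ⟨s, q, -, -, hq0, hsq⟩ := exists_multiset_factorization
      (f := fun t : ℂ => f (x + t • v)) hR
      (fun t ht => slice_analyticAt hOo hFs ((hρb hx).1 t ht)) fun t ht => ((hρb hx).2 t ht).2
    have hnull : volume (s.toFinset : Set ℂ) = 0 := s.toFinset.finite_toSet.measure_zero volume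
    refine le_of_eq ((lintegral_eq_zero_iff (hΦm.comp (by fun_prop))).2 ?_)
    refine (ae_restrict_iff' measurableSet_ball).2 ?_
    filter_upwards [measure_eq_zero_iff_ae_notMem.1 hnull] with t hts ht
    refine indicator_of_notMem (fun hmem => hts ?_) 1
    have htR : t ∈ closedBall (0 : ℂ) R :=
      ball_subset_closedBall (ball_subset_ball (min_le_left _ _) ht)
    have h1 : f (x + t • v) = 0 := hmem.2
    rw [(hsq t htR).eq_of_nhds, mul_eq_zero, or_iff_left (hq0 t htR),
      Multiset.prod_eq_zero_iff, Multiset.mem_map] at h1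
    obtain ⟨a, ha, hta⟩ := h1
    rw [sub_eq_zero.1 hta]
    exact Multiset.mem_toFinset.2 ha

/-- The kernels `ε / (‖f‖ ^ 2 + ε) ^ 2` do not tend to zero near a regular zero of `f`. -/
theorem exists_pos_le_lintegral_kernel {f : E → ℂ} {O : Set E} (hO : IsOpen O)
    (hf : ContDiffOn ℂ ∞ f O) {y v : E} (hy : y ∈ O) (h0 : f y = 0) (hv : fderiv ℂ f y v ≠ 0)
    {N : Set E} (hN : N ∈ 𝓝 y) :
    ∃ c : ℝ≥0∞, 0 < c ∧ ∃ ε₀ > 0, ∀ ε : ℝ, 0 < ε → ε < ε₀ →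
      c ≤ ∫⁻ x in N, ENNReal.ofReal (ε / (‖f x‖ ^ 2 + ε) ^ 2) ∂μ := by
  have hFs := contDiffOn_line hf v
  have hOo := isOpen_line hO v
  obtain ⟨L, s, hs, hLip⟩ := ((hf.contDiffAt (hO.mem_nhds hy)).of_le
    (m := 1) (by simp)).exists_lipschitzOnWith
  obtain ⟨ρ, hρ, hρb⟩ := Metric.nhds_basis_ball.mem_iff.1
    (inter_mem (inter_mem hN hs) (hO.mem_nhds hy))
  set L' : ℝ := L * ‖v‖ + 1 with hL'
  have hL'0 : 0 < L' := by positivity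
  set η := ρ / 4 / (‖v‖ + 1) with hη
  have hη0 : 0 < η := by positivity
  have hηv : ∀ t : ℂ, ‖t‖ < 2 * η → ‖t • v‖ ≤ ρ / 2 := by
    intro t ht
    rw [norm_smul]
    calc ‖t‖ * ‖v‖ ≤ (2 * η) * (‖v‖ + 1) := by gcongr; linarith
      _ = ρ / 2 := by rw [hη]; field_simp; norm_num
  have hne : ¬ ∀ᶠ t : ℂ in 𝓝 0, f (y + t • v) = 0 := by
    intro hev
    have h1 := hasDerivAt_line hO hf y v (t := 0) (by simpa using hy)
    have h2 : HasDerivAt (fun t : ℂ => f (y + t • v)) 0 0 :=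
      (hasDerivAt_const (0 : ℂ) (0 : ℂ)).congr_of_eventuallyEq hev
    have h3 := h1.unique h2
    simp only [zero_smul, add_zero] at h3
    exact hv h3
  -- Every nearby line in the direction `v` has a zero `τ` of `f` with `‖τ‖ < η`.
  have hroot := eventually_exists_zero hOo hFs (z₀ := y) (w₀ := 0) (by simpa using hy)
    (by simpa using h0) hne (N := {p | p.2 ∈ ball (0 : ℂ) η})
    ((isOpen_ball.preimage continuous_snd).mem_nhds (by simpa using hη0))
  obtain ⟨ρ', hρ', hρ'b⟩ := Metric.nhds_basis_ball.mem_iff.1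
    (inter_mem hroot (ball_mem_nhds y (half_pos hρ)))
  -- On the disc of radius `√ε / L'` about `τ` the Lipschitz bound gives `‖f‖ ≤ √ε`, so the kernel
  -- is at least `1 / (4 ε)`. The area `π ε / L'²` of the disc makes the product `κ`, independent of
  -- `ε`. The bound `ε < (η L')²` makes this radius less than `η`.
  set κ : ℝ≥0∞ := ENNReal.ofReal (Real.pi / (4 * L' ^ 2)) with hκ
  have hκ0 : 0 < κ := ENNReal.ofReal_pos.2 (by positivity)
  have hvol : volume (ball (0 : ℂ) (2 * η)) ≠ 0 :=
    (measure_ball_pos volume 0 (by positivity)).ne'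
  have hvol' : volume (ball (0 : ℂ) (2 * η)) ≠ ⊤ := measure_ball_lt_top.ne
  refine ⟨κ * μ (ball y ρ') / volume (ball (0 : ℂ) (2 * η)),
    ENNReal.div_pos (mul_ne_zero hκ0.ne' (measure_ball_pos μ y hρ').ne') hvol',
    (η * L') ^ 2, by positivity, fun ε hε hεη => ?_⟩
  have hBO : ball y ρ ⊆ O := fun x hx => (hρb hx).2
  set Φ : E → ℝ≥0∞ := fun x => ENNReal.ofReal (ε / (‖O.indicator f x‖ ^ 2 + ε) ^ 2) with hΦ
  have hΦm : Measurable Φ := by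
    have := measurable_indicator_of_continuousOn hO hf.continuousOn
    fun_prop
  have hΦf : ∀ x ∈ O, Φ x = ENNReal.ofReal (ε / (‖f x‖ ^ 2 + ε) ^ 2) := fun x hx => by
    simp only [hΦ, indicator_of_mem hx]
  have hmem : ∀ t ∈ ball (0 : ℂ) (2 * η), ∀ x ∈ ball y ρ', x + t • v ∈ ball y ρ := by
    intro t ht x hx
    have h1 := hηv t (mem_ball_zero_iff.1 ht)
    have h2 := (hρ'b hx).2
    rw [mem_ball, dist_eq_norm] at h2 ⊢
    rw [show x + t • v - y = (x - y) + t • v by abel]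
    exact (norm_add_le _ _).trans_lt (by linarith)
  have hlow := mul_measure_le_volume_mul_setLIntegral μ hΦm (B := ball y ρ') (B' := ball y ρ)
    measurableSet_ball measurableSet_ball v (η := 2 * η) (c := κ) hmem (fun x hx => ?_)
  · refine (ENNReal.div_le_of_le_mul' hlow).trans ?_
    rw [setLIntegral_congr_fun measurableSet_ball fun x hx => hΦf x (hBO hx)]
    exact lintegral_mono_set fun x hx => (hρb hx).1.1
  · obtain ⟨τ, hτ, hfτ⟩ := (hρ'b hx).1
    have hτ' : ‖τ‖ < η := mem_ball_zero_iff.1 hτ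
    set r := √ε / L' with hr
    have hr0 : 0 < r := by positivity
    have hrη : r < η := by
      rw [hr, div_lt_iff₀ hL'0]
      exact (Real.sqrt_lt' (by positivity)).2 hεη
    have hsub : ball τ r ⊆ ball (0 : ℂ) (2 * η) := by
      intro t ht
      rw [mem_ball, dist_eq_norm] at ht
      rw [mem_ball_zero_iff]
      have := norm_add_le (t - τ) τ
      rw [sub_add_cancel] at this
      linarith
    refine le_trans ?_ (lintegral_mono_set hsub)
    have hpt : ∀ t ∈ ball τ r, ENNReal.ofReal (1 / (4 * ε)) ≤ Φ (x + t • v) := by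
      intro t ht
      have hxt := hmem t (hsub ht) x hx
      rw [hΦf _ (hBO hxt)]
      refine ENNReal.ofReal_le_ofReal ?_
      have hτm : τ ∈ ball (0 : ℂ) (2 * η) := by rw [mem_ball_zero_iff]; linarith
      have hxτ := hmem τ hτm x hx
      have h1 := hLip.dist_le_mul _ (hρb hxt).1.2 _ (hρb hxτ).1.2
      simp only at hfτ
      rw [hfτ, dist_zero_right, dist_add_left, dist_eq_norm, ← sub_smul, norm_smul] at h1
      rw [mem_ball, dist_eq_norm] at ht
      have h2 : ‖f (x + t • v)‖ ≤ √ε := by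
        calc ‖f (x + t • v)‖ ≤ L * (‖t - τ‖ * ‖v‖) := h1
          _ = ‖t - τ‖ * (L * ‖v‖) := by ring
          _ ≤ r * L' := by
            have : (L : ℝ) * ‖v‖ ≤ L' := by rw [hL']; linarith
            gcongr
          _ = √ε := by rw [hr]; field_simp
      have h3 : ‖f (x + t • v)‖ ^ 2 ≤ ε := by
        calc ‖f (x + t • v)‖ ^ 2 ≤ √ε ^ 2 := by gcongr
          _ = ε := Real.sq_sqrt hε.le
      rw [div_le_div_iff₀ (by positivity) (by positivity)]
      have h4 : (‖f (x + t • v)‖ ^ 2 + ε) ^ 2 ≤ (2 * ε) ^ 2 := by gcongr; linarith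
      nlinarith
    refine le_trans ?_ (setLIntegral_mono' measurableSet_ball hpt)
    rw [lintegral_const, Measure.restrict_apply MeasurableSet.univ, univ_inter,
      Complex.volume_ball, hκ, ← ENNReal.ofReal_pow hr0.le, ← ENNReal.ofReal_coe_nnreal,
      ← ENNReal.ofReal_mul (by positivity), ← ENNReal.ofReal_mul (by positivity)]
    refine ENNReal.ofReal_le_ofReal (le_of_eq ?_)
    rw [hr, div_pow, Real.sq_sqrt hε.le]
    simp only [NNReal.coe_real_pi]
    field_simp

end Averaging

/-! ### Reduced local equations of curves in a complex surface. -/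

section ReducedEquation
open Metric Set Filter MeasureTheory
open scoped ENNReal

variable {E : Type*} [NormedAddCommGroup E] [NormedSpace ℂ E]

/-- If a holomorphic function does not vanish at a point of a ball, then it does not vanish
identically on the complex line through the centre and the point. -/
theorem not_eventually_zero_line {f : E → ℂ} {x₀ : E} {ρ : ℝ} (hf : ContDiffOn ℂ ∞ f (ball x₀ ρ))
    {u : E} (hu : x₀ + u ∈ ball x₀ ρ) (hne : f (x₀ + u) ≠ 0) :
    ¬ ∀ᶠ t : ℂ in 𝓝 0, f (x₀ + t • u) = 0 := by
  intro hev
  set T : Set ℂ := (fun t : ℂ => x₀ + t • u) ⁻¹' ball x₀ ρ with hT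
  have hTc : Convex ℝ T := by
    intro s hs t ht a b ha hb hab
    have h1 := convex_ball x₀ ρ hs ht ha hb hab
    have h2 : a • (x₀ + s • u) + b • (x₀ + t • u) = x₀ + (a • s + b • t) • u := by
      rw [smul_add, smul_add, add_smul, smul_assoc, smul_assoc]
      calc _ = (a + b) • x₀ + (a • s • u + b • t • u) := by rw [add_smul]; abel
        _ = _ := by rw [hab, one_smul]
    simp only [hT, mem_preimage]
    rwa [← h2]
  have hana : AnalyticOnNhd ℂ (fun t : ℂ => f (x₀ + t • u)) T := fun t ht =>
    slice_analyticAt (isOpen_line isOpen_ball u) (contDiffOn_line hf u) ht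
  have h0 : (0 : ℂ) ∈ T := by
    have : 0 < ρ := dist_nonneg.trans_lt hu
    simpa [hT] using this
  have h1 : (1 : ℂ) ∈ T := by simpa [hT] using hu
  have := hana.eqOn_zero_of_preconnected_of_eventuallyEq_zero hTc.isPreconnected h0 hev h1
  simp only [one_smul, Pi.zero_apply] at this
  exact hne this

/-- A nearby point at which `f ≠ 0` gives one direction, and since `f ≠ 0` is an open condition, a
small transverse perturbation gives another. Both are needed to control all components of `dP / P`.
-/
theorem exists_linearIndependent_directions [FiniteDimensional ℂ E] (hE : Module.finrank ℂ E = 2)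
    {f : E → ℂ} {x₀ : E}
    {O : Set E} (hO : IsOpen O) (hf : ContDiffOn ℂ ∞ f O) (hx₀ : x₀ ∈ O) (h0 : f x₀ = 0)
    (hne : ¬ ∀ᶠ x in 𝓝 x₀, f x = 0) :
    ∃ u₁ u₂ : E, (∀ a b : ℂ, a • u₁ + b • u₂ = 0 → a = 0 ∧ b = 0) ∧
      (¬ ∀ᶠ t : ℂ in 𝓝 0, f (x₀ + t • u₁) = 0) ∧ ¬ ∀ᶠ t : ℂ in 𝓝 0, f (x₀ + t • u₂) = 0 := by
  obtain ⟨ρ, hρ, hρO⟩ := Metric.isOpen_iff.1 hO x₀ hx₀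
  have hfρ := hf.mono hρO
  obtain ⟨y, hyne, hy⟩ := (not_eventually.1 hne).and_eventually (ball_mem_nhds x₀ hρ) |>.exists
  set u := y - x₀ with hu
  have hyu : x₀ + u = y := by rw [hu]; abel
  have hu0 : u ≠ 0 := by
    intro h
    rw [h, add_zero] at hyu
    exact hyne (hyu ▸ h0)
  obtain ⟨w, hw⟩ : ∃ w, w ∉ Submodule.span ℂ {u} := by
    by_contra! hall
    have htop : Submodule.span ℂ {u} = ⊤ := eq_top_iff.2 fun w _ => hall w
    have h1 := finrank_span_singleton (K := ℂ) hu0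
    rw [htop, finrank_top, hE] at h1
    omega
  have hcont : ∀ᶠ s : ℂ in 𝓝 0, x₀ + (u + s • w) ∈ ball x₀ ρ ∧ f (x₀ + (u + s • w)) ≠ 0 := by
    have hopen : IsOpen (ball x₀ ρ ∩ {y | f y ≠ 0}) :=
      hfρ.continuousOn.isOpen_inter_preimage isOpen_ball isOpen_ne
    have hc : ContinuousAt (fun s : ℂ => x₀ + (u + s • w)) 0 := by fun_prop
    refine hc.eventually_mem (hopen.mem_nhds ?_)
    rw [zero_smul, add_zero, hyu]
    exact ⟨hy, hyne⟩
  obtain ⟨s, ⟨hs1, hs2⟩, hs0⟩ := ((hcont.filter_mono nhdsWithin_le_nhds).and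
    (eventually_mem_nhdsWithin (a := (0 : ℂ)) (s := {0}ᶜ))).exists
  have hs0' : s ≠ 0 := hs0
  refine ⟨u, u + s • w, fun a b hab => ?_, not_eventually_zero_line hfρ (by rwa [hyu])
    (by rwa [hyu]), not_eventually_zero_line hfρ hs1 hs2⟩
  have hb : b = 0 := by
    by_contra hb
    refine hw (Submodule.mem_span_singleton.2 ⟨-(a + b) / (b * s), ?_⟩)
    have h1 : (b * s) • w = -(a + b) • u := by
      rw [smul_add, ← add_assoc, ← add_smul, smul_smul] at hab
      rw [neg_smul]
      exact (neg_eq_of_add_eq_zero_right hab).symm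
    rw [div_eq_inv_mul, mul_smul, ← h1, smul_smul, inv_mul_cancel₀ (mul_ne_zero hb hs0'), one_smul]
  subst hb
  rw [zero_smul, add_zero] at hab
  exact ⟨(smul_eq_zero.1 hab).resolve_right hu0, rfl⟩

variable [MeasurableSpace E]

/-- `P` is a reduced equation of `Z` in the open set `V`: it is holomorphic with zero locus `Z`, it
generates the ideal of holomorphic functions vanishing on `Z` near every point, its derivative does
not vanish on a dense subset of `Z`, its zero locus is a null set, and its logarithmic derivatives
are integrable. -/
structure IsReducedEquation (μ : Measure E) (V : Set E) (P : E → ℂ) (Z : Set E) : Prop where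
  isOpen : IsOpen V
  smooth : ContDiffOn ℂ ∞ P V
  eq_zero_iff : ∀ x ∈ V, P x = 0 ↔ x ∈ Z
  exists_eq_mul : ∀ x ∈ V, ∀ (N : Set E) (f : E → ℂ), IsOpen N → x ∈ N → ContDiffOn ℂ ∞ f N →
    (∀ y ∈ N, y ∈ Z → f y = 0) → ∃ (N' : Set E) (q : E → ℂ), IsOpen N' ∧ x ∈ N' ∧
      ContDiffOn ℂ ∞ q N' ∧ ∀ y ∈ N', f y = q y * P y
  exists_regular : ∀ x ∈ V, P x = 0 → ∀ N ∈ 𝓝 x, ∃ y ∈ N, P y = 0 ∧ fderiv ℂ P y ≠ 0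
  measure_zeros : μ (V ∩ {x | P x = 0}) = 0
  lintegral_lt_top : ∀ v, ∫⁻ x in V, ‖fderiv ℂ P x v / P x‖ₑ ∂μ < ⊤

theorem IsReducedEquation.mono {μ : Measure E} {V V' : Set E} {P : E → ℂ} {Z : Set E}
    (h : IsReducedEquation μ V P Z) (hV' : IsOpen V') (hsub : V' ⊆ V) :
    IsReducedEquation μ V' P Z where
  isOpen := hV'
  smooth := h.smooth.mono hsub
  eq_zero_iff x hx := h.eq_zero_iff x (hsub hx)
  exists_eq_mul x hx := h.exists_eq_mul x (hsub hx)
  exists_regular x hx := h.exists_regular x (hsub hx)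
  measure_zeros := measure_mono_null (inter_subset_inter_left _ hsub) h.measure_zeros
  lintegral_lt_top v := (lintegral_mono_set hsub).trans_lt (h.lintegral_lt_top v)

theorem IsReducedEquation.not_eventually_zero {μ : Measure E} {V : Set E} {P : E → ℂ} {Z : Set E}
    (h : IsReducedEquation μ V P Z) {x : E} (hx : x ∈ V) : ¬ ∀ᶠ y in 𝓝 x, P y = 0 := by
  intro hev
  obtain ⟨y, hy, -, hy'⟩ := h.exists_regular x hx hev.self_of_nhds _
    (eventually_eventually_nhds.2 hev)
  refine hy' ?_
  have h1 : P =ᶠ[𝓝 y] fun _ => (0 : ℂ) := hy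
  rw [h1.fderiv_eq, fderiv_fun_const]
  rfl

variable [FiniteDimensional ℂ E] [BorelSpace E]

/-- Every curve in a complex surface has local reduced equations. -/
theorem exists_isReducedEquation (μ : Measure E) [μ.IsAddHaarMeasure]
    (hE : Module.finrank ℂ E = 2) {h : E → ℂ} {x₀ : E}
    {O Z : Set E} (hO : IsOpen O) (hh : ContDiffOn ℂ ∞ h O) (hx₀ : x₀ ∈ O) (h0 : h x₀ = 0)
    (hne : ¬ ∀ᶠ x in 𝓝 x₀, h x = 0) (hZ : ∀ x ∈ O, x ∈ Z ↔ h x = 0) :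
    ∃ (V : Set E) (P : E → ℂ), x₀ ∈ V ∧ V ⊆ O ∧ IsReducedEquation μ V P Z := by
  obtain ⟨u₁, u₂, hind, hu₁, hu₂⟩ := exists_linearIndependent_directions hE hO hh hx₀ h0 hne
  -- In these coordinates the vertical line has direction `u₂`, along which `h` does not vanish
  -- identically.
  let Λ₀ : ℂ × ℂ →ₗ[ℂ] E :=
    (LinearMap.toSpanSingleton ℂ E u₁).coprod (LinearMap.toSpanSingleton ℂ E u₂)
  have hΛ₀ : ∀ y, Λ₀ y = y.1 • u₁ + y.2 • u₂ := fun y => by simp [Λ₀]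
  have hinj : Function.Injective Λ₀ := by
    refine (injective_iff_map_eq_zero Λ₀).2 fun y hy => ?_
    rw [hΛ₀] at hy
    exact Prod.ext (hind _ _ hy).1 (hind _ _ hy).2
  let Λ : (ℂ × ℂ) ≃L[ℂ] E :=
    (LinearEquiv.ofInjectiveOfFinrankEq Λ₀ hinj (by simp [hE])).toContinuousLinearEquiv
  have hΛ : ∀ y, Λ y = y.1 • u₁ + y.2 • u₂ := hΛ₀
  set φ : ℂ × ℂ → E := fun y => x₀ + Λ y with hφ
  set ψ : E → ℂ × ℂ := fun x => Λ.symm (x - x₀) with hψ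
  have hφs : ContDiff ℂ ∞ φ := by fun_prop
  have hψs : ContDiff ℂ ∞ ψ := by fun_prop
  have hφψ : ∀ x, φ (ψ x) = x := fun x => by simp [hφ, hψ]
  have hψφ : ∀ y, ψ (φ y) = y := fun y => by simp [hφ, hψ]
  have hφ0 : φ (0, 0) = x₀ := by simp [hφ, hΛ]
  have hψ0 : ψ x₀ = (0, 0) := by rw [← hφ0, hψφ]
  obtain ⟨δ, r, P', hδ, hr, hfam, hsub, hzero⟩ := exists_isReducedFamily (h := h ∘ φ)
    (O := φ ⁻¹' O) (z₀ := 0) (w₀ := 0)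
    (hO.preimage hφs.continuous) (hh.comp hφs.contDiffOn fun _ h => h)
    (by rw [mem_preimage, hφ0]; exact hx₀) (by simp [hφ0, h0])
    (by simpa [hφ, hΛ] using hu₂)
  set W := ball (0 : ℂ) δ ×ˢ ball (0 : ℂ) r with hW
  have hWo : IsOpen W := isOpen_ball.prod isOpen_ball
  set P : E → ℂ := P' ∘ ψ with hP
  set V₁ := ψ ⁻¹' W with hV₁
  have hV₁o : IsOpen V₁ := hWo.preimage hψs.continuous
  have hx₀V₁ : x₀ ∈ V₁ := by
    rw [hV₁, mem_preimage, hψ0]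
    exact ⟨mem_ball_self hδ, mem_ball_self hr⟩
  have hV₁O : V₁ ⊆ O := fun x hx => by simpa [hφψ] using hsub hx
  have hPs : ContDiffOn ℂ ∞ P V₁ :=
    (hfam.smooth.mono (prod_mono_right (subset_univ _))).comp hψs.contDiffOn fun _ h => h
  have hPh : ∀ x ∈ V₁, P x = 0 ↔ h x = 0 := fun x hx => by
    simpa [hφψ, hP] using hzero (ψ x) hx
  have hPline : ∀ u, (¬ ∀ᶠ t : ℂ in 𝓝 0, h (x₀ + t • u) = 0) →
      ¬ ∀ᶠ t : ℂ in 𝓝 0, P (x₀ + t • u) = 0 := by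
    intro u hu hev
    have hc : ContinuousAt (fun t : ℂ => x₀ + t • u) 0 := by fun_prop
    have hmem : ∀ᶠ t : ℂ in 𝓝 0, x₀ + t • u ∈ V₁ :=
      hc.eventually_mem (by simpa using hV₁o.mem_nhds hx₀V₁)
    refine hu ?_
    filter_upwards [hev, hmem] with t ht htV
    exact (hPh _ htV).1 ht
  obtain ⟨B₁, hB₁, hI₁⟩ := exists_nhds_lintegral_logDeriv_lt_top μ hV₁o hPs hx₀V₁ (hPline u₁ hu₁)
  obtain ⟨B₂, hB₂, hI₂⟩ := exists_nhds_lintegral_logDeriv_lt_top μ hV₁o hPs hx₀V₁ (hPline u₂ hu₂)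
  obtain ⟨B₃, hB₃, hI₃⟩ := exists_nhds_measure_zeros_eq_zero μ hV₁o hPs hx₀V₁ (hPline u₁ hu₁)
  set V := V₁ ∩ (interior B₁ ∩ interior B₂ ∩ interior B₃) with hV
  have hVo : IsOpen V :=
    hV₁o.inter ((isOpen_interior.inter isOpen_interior).inter isOpen_interior)
  have hVV₁ : V ⊆ V₁ := inter_subset_left
  refine ⟨V, P, ⟨hx₀V₁, ⟨mem_interior_iff_mem_nhds.2 hB₁, mem_interior_iff_mem_nhds.2 hB₂⟩,
    mem_interior_iff_mem_nhds.2 hB₃⟩, hVV₁.trans hV₁O, ⟨hVo, hPs.mono hVV₁, ?_, ?_, ?_, ?_, ?_⟩⟩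
  · exact fun x hx => (hPh x (hVV₁ hx)).trans (hZ x (hV₁O (hVV₁ hx))).symm
  · intro x hx N f hN hxN hf hf0
    obtain ⟨N', q, hN', hxN', hq, hfq⟩ := hfam.exists_eq_mul (x := ψ x) (hVV₁ hx).1
      (N := φ ⁻¹' (N ∩ V)) ((hN.inter hVo).preimage hφs.continuous)
      (by rw [mem_preimage, hφψ]; exact ⟨hxN, hx⟩) (f := f ∘ φ)
      (hf.comp hφs.contDiffOn fun _ h => h.1) (fun y hy hy0 => by
        refine hf0 _ hy.1 ((hZ _ (hV₁O (hVV₁ hy.2))).2 ((hPh _ (hVV₁ hy.2)).1 ?_))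
        simp [hP, hψφ, hy0])
    refine ⟨ψ ⁻¹' N', q ∘ ψ, hN'.preimage hψs.continuous, hxN',
      hq.comp hψs.contDiffOn fun _ h => h, fun y hy => ?_⟩
    have := hfq (ψ y) hy
    simpa [hφψ, hP] using this
  · intro x hx hPx N hN
    obtain ⟨y, hyN, hy0, hyd⟩ := hfam.exists_regular (x := ψ x) (hVV₁ hx).1 hPx
      (N := φ ⁻¹' (N ∩ V)) (hφs.continuous.continuousAt.preimage_mem_nhds (by
        rw [hφψ]; exact inter_mem hN (hVo.mem_nhds hx)))
    refine ⟨φ y, hyN.1, by simp [hP, hψφ, hy0], fun hd => hyd ?_⟩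
    have h1 : P' = P ∘ φ := by ext z; simp [hP, hψφ]
    rw [h1, fderiv_comp y ((hPs.contDiffAt (hV₁o.mem_nhds (hVV₁ hyN.2))).differentiableAt
      (by simp)) (hφs.differentiable (by simp) y), hd]
    simp
  · exact measure_mono_null (fun x hx => by
      exact ⟨interior_subset hx.1.2.2, hx.1.1, hx.2⟩) hI₃
  -- Integrability along `u₁` and `u₂` gives it along every `v`, because `dP(v) / P` is linear in
  -- `v`.
  · intro v
    obtain ⟨a, b, hab⟩ : ∃ a b : ℂ, v = a • u₁ + b • u₂ :=
      ⟨(Λ.symm v).1, (Λ.symm v).2, by rw [← hΛ]; simp⟩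
    have hmeas : ∀ u, AEMeasurable (fun x => ‖fderiv ℂ P x u / P x‖ₑ) (μ.restrict V) := by
      intro u
      have c1 : ContinuousOn (fun x => fderiv ℂ P x u) V :=
        ((hPs.mono hVV₁).continuousOn_fderiv_of_isOpen hVo (by simp)).clm_apply continuousOn_const
      exact ((c1.aemeasurable hVo.measurableSet).div
        ((hPs.mono hVV₁).continuousOn.aemeasurable hVo.measurableSet)).enorm
    have hbound : ∀ x, ‖fderiv ℂ P x v / P x‖ₑ ≤
        ‖a‖ₑ * ‖fderiv ℂ P x u₁ / P x‖ₑ + ‖b‖ₑ * ‖fderiv ℂ P x u₂ / P x‖ₑ := by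
      intro x
      have h1 : fderiv ℂ P x v / P x =
          a * (fderiv ℂ P x u₁ / P x) + b * (fderiv ℂ P x u₂ / P x) := by
        rw [hab, map_add, map_smul, map_smul, smul_eq_mul, smul_eq_mul]
        ring
      rw [h1, ← enorm_mul, ← enorm_mul]
      exact enorm_add_le _ _
    refine (lintegral_mono hbound).trans_lt ?_
    rw [lintegral_add_left' ((hmeas u₁).const_mul _), lintegral_const_mul'' _ (hmeas u₁),
      lintegral_const_mul'' _ (hmeas u₂)]
    refine ENNReal.add_lt_top.2 ⟨ENNReal.mul_lt_top enorm_lt_top ?_,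
      ENNReal.mul_lt_top enorm_lt_top ?_⟩
    · exact (lintegral_mono_set fun x hx => interior_subset hx.2.1.1).trans_lt hI₁
    · exact (lintegral_mono_set fun x hx => interior_subset hx.2.1.2).trans_lt hI₂

end ReducedEquation

/-! ### Rules for `∂̄` and Stokes' theorem in coordinates. -/

section Calculus
open Metric Set Filter MeasureTheory

variable {E F : Type*} [NormedAddCommGroup E] [NormedSpace ℂ E]
  [NormedAddCommGroup F] [NormedSpace ℂ F]

theorem dbar_congr {f g : E → F} {x : E} (h : f =ᶠ[𝓝 x] g) (v : E) : dbar f x v = dbar g x v := by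
  simp only [dbar, h.fderiv_eq]

theorem dbar_of_eventuallyEq_zero {f : E → F} {x : E} (h : f =ᶠ[𝓝 x] fun _ => 0) (v : E) :
    dbar f x v = 0 := by
  rw [dbar_congr h, dbar_zero]

theorem dbar_mul {f g : E → ℂ} {x : E} (hf : DifferentiableAt ℝ f x) (hg : DifferentiableAt ℝ g x)
    (v : E) : dbar (fun y => f y * g y) x v = dbar f x v * g x + f x * dbar g x v := by
  simp only [dbar, fderiv_fun_mul hf hg, add_apply, smul_apply, smul_eq_mul]
  ring

theorem dbar_eq_zero {f : E → F} {x : E} (hf : DifferentiableAt ℂ f x) (v : E) :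
    dbar f x v = 0 := by
  simp only [dbar, hf.fderiv_restrictScalars ℝ, ContinuousLinearMap.coe_restrictScalars',
    map_smul, smul_smul, Complex.I_mul_I]
  simp

theorem dbar_smul_right (f : E → F) (x : E) (c : ℂ) (v : E) :
    dbar f x (c • v) = (starRingEnd ℂ c) • dbar f x v := by
  have h1 : Complex.I • c • v = (-c.im) • v + c.re • (Complex.I • v) := by
    rw [smul_smul, complex_smul_eq (Complex.I * c) v]; simp
  have h2 : (starRingEnd ℂ) c = c.re - c.im * Complex.I := by
    apply Complex.ext <;> simp
  simp only [dbar]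
  rw [h1, complex_smul_eq c v, h2]
  simp only [map_add, map_smul]
  have h3 : ∀ (r : ℝ) (y : F), r • y = (r : ℂ) • y := fun r y => rfl
  simp only [h3, smul_add, smul_smul]
  push_cast
  set A := fderiv ℝ f x v
  set B := fderiv ℝ f x (Complex.I • v)
  rw [show ((c.re : ℂ) - c.im * Complex.I) * (1 / 2 * Complex.I) =
    1 / 2 * (Complex.I * (c.re : ℂ)) + 1 / 2 * (c.im : ℂ) by
      linear_combination (-(c.im : ℂ) / 2) * Complex.I_mul_I]
  module

theorem dbar_add_right (f : E → F) (x : E) (u v : E) :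
    dbar f x (u + v) = dbar f x u + dbar f x v := by
  simp only [dbar, smul_add, map_add]
  abel

theorem dbar_conj {P : E → ℂ} {x : E} (hP : DifferentiableAt ℂ P x) (v : E) :
    dbar (fun y => starRingEnd ℂ (P y)) x v = starRingEnd ℂ (fderiv ℂ P x v) := by
  have h1 : HasFDerivAt (fun y => starRingEnd ℂ (P y))
      ((Complex.conjCLE : ℂ →L[ℝ] ℂ).comp ((fderiv ℂ P x).restrictScalars ℝ)) x :=
    (Complex.conjCLE : ℂ →L[ℝ] ℂ).hasFDerivAt.comp x (hP.hasFDerivAt.restrictScalars ℝ)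
  simp only [dbar, h1.fderiv, ContinuousLinearMap.comp_apply,
    ContinuousLinearMap.coe_restrictScalars', map_smul, smul_eq_mul,
    ContinuousLinearEquiv.coe_coe, Complex.conjCLE_apply, map_mul, Complex.conj_I]
  linear_combination (-(1 / 2 : ℂ)) * (starRingEnd ℂ (fderiv ℂ P x v)) * Complex.I_mul_I

theorem contDiffOn_dbar {f : E → F} {Ω : Set E} (hΩ : IsOpen Ω) (hf : ContDiffOn ℝ ∞ f Ω) (v : E) :
    ContDiffOn ℝ ∞ (fun x => dbar f x v) Ω := by
  have h := hf.fderiv_of_isOpen (m := ∞) hΩ (by simp)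
  exact ((h.clm_apply contDiffOn_const).add
    ((h.clm_apply contDiffOn_const).const_smul Complex.I)).const_smul (1 / 2 : ℂ)

theorem dbar_comm {f : E → F} {x : E} (hf : ContDiffAt ℝ ∞ f x) (u v : E) :
    dbar (fun y => dbar f y u) x v = dbar (fun y => dbar f y v) x u := by
  have hsym : IsSymmSndFDerivAt ℝ f x := hf.isSymmSndFDerivAt (by simp; norm_cast)
  have hd : DifferentiableAt ℝ (fderiv ℝ f) x :=
    (hf.fderiv_right (m := 1) (by norm_cast)).differentiableAt (by simp)
  have hD : ∀ u v, fderiv ℝ (fun y => dbar f y u) x v =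
      (1 / 2 : ℂ) • (fderiv ℝ (fderiv ℝ f) x v u +
        Complex.I • fderiv ℝ (fderiv ℝ f) x v (Complex.I • u)) := by
    intro u v
    have h1 : ∀ w, HasFDerivAt (fun y => fderiv ℝ f y w)
        ((fderiv ℝ (fderiv ℝ f) x).flip w) x := by
      intro w
      have := hd.hasFDerivAt.clm_apply (hasFDerivAt_const w x)
      simpa using this
    have h2 := (((h1 u).add ((h1 (Complex.I • u)).const_smul Complex.I))).const_smul (1 / 2 : ℂ)
    have h3 : HasFDerivAt (fun y => dbar f y u) _ x := h2
    rw [h3.fderiv]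
    simp
  simp only [dbar] at hD ⊢
  rw [hD, hD, hD, hD, hsym.eq v u, hsym.eq v (Complex.I • u), hsym.eq (Complex.I • v) u,
    hsym.eq (Complex.I • v) (Complex.I • u)]
  simp only [smul_add, smul_smul]
  module

/-- For holomorphic `P`, the antiholomorphic derivative of `dP(Y)` is `dP` applied to that of
`Y`. -/
theorem dbar_fderiv_apply {P : E → ℂ} {Ω : Set E} (hΩ : IsOpen Ω) (hP : ContDiffOn ℂ ∞ P Ω)
    {Y : E → E} {x : E} (hx : x ∈ Ω) (hY : DifferentiableAt ℝ Y x) (v : E) :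
    dbar (fun y => fderiv ℂ P y (Y y)) x v = fderiv ℂ P x (dbar Y x v) := by
  have hd : DifferentiableAt ℂ (fderiv ℂ P) x :=
    ((hP.fderiv_of_isOpen (m := ∞) hΩ (by simp)).contDiffAt (hΩ.mem_nhds hx)).differentiableAt
      (by simp)
  -- The term with the second derivative of `P` is complex linear in `w`, so it cancels in `∂̄`.
  have h1 : ∀ w, fderiv ℝ (fun y => fderiv ℂ P y (Y y)) x w =
      fderiv ℂ (fderiv ℂ P) x w (Y x) + fderiv ℂ P x (fderiv ℝ Y x w) := by
    intro w
    have hb : HasFDerivAt (fun p : (E →L[ℂ] ℂ) × E => p.1 p.2) _ (fderiv ℂ P x, Y x) :=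
      (isBoundedBilinearMap_apply (𝕜 := ℂ) (E := E) (F := ℂ)).hasFDerivAt (fderiv ℂ P x, Y x)
    have h2 := (hb.restrictScalars ℝ).comp x
      ((hd.hasFDerivAt.restrictScalars ℝ).prodMk hY.hasFDerivAt)
    have h3 : HasFDerivAt (fun y => fderiv ℂ P y (Y y)) _ x := h2
    rw [h3.fderiv]
    simp [add_comm]
  simp only [dbar, h1, map_smul, map_add, smul_apply, smul_eq_mul]
  linear_combination (1 / 2 : ℂ) * (fderiv ℂ (fderiv ℂ P) x v (Y x)) * Complex.I_mul_I

/-- The coefficient of `∂̄g ∧ ∂̄F` with respect to the frame `v₁, v₂`. -/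
def jac (v₁ v₂ : E) (g F : E → ℂ) (x : E) : ℂ :=
  dbar g x v₁ * dbar F x v₂ - dbar g x v₂ * dbar F x v₁

theorem jac_mul_left {v₁ v₂ : E} {g h F : E → ℂ} {x : E} (hg : DifferentiableAt ℝ g x)
    (hh : DifferentiableAt ℝ h x) :
    jac v₁ v₂ (fun y => h y * g y) F x = h x * jac v₁ v₂ g F x + g x * jac v₁ v₂ h F x := by
  simp only [jac, dbar_mul hh hg]
  ring

theorem contDiffOn_jac {v₁ v₂ : E} {g F : E → ℂ} {Ω : Set E} (hΩ : IsOpen Ω)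
    (hg : ContDiffOn ℝ ∞ g Ω) (hF : ContDiffOn ℝ ∞ F Ω) : ContDiffOn ℝ ∞ (jac v₁ v₂ g F) Ω :=
  ((contDiffOn_dbar hΩ hg v₁).mul (contDiffOn_dbar hΩ hF v₂)).sub
    ((contDiffOn_dbar hΩ hg v₂).mul (contDiffOn_dbar hΩ hF v₁))

variable [FiniteDimensional ℂ E] [MeasurableSpace E] [BorelSpace E] (μ : Measure E)
  [μ.IsAddHaarMeasure]

theorem integral_dbar_eq_zero {W : E → ℂ} (hW : ContDiff ℝ 1 W) (hc : HasCompactSupport W) (v : E) :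
    Integrable (fun x => dbar W x v) μ ∧ ∫ x, dbar W x v ∂μ = 0 := by
  have hfd : FiniteDimensional ℝ E := FiniteDimensional.complexToReal E
  have hcont : ∀ w, Continuous fun x => fderiv ℝ W x w := fun w =>
    (hW.continuous_fderiv (by simp)).clm_apply continuous_const
  have hint : ∀ w, Integrable (fun x => fderiv ℝ W x w) μ := fun w =>
    (hcont w).integrable_of_hasCompactSupport (hc.fderiv_apply ℝ w)
  have hz : ∀ w, ∫ x, fderiv ℝ W x w ∂μ = 0 := by
    intro w
    have := integral_mul_fderiv_eq_neg_fderiv_mul_of_integrable (μ := μ) (f := fun _ => (1 : ℂ))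
      (g := W) (v := w) (by simp) (by simpa using hint w)
      (by simpa using hW.continuous.integrable_of_hasCompactSupport hc)
      (fun x _ => by fun_prop) (fun x _ => (hW.differentiable (by simp)) x)
    simpa using this
  refine ⟨((hint v).add ((hint (Complex.I • v)).smul Complex.I)).smul (1 / 2 : ℂ), ?_⟩
  simp only [dbar]
  have h := integral_add (hint v) ((hint (Complex.I • v)).smul Complex.I)
  simp only [Pi.smul_apply, integral_smul, hz, smul_zero, add_zero] at h
  rw [integral_smul, h, smul_zero]

/-- Stokes' theorem for `d(G ∂̄F)`. -/
theorem integral_jac_eq_zero (v₁ v₂ : E) {Ω K : Set E} (hΩ : IsOpen Ω) (hK : IsCompact K)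
    (hKΩ : K ⊆ Ω) {G F : E → ℂ} (hG : ContDiffOn ℝ ∞ G Ω) (hF : ContDiffOn ℝ ∞ F Ω)
    (h0 : ∀ x ∈ Ω, x ∉ K → G x = 0 ∨ F =ᶠ[𝓝 x] fun _ => 0) :
    ∫ x in Ω, jac v₁ v₂ G F x ∂μ = 0 := by
  -- The components of `G ∂̄F` extend by zero to functions with compact support. Since `∂̄∂̄F = 0`,
  -- the Jacobian is the difference of their `∂̄`-derivatives, which integrate to zero.
  set W : E → E → ℂ := fun v => Ω.indicator fun x => G x * dbar F x v with hWdef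
  have hWK : ∀ v x, x ∉ K → W v x = 0 := by
    intro v x hx
    by_cases hxΩ : x ∈ Ω
    · simp only [hWdef, indicator_of_mem hxΩ]
      rcases h0 x hxΩ hx with h | h
      · rw [h, zero_mul]
      · rw [dbar_of_eventuallyEq_zero h, mul_zero]
    · exact indicator_of_notMem hxΩ _
  have hWev : ∀ v, ∀ x ∈ Ω, W v =ᶠ[𝓝 x] fun x => G x * dbar F x v := by
    intro v x hx
    filter_upwards [hΩ.mem_nhds hx] with y hy
    exact indicator_of_mem hy _
  have hWev0 : ∀ v, ∀ x ∉ K, W v =ᶠ[𝓝 x] fun _ => 0 := by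
    intro v x hx
    filter_upwards [hK.isClosed.isOpen_compl.mem_nhds hx] with y hy
    exact hWK v y hy
  have hWs : ∀ v, ContDiff ℝ 1 (W v) := by
    intro v
    rw [contDiff_iff_contDiffAt]
    intro x
    by_cases hx : x ∈ K
    · refine ContDiffAt.congr_of_eventuallyEq ?_ (hWev v x (hKΩ hx))
      exact ((hG.mul (contDiffOn_dbar hΩ hF v)).contDiffAt (hΩ.mem_nhds (hKΩ hx))).of_le (by simp)
    · exact contDiffAt_const.congr_of_eventuallyEq (hWev0 v x hx)
  have hWc : ∀ v, HasCompactSupport (W v) := fun v => HasCompactSupport.intro hK (hWK v)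
  obtain ⟨i1, z1⟩ := integral_dbar_eq_zero μ (hWs v₂) (hWc v₂) v₁
  obtain ⟨i2, z2⟩ := integral_dbar_eq_zero μ (hWs v₁) (hWc v₁) v₂
  have hpt : ∀ x ∈ Ω, jac v₁ v₂ G F x = dbar (W v₂) x v₁ - dbar (W v₁) x v₂ := by
    intro x hx
    have hFx : ContDiffAt ℝ ∞ F x := hF.contDiffAt (hΩ.mem_nhds hx)
    have hGd : DifferentiableAt ℝ G x := (hG.contDiffAt (hΩ.mem_nhds hx)).differentiableAt (by simp)
    have hd : ∀ v, DifferentiableAt ℝ (fun x => dbar F x v) x := fun v =>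
      ((contDiffOn_dbar hΩ hF v).contDiffAt (hΩ.mem_nhds hx)).differentiableAt (by simp)
    rw [dbar_congr (hWev v₂ x hx), dbar_congr (hWev v₁ x hx), dbar_mul hGd (hd v₂),
      dbar_mul hGd (hd v₁), dbar_comm hFx v₁ v₂, jac]
    ring
  have hoff : ∀ x ∉ Ω, dbar (W v₂) x v₁ - dbar (W v₁) x v₂ = 0 := by
    intro x hx
    have hxK : x ∉ K := fun h => hx (hKΩ h)
    rw [dbar_of_eventuallyEq_zero (hWev0 _ x hxK), dbar_of_eventuallyEq_zero (hWev0 _ x hxK),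
      sub_zero]
  rw [setIntegral_congr_fun hΩ.measurableSet hpt, setIntegral_eq_integral_of_forall_compl_eq_zero
    hoff, integral_sub i1 i2, z1, z2, sub_zero]

end Calculus

/-! ### The residue pairing in coordinates: convergence, vanishing, change of equation. -/

section Residue
open Metric Set Filter MeasureTheory

variable {E : Type*} [NormedAddCommGroup E] [NormedSpace ℂ E]

/-- The density of the residue pairing `(1 / P) ∂̄g ∧ ∂̄(f dP(X))` with respect to the coordinates
dual to `v₁, v₂`; here `b` is the coefficient of a bivector field. -/
def resDensity (v₁ v₂ : E) (b P : E → ℂ) (X : E → E) (f g : E → ℂ) (x : E) : ℂ :=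
  (b x * P x)⁻¹ * jac v₁ v₂ g (fun y => f y * fderiv ℂ P y (X y)) x

/-- A nowhere vanishing holomorphic function and a smooth vector field on an open set. -/
structure IsPoissonData (V : Set E) (b : E → ℂ) (X : E → E) : Prop where
  isOpen : IsOpen V
  smooth : ContDiffOn ℂ ∞ b V
  ne_zero : ∀ x ∈ V, b x ≠ 0
  smooth_vec : ContDiffOn ℝ ∞ X V

theorem IsPoissonData.mono {V V' : Set E} {b : E → ℂ} {X : E → E} (h : IsPoissonData V b X)
    (hV' : IsOpen V') (hsub : V' ⊆ V) : IsPoissonData V' b X :=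
  ⟨hV', h.smooth.mono hsub, fun x hx => h.ne_zero x (hsub hx), h.smooth_vec.mono hsub⟩

/-- Two functions on `V` such that locally one of them vanishes, outside a compact subset `K`. -/
structure IsSupportedPair (V K : Set E) (f g : E → ℂ) : Prop where
  smooth_left : ContDiffOn ℝ ∞ f V
  smooth_right : ContDiffOn ℝ ∞ g V
  isCompact : IsCompact K
  subset : K ⊆ V
  eventually_zero : ∀ x ∈ V, x ∉ K → (f =ᶠ[𝓝 x] fun _ => 0) ∨ g =ᶠ[𝓝 x] fun _ => 0

theorem contDiffOn_fderiv_apply {V : Set E} {P : E → ℂ} {X : E → E} (hV : IsOpen V)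
    (hP : ContDiffOn ℂ ∞ P V) (hX : ContDiffOn ℝ ∞ X V) :
    ContDiffOn ℝ ∞ (fun y => fderiv ℂ P y (X y)) V := by
  have h1 : ContDiffOn ℝ ∞ (fderiv ℂ P) V :=
    (hP.fderiv_of_isOpen (m := ∞) hV (by simp)).restrict_scalars ℝ
  exact ((isBoundedBilinearMap_apply (𝕜 := ℂ) (E := E) (F := ℂ)).contDiff.restrict_scalars
    ℝ).comp_contDiffOn (h1.prodMk hX)

theorem IsSupportedPair.resDensity_eq_zero {V K : Set E} {f g : E → ℂ}
    (h : IsSupportedPair V K f g) (v₁ v₂ : E) (b P : E → ℂ) (X : E → E) {x : E} (hx : x ∈ V)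
    (hxK : x ∉ K) : resDensity v₁ v₂ b P X f g x = 0 := by
  rcases h.eventually_zero x hx hxK with h0 | h0
  · have h1 : (fun y => f y * fderiv ℂ P y (X y)) =ᶠ[𝓝 x] fun _ => 0 := by
      filter_upwards [h0] with y hy
      rw [hy, zero_mul]
    simp only [resDensity, jac, dbar_of_eventuallyEq_zero h1]
    ring
  · simp only [resDensity, jac, dbar_of_eventuallyEq_zero h0]
    ring

theorem IsSupportedPair.eventually_mul {V K : Set E} {f g : E → ℂ}
    (h : IsSupportedPair V K f g) (H k : E → ℂ) {x : E} (hx : x ∈ V) (hxK : x ∉ K) :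
    H x * g x = 0 ∨ (fun y => f y * k y) =ᶠ[𝓝 x] fun _ => 0 := by
  rcases h.eventually_zero x hx hxK with h0 | h0
  · right
    filter_upwards [h0] with y hy
    rw [hy, zero_mul]
  · left
    rw [h0.eq_of_nhds, mul_zero]

theorem IsSupportedPair.integrableOn_of_eq_zero {V K : Set E} {f g : E → ℂ} [MeasurableSpace E]
    [BorelSpace E] {μ : Measure E} [IsFiniteMeasureOnCompacts μ] (h : IsSupportedPair V K f g)
    (hV : MeasurableSet V) {F : Type*} [NormedAddCommGroup F] {T : E → F}
    (hT : ContinuousOn T V) (h0 : ∀ x ∈ V, x ∉ K → T x = 0) : IntegrableOn T V μ :=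
  ((hT.mono h.subset).integrableOn_compact h.isCompact).of_forall_sdiff_eq_zero hV
    fun x hx => h0 x hx.1 hx.2

variable [FiniteDimensional ℂ E] [MeasurableSpace E] [BorelSpace E] (μ : Measure E)
  [μ.IsAddHaarMeasure]

/-- Stokes' theorem for a pairing with holomorphic weight. -/
theorem IsSupportedPair.integral_mul_jac_eq_zero {V K : Set E} {f g : E → ℂ}
    (h : IsSupportedPair V K f g) (v₁ v₂ : E) (hV : IsOpen V) {H k : E → ℂ}
    (hH : ContDiffOn ℂ ∞ H V) (hk : ContDiffOn ℝ ∞ k V) :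
    ∫ x in V, H x * jac v₁ v₂ g (fun y => f y * k y) x ∂μ = 0 := by
  have hHr : ContDiffOn ℝ ∞ H V := hH.restrict_scalars ℝ
  -- A holomorphic `H` is constant for `∂̄`, so the integrand is `∂̄(H g) ∧ ∂̄(f k)`.
  rw [← integral_jac_eq_zero μ v₁ v₂ hV h.isCompact h.subset (hHr.mul h.smooth_right)
    (h.smooth_left.mul hk) fun x hx hxK => h.eventually_mul H k hx hxK]
  refine setIntegral_congr_fun hV.measurableSet fun x hx => ?_
  have hnb := hV.mem_nhds hx
  have hz : ∀ v, dbar H x v = 0 :=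
    dbar_eq_zero ((hH.contDiffAt hnb).differentiableAt (by simp))
  have h1 := jac_mul_left (v₁ := v₁) (v₂ := v₂) (F := fun y => f y * k y)
    ((h.smooth_right.contDiffAt hnb).differentiableAt (by simp))
    ((hHr.contDiffAt hnb).differentiableAt (by simp))
  rw [h1]
  simp [jac, hz]

variable {V K Z : Set E} {b P : E → ℂ} {X : E → E} {f g : E → ℂ}

/-- The norm of `dP` is bounded by its values on a basis, and each of these has an integrable
quotient by `P`. -/
theorem IsReducedEquation.integrableOn_norm_fderiv_div {μ : Measure E}
    (hP : IsReducedEquation μ V P Z) : IntegrableOn (fun x => ‖fderiv ℂ P x‖ / ‖P x‖) V μ := by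
  let e := Module.finBasis ℂ E
  obtain ⟨C, hC, hCb⟩ := e.exists_opNorm_le (F := ℂ)
  have hVm := hP.isOpen.measurableSet
  have hc := hP.smooth.continuousOn_fderiv_of_isOpen hP.isOpen (by simp)
  have hcP := hP.smooth.continuousOn.aemeasurable hVm (μ := μ)
  have hint : ∀ i, IntegrableOn (fun x => ‖fderiv ℂ P x (e i) / P x‖) V μ := by
    intro i
    refine Integrable.norm ⟨?_, hP.lintegral_lt_top (e i)⟩
    exact (((hc.clm_apply continuousOn_const).aemeasurable hVm).div hcP).aestronglyMeasurable
  have hsum : IntegrableOn (fun x => C * ∑ i, ‖fderiv ℂ P x (e i) / P x‖) V μ :=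
    (integrable_finsetSum _ fun i _ => hint i).const_mul C
  refine Integrable.mono' hsum ?_ (Eventually.of_forall fun x => ?_)
  · exact ((hc.norm.aemeasurable hVm).div hcP.norm).aestronglyMeasurable
  · rw [Real.norm_of_nonneg (by positivity)]
    have h1 : ‖fderiv ℂ P x‖ ≤ C * ∑ i, ‖fderiv ℂ P x (e i)‖ :=
      hCb (Finset.sum_nonneg fun i _ => norm_nonneg _) fun i =>
        Finset.single_le_sum (f := fun i => ‖fderiv ℂ P x (e i)‖) (fun i _ => norm_nonneg _)
          (Finset.mem_univ i)
    simp only [norm_div]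
    rw [← Finset.sum_div, ← mul_div_assoc]
    gcongr

/-- As `∂̄(f dP(X)) = dP(∂̄(f X))`, no second derivative of `P` enters, and the density is at most a
constant times `‖dP‖ / ‖P‖`. -/
theorem integrableOn_resDensity {μ : Measure E} (v₁ v₂ : E) (hd : IsPoissonData V b X)
    (hP : IsReducedEquation μ V P Z)
    (hfg : IsSupportedPair V K f g) : IntegrableOn (resDensity v₁ v₂ b P X f g) V μ := by
  have hV := hd.isOpen
  have hVm := hV.measurableSet
  set Y : E → E := fun y => f y • X y with hY
  have hYs : ContDiffOn ℝ ∞ Y V := hfg.smooth_left.smul hd.smooth_vec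
  have hjs : ContDiffOn ℝ ∞ (jac v₁ v₂ g (fun y => f y * fderiv ℂ P y (X y))) V :=
    contDiffOn_jac hV hfg.smooth_right
      (hfg.smooth_left.mul (contDiffOn_fderiv_apply hV hP.smooth hd.smooth_vec))
  set A : E → ℝ := fun x => ‖(b x)⁻¹‖ * (‖dbar g x v₁‖ * ‖dbar Y x v₂‖ +
    ‖dbar g x v₂‖ * ‖dbar Y x v₁‖) with hA
  have hAc : ContinuousOn A V := by
    have hbc : ContinuousOn (fun x => (b x)⁻¹) V :=
      hd.smooth.continuousOn.inv₀ hd.ne_zero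
    have hg := fun v => (contDiffOn_dbar hV hfg.smooth_right v).continuousOn.norm
    have hYc := fun v => (contDiffOn_dbar hV hYs v).continuousOn.norm
    exact hbc.norm.mul (((hg v₁).mul (hYc v₂)).add ((hg v₂).mul (hYc v₁)))
  obtain ⟨C, hC⟩ := hfg.isCompact.exists_bound_of_continuousOn (hAc.mono hfg.subset)
  refine Integrable.mono' (hP.integrableOn_norm_fderiv_div.const_mul |C|) ?_ ?_
  · exact ((((hd.smooth.continuousOn.mul hP.smooth.continuousOn).aemeasurable hVm).inv).mul
      (hjs.continuousOn.aemeasurable hVm)).aestronglyMeasurable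
  · refine (ae_restrict_iff' hVm).2 (Eventually.of_forall fun x hx => ?_)
    by_cases hxK : x ∈ K
    · have hdb : ∀ v, dbar (fun y => f y * fderiv ℂ P y (X y)) x v =
          fderiv ℂ P x (dbar Y x v) := by
        intro v
        rw [← dbar_fderiv_apply hV hP.smooth hx ((hYs.contDiffAt
          (hV.mem_nhds hx)).differentiableAt (by simp))]
        simp only [hY, map_smul, smul_eq_mul]
      have h1 : ‖jac v₁ v₂ g (fun y => f y * fderiv ℂ P y (X y)) x‖ ≤
          (‖dbar g x v₁‖ * ‖dbar Y x v₂‖ + ‖dbar g x v₂‖ * ‖dbar Y x v₁‖) * ‖fderiv ℂ P x‖ := by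
        simp only [jac, hdb]
        refine (norm_sub_le _ _).trans ?_
        rw [norm_mul, norm_mul, add_mul, mul_assoc, mul_assoc]
        gcongr
        · rw [mul_comm]; exact (fderiv ℂ P x).le_opNorm _
        · rw [mul_comm]; exact (fderiv ℂ P x).le_opNorm _
      have h2 : A x ≤ |C| := (le_abs_self _).trans ((hC x hxK).trans (le_abs_self C))
      calc ‖resDensity v₁ v₂ b P X f g x‖
          = ‖(b x)⁻¹‖ * ‖P x‖⁻¹ * ‖jac v₁ v₂ g (fun y => f y * fderiv ℂ P y (X y)) x‖ := by
            simp only [resDensity, norm_mul, mul_inv, norm_inv]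
        _ ≤ ‖(b x)⁻¹‖ * ‖P x‖⁻¹ * ((‖dbar g x v₁‖ * ‖dbar Y x v₂‖ +
              ‖dbar g x v₂‖ * ‖dbar Y x v₁‖) * ‖fderiv ℂ P x‖) := by gcongr
        _ = A x * (‖fderiv ℂ P x‖ / ‖P x‖) := by simp only [hA]; ring
        _ ≤ |C| * (‖fderiv ℂ P x‖ / ‖P x‖) := by gcongr
    · rw [hfg.resDensity_eq_zero v₁ v₂ b P X hx hxK, norm_zero]
      positivity

/-- The residue pairing vanishes if one of the functions vanishes near each point of the curve. -/
theorem integral_resDensity_eq_zero (v₁ v₂ : E) (hd : IsPoissonData V b X)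
    (hP : ContDiffOn ℂ ∞ P V) (hfg : IsSupportedPair V K f g)
    (h0 : ∀ x ∈ V, P x = 0 → (f =ᶠ[𝓝 x] fun _ => 0) ∨ g =ᶠ[𝓝 x] fun _ => 0) :
    ∫ x in V, resDensity v₁ v₂ b P X f g x ∂μ = 0 := by
  set Ω := V ∩ {x | P x ≠ 0} with hΩdef
  have hΩ : IsOpen Ω := hP.continuousOn.isOpen_inter_preimage hd.isOpen isOpen_ne
  have hΩV : Ω ⊆ V := inter_subset_left
  -- Removing the open set `N` leaves a compact set that misses the zeros of `P`. Off these zeros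
  -- the weight `(b P)⁻¹` is holomorphic, so Stokes' theorem applies.
  set N := {x | f =ᶠ[𝓝 x] fun _ => 0} ∪ {x | g =ᶠ[𝓝 x] fun _ => 0} with hN
  have hNo : IsOpen N := isOpen_setOfPred_eventually_nhds.union isOpen_setOfPred_eventually_nhds
  have hpair : IsSupportedPair Ω (K \ N) f g := by
    refine ⟨hfg.smooth_left.mono hΩV, hfg.smooth_right.mono hΩV, hfg.isCompact.diff hNo, ?_, ?_⟩
    · intro x hx
      exact ⟨hfg.subset hx.1, fun hPx => hx.2 (h0 x (hfg.subset hx.1) hPx)⟩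
    · intro x hx hxK
      by_cases hxN : x ∈ N
      · exact hxN
      · exact hfg.eventually_zero x (hΩV hx) fun h => hxK ⟨h, hxN⟩
  rw [setIntegral_eq_of_subset_of_forall_sdiff_eq_zero hd.isOpen.measurableSet hΩV]
  · refine hpair.integral_mul_jac_eq_zero μ v₁ v₂ hΩ ?_
      ((contDiffOn_fderiv_apply hd.isOpen hP hd.smooth_vec).mono hΩV)
    exact ((hd.smooth.mul hP).mono hΩV).inv fun x hx => mul_ne_zero (hd.ne_zero x hx.1) hx.2
  -- On the zeros of `P` the density is `0`, as `0⁻¹ = 0`.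
  · intro x hx
    have : P x = 0 := by
      by_contra h
      exact hx.2 ⟨hx.1, h⟩
    simp [resDensity, this]

/-- The residue pairing does not change if the equation is multiplied by a unit. -/
theorem integral_resDensity_unit {v₁ v₂ : E} {Q u : E → ℂ}
    (hd : IsPoissonData V b X) (hQs : ContDiffOn ℂ ∞ Q V) (hQ0 : μ (V ∩ {x | Q x = 0}) = 0)
    (hQi : IntegrableOn (resDensity v₁ v₂ b Q X f g) V μ) (hfg : IsSupportedPair V K f g)
    (hu : ContDiffOn ℂ ∞ u V) (hu0 : ∀ x ∈ V, u x ≠ 0) (hPQ : ∀ x ∈ V, P x = u x * Q x) :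
    ∫ x in V, resDensity v₁ v₂ b P X f g x ∂μ = ∫ x in V, resDensity v₁ v₂ b Q X f g x ∂μ := by
  have hV := hd.isOpen
  have hVm := hV.measurableSet
  have hus := contDiffOn_fderiv_apply hV hu hd.smooth_vec
  have hQX := contDiffOn_fderiv_apply hV hQs hd.smooth_vec
  have hbu : ContDiffOn ℂ ∞ (fun x => (b x * u x)⁻¹) V :=
    (hd.smooth.mul hu).inv fun x hx => mul_ne_zero (hd.ne_zero x hx) (hu0 x hx)
  -- From `dP(X) = u dQ(X) + Q du(X)` the second term contributes `T`: the factor `Q` cancels the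
  -- pole, leaving a holomorphic weight and hence integral zero.
  set T : E → ℂ := fun x => (b x * u x)⁻¹ *
    jac v₁ v₂ g (fun y => f y * fderiv ℂ u y (X y)) x with hT
  have hTzero : ∫ x in V, T x ∂μ = 0 := hfg.integral_mul_jac_eq_zero μ v₁ v₂ hV hbu hus
  have hTc : ContinuousOn T V := hbu.continuousOn.mul
    (contDiffOn_jac hV hfg.smooth_right (hfg.smooth_left.mul hus)).continuousOn
  have hToff : ∀ x ∈ V, x ∉ K → T x = 0 := fun x hx hxK => by
    have := hfg.resDensity_eq_zero v₁ v₂ b u X hx hxK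
    exact this
  have hTi : IntegrableOn T V μ := hfg.integrableOn_of_eq_zero hVm hTc hToff
  -- The cancellation of `Q` fails on its zeros, which form a null set.
  have hae : ∀ᵐ x ∂μ.restrict V, resDensity v₁ v₂ b P X f g x =
      resDensity v₁ v₂ b Q X f g x + T x := by
    rw [ae_restrict_iff' hVm]
    filter_upwards [measure_eq_zero_iff_ae_notMem.1 hQ0] with x hx0 hx
    have hQx : Q x ≠ 0 := fun h => hx0 ⟨hx, h⟩
    have hnb := hV.mem_nhds hx
    have hdu : ∀ y ∈ V, DifferentiableAt ℂ u y := fun y hy =>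
      (hu.contDiffAt (hV.mem_nhds hy)).differentiableAt (by simp)
    have hdQ : ∀ y ∈ V, DifferentiableAt ℂ Q y := fun y hy =>
      (hQs.contDiffAt (hV.mem_nhds hy)).differentiableAt (by simp)
    have hev : (fun y => f y * fderiv ℂ P y (X y)) =ᶠ[𝓝 x] fun y =>
        u y * (f y * fderiv ℂ Q y (X y)) + Q y * (f y * fderiv ℂ u y (X y)) := by
      filter_upwards [hnb] with y hy
      have h1 : P =ᶠ[𝓝 y] fun z => u z * Q z := by
        filter_upwards [hV.mem_nhds hy] with z hz using hPQ z hz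
      rw [h1.fderiv_eq, fderiv_fun_mul (hdu y hy) (hdQ y hy)]
      simp only [add_apply, smul_apply, smul_eq_mul]
      ring
    have hr : ∀ {k : E → ℂ}, ContDiffOn ℝ ∞ k V → DifferentiableAt ℝ k x := fun hk =>
      (hk.contDiffAt hnb).differentiableAt (by simp)
    have d1 := hr (hfg.smooth_left.mul hQX)
    have d2 := hr (hfg.smooth_left.mul hus)
    have du := hr (hu.restrict_scalars ℝ)
    have dQ := hr (hQs.restrict_scalars ℝ)
    have hdb : ∀ v, dbar (fun y => f y * fderiv ℂ P y (X y)) x v =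
        u x * dbar (fun y => f y * fderiv ℂ Q y (X y)) x v +
        Q x * dbar (fun y => f y * fderiv ℂ u y (X y)) x v := by
      intro v
      rw [dbar_congr hev, dbar_add (du.fun_mul d1) (dQ.fun_mul d2), dbar_mul du d1, dbar_mul dQ d2,
        dbar_eq_zero (hdu x hx), dbar_eq_zero (hdQ x hx)]
      ring
    simp only [resDensity, hT, jac, hdb, hPQ x hx]
    have hb := hd.ne_zero x hx
    have hux := hu0 x hx
    field_simp
    ring
  rw [integral_congr_ae hae, integral_add hQi hTi, hTzero, add_zero]

end Residue

/-! ### The sign of the residue pairing. -/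

section Positivity
open Metric Set Filter MeasureTheory

/-- A smooth approximation of `1 / P`. -/
def regInv {E : Type*} (P : E → ℂ) (ε : ℝ) (x : E) : ℂ :=
  starRingEnd ℂ (P x) * ((‖P x‖ ^ 2 + ε : ℝ) : ℂ)⁻¹

theorem regInv_norm_le {E : Type*} (P : E → ℂ) {ε : ℝ} (hε : 0 < ε) (x : E) :
    ‖regInv P ε x‖ ≤ ‖(P x)⁻¹‖ := by
  rw [regInv, norm_mul, norm_inv, norm_inv, RCLike.norm_conj, Complex.norm_real,
    Real.norm_of_nonneg (by positivity), ← div_eq_mul_inv]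
  by_cases h : P x = 0
  · simp [h]
  have hp : 0 < ‖P x‖ := norm_pos_iff.2 h
  rw [div_le_iff₀ (by positivity), inv_mul_eq_div, le_div_iff₀ hp]
  nlinarith

/-- At the zeros of `P` both sides are `0`, so the convergence holds at every point. -/
theorem tendsto_regInv {E : Type*} (P : E → ℂ) (x : E) :
    Tendsto (fun ε => regInv P ε x) (𝓝[>] 0) (𝓝 (P x)⁻¹) := by
  by_cases h : P x = 0
  · simp [regInv, h]
  have hp : 0 < ‖P x‖ := norm_pos_iff.2 h
  have h1 : ContinuousAt (fun ε : ℝ => regInv P ε x) 0 := by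
    refine ContinuousAt.mul continuousAt_const (ContinuousAt.inv₀ (by fun_prop) ?_)
    rw [add_zero]
    exact_mod_cast (by positivity : ‖P x‖ ^ 2 ≠ 0)
  have h2 : regInv P 0 x = (P x)⁻¹ := by
    rw [regInv, add_zero, ← Complex.normSq_eq_norm_sq, Complex.inv_def (P x), Complex.ofReal_inv]
  rw [← h2]
  exact h1.tendsto.mono_left nhdsWithin_le_nhds

variable {E : Type*} [NormedAddCommGroup E] [NormedSpace ℂ E]
variable {V K Z : Set E} {b P : E → ℂ} {X : E → E}

theorem contDiffOn_regInv (hP : ContDiffOn ℂ ∞ P V) {ε : ℝ} (hε : 0 < ε) :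
    ContDiffOn ℝ ∞ (regInv P ε) V := by
  have hPr : ContDiffOn ℝ ∞ P V := hP.restrict_scalars ℝ
  have hc : ContDiffOn ℝ ∞ (fun x => starRingEnd ℂ (P x)) V :=
    Complex.conjCLE.contDiff.comp_contDiffOn hPr
  have hn : ContDiffOn ℝ ∞ (fun x => ((‖P x‖ ^ 2 + ε : ℝ) : ℂ)) V :=
    Complex.ofRealCLM.contDiff.comp_contDiffOn ((hPr.norm_sq ℝ).add contDiffOn_const)
  refine hc.mul (hn.inv fun x _ => ?_)
  exact_mod_cast (by positivity : ‖P x‖ ^ 2 + ε ≠ 0)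

/-- Apply `∂̄` to `P̄ = regInv P ε · (P P̄ + ε)`. The factor obtained is a kernel concentrating on
`P = 0` as `ε → 0`: a smooth form of the current `∂̄(1 / P)`. -/
theorem dbar_regInv (hV : IsOpen V) (hP : ContDiffOn ℂ ∞ P V) {ε : ℝ} (hε : 0 < ε) {x : E}
    (hx : x ∈ V) (v : E) :
    dbar (regInv P ε) x v = ((ε / (‖P x‖ ^ 2 + ε) ^ 2 : ℝ) : ℂ) *
      dbar (fun y => starRingEnd ℂ (P y)) x v := by
  have hnb := hV.mem_nhds hx
  have hPd : DifferentiableAt ℂ P x := (hP.contDiffAt hnb).differentiableAt (by simp)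
  have hPr : DifferentiableAt ℝ P x := hPd.restrictScalars ℝ
  have hcd : DifferentiableAt ℝ (fun y => starRingEnd ℂ (P y)) x :=
    Complex.conjCLE.differentiableAt.comp x hPr
  have hR : DifferentiableAt ℝ (regInv P ε) x :=
    ((contDiffOn_regInv hP hε).contDiffAt hnb).differentiableAt (by simp)
  set D : E → ℂ := fun y => P y * starRingEnd ℂ (P y) + ε with hD
  have hDeq : ∀ y, D y = ((‖P y‖ ^ 2 + ε : ℝ) : ℂ) := fun y => by
    simp only [hD, Complex.mul_conj, Complex.normSq_eq_norm_sq]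
    push_cast
    ring
  have hD0 : ∀ y, D y ≠ 0 := fun y => by
    rw [hDeq]
    exact_mod_cast (by positivity : ‖P y‖ ^ 2 + ε ≠ 0)
  have hDd : DifferentiableAt ℝ D x := (hPr.fun_mul hcd).add_const _
  have hdD : dbar D x v = P x * dbar (fun y => starRingEnd ℂ (P y)) x v := by
    have h1 := dbar_add (hPr.fun_mul hcd) (differentiableAt_const (ε : ℂ)) v
    have h2 : dbar (fun _ : E => (ε : ℂ)) x v = 0 := by simp [dbar]
    rw [hD, h1, h2, dbar_mul hPr hcd, dbar_eq_zero hPd]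
    ring
  have heq : (fun y => starRingEnd ℂ (P y)) = fun y => regInv P ε y * D y := by
    ext y
    rw [regInv, ← hDeq, mul_assoc, inv_mul_cancel₀ (hD0 y), mul_one]
  have h3 := dbar_mul hR hDd v
  rw [← heq, hdD] at h3
  set c := dbar (fun y => starRingEnd ℂ (P y)) x v
  have h4 : regInv P ε x = starRingEnd ℂ (P x) * (D x)⁻¹ := by rw [regInv, ← hDeq]
  have h5 : ((ε / (‖P x‖ ^ 2 + ε) ^ 2 : ℝ) : ℂ) = ε / D x ^ 2 := by
    rw [hDeq]; push_cast; ring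
  have h6 : dbar (regInv P ε) x v * D x = c * (1 - regInv P ε x * P x) := by
    linear_combination -h3
  have h7 : 1 - regInv P ε x * P x = ε / D x := by
    rw [h4]
    have := hD0 x
    field_simp
    simp only [hD]
    ring
  rw [h5]
  have := hD0 x
  rw [h7] at h6
  field_simp at h6 ⊢
  linear_combination h6

variable [FiniteDimensional ℂ E] [MeasurableSpace E] [BorelSpace E] (μ : Measure E)
  [μ.IsAddHaarMeasure]

/-- The sign of the residue pairing. -/
theorem integral_resDensity_im (v₁ v₂ : E) (hd : IsPoissonData V b X)
    (hP : IsReducedEquation μ V P Z) {ψ q : E → ℝ}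
    (hψ : IsSupportedPair V K (fun _ => 1) (fun x => (ψ x : ℂ))) (hψ0 : ∀ x ∈ V, 0 ≤ ψ x)
    (hq : ∀ x ∈ V, (b x)⁻¹ * jac v₁ v₂ (fun y => starRingEnd ℂ (P y))
      (fun y => fderiv ℂ P y (X y)) x = Complex.I * q x) (hq0 : ∀ x ∈ V, 0 ≤ q x) :
    (∫ x in V, resDensity v₁ v₂ b P X (fun _ => 1) (fun x => (ψ x : ℂ)) x ∂μ).im ≤ 0 ∧
    ((∃ y ∈ V, P y = 0 ∧ fderiv ℂ P y ≠ 0 ∧ 0 < ψ y ∧ 0 < q y) →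
      (∫ x in V, resDensity v₁ v₂ b P X (fun _ => 1) (fun x => (ψ x : ℂ)) x ∂μ).im < 0) := by
  have hV := hd.isOpen
  have hVm := hV.measurableSet
  set F : E → ℂ := fun y => 1 * fderiv ℂ P y (X y) with hF
  have hF1 : (fun y => fderiv ℂ P y (X y)) = F := by ext y; simp [hF]
  rw [hF1] at hq
  have hdPX := contDiffOn_fderiv_apply hV hP.smooth hd.smooth_vec
  have hFs : ContDiffOn ℝ ∞ F V := hF1 ▸ hdPX
  set Ψ : E → ℂ := fun x => (ψ x : ℂ) with hΨ
  have hΨs : ContDiffOn ℝ ∞ Ψ V := hψ.smooth_right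
  have hψc : ContinuousOn ψ V := by
    have : ContinuousOn (fun x => (Ψ x).re) V :=
      Complex.continuous_re.comp_continuousOn hΨs.continuousOn
    exact this
  have hPr : ContDiffOn ℝ ∞ P V := hP.smooth.restrict_scalars ℝ
  have hbi : ContDiffOn ℂ ∞ (fun x => (b x)⁻¹) V := hd.smooth.inv hd.ne_zero
  have hconj : ContDiffOn ℝ ∞ (fun x => starRingEnd ℂ (P x)) V :=
    Complex.conjCLE.contDiff.comp_contDiffOn hPr
  have hqc : ContinuousOn q V := by
    have h1 : ContinuousOn (fun x => ((b x)⁻¹ * jac v₁ v₂ (fun y => starRingEnd ℂ (P y)) F x).im)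
        V := Complex.continuous_im.comp_continuousOn
          (hbi.continuousOn.mul (contDiffOn_jac hV hconj hFs).continuousOn)
    refine h1.congr fun x hx => ?_
    change q x = ((b x)⁻¹ * jac v₁ v₂ (fun y => starRingEnd ℂ (P y)) F x).im
    rw [hq x hx]
    simp
  have hΨ0 : ∀ x ∈ V, x ∉ K → Ψ =ᶠ[𝓝 x] fun _ => 0 := fun x hx hxK =>
    (hψ.eventually_zero x hx hxK).resolve_left fun h => one_ne_zero h.eq_of_nhds
  have hΨ0' : ∀ x ∈ V, x ∉ K → ψ x = 0 := fun x hx hxK => by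
    have h : (ψ x : ℂ) = 0 := (hΨ0 x hx hxK).eq_of_nhds
    exact_mod_cast h
  -- `J ε` is a smoothed integral of `ψ` over the curve, with density given by `q`.
  set J : ℝ → ℝ := fun ε => ∫ x in V, ψ x * (ε / (‖P x‖ ^ 2 + ε) ^ 2) * q x ∂μ with hJ
  have hJi : ∀ ε, 0 < ε →
      IntegrableOn (fun x => ψ x * (ε / (‖P x‖ ^ 2 + ε) ^ 2) * q x) V μ := by
    intro ε hε
    refine hψ.integrableOn_of_eq_zero hVm ((hψc.mul (ContinuousOn.div continuousOn_const
      (((hP.smooth.continuousOn.norm.pow 2).add continuousOn_const).pow 2)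
      fun x _ => ?_)).mul hqc) fun x hx hxK => ?_
    · have : 0 < ‖P x‖ ^ 2 + ε := by positivity
      exact pow_ne_zero 2 this.ne'
    · rw [hΨ0' x hx hxK]; ring
  -- Integration by parts moves `∂̄` from `ψ` to the regularized inverse; by `hq` the resulting form
  -- is `i` times the integrand of `J ε`.
  have hA : ∀ ε, 0 < ε → ∫ x in V, (b x)⁻¹ * regInv P ε x * jac v₁ v₂ Ψ F x ∂μ =
      -(Complex.I * J ε) := by
    intro ε hε
    have hRs := contDiffOn_regInv hP.smooth hε
    set H : E → ℂ := fun x => (b x)⁻¹ * regInv P ε x with hH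
    have hbr : ContDiffOn ℝ ∞ (fun x => (b x)⁻¹) V := hbi.restrict_scalars ℝ
    have hHs : ContDiffOn ℝ ∞ H V := hbr.mul hRs
    have h0 := integral_jac_eq_zero μ v₁ v₂ hV hψ.isCompact hψ.subset (hHs.mul hΨs) hFs
      fun x hx hxK => Or.inl (by simp only [(hΨ0 x hx hxK).eq_of_nhds, mul_zero])
    have hpt : ∀ x ∈ V, jac v₁ v₂ (fun x => H x * Ψ x) F x = H x * jac v₁ v₂ Ψ F x +
        Complex.I * ((ψ x * (ε / (‖P x‖ ^ 2 + ε) ^ 2) * q x : ℝ) : ℂ) := by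
      intro x hx
      have hnb := hV.mem_nhds hx
      have hr : ∀ {k : E → ℂ}, ContDiffOn ℝ ∞ k V → DifferentiableAt ℝ k x := fun hk =>
        (hk.contDiffAt hnb).differentiableAt (by simp)
      rw [jac_mul_left (hr hΨs) (hr hHs)]
      have hdH : ∀ v, dbar H x v = (b x)⁻¹ * (((ε / (‖P x‖ ^ 2 + ε) ^ 2 : ℝ) : ℂ) *
          dbar (fun y => starRingEnd ℂ (P y)) x v) := by
        intro v
        rw [hH, dbar_mul (hr hbr) (hr hRs), dbar_regInv hV hP.smooth hε hx,
          dbar_eq_zero ((hbi.contDiffAt hnb).differentiableAt (by simp))]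
        ring
      have hqx := hq x hx
      simp only [jac] at hqx ⊢
      rw [hdH, hdH]
      simp only [hΨ]
      push_cast
      linear_combination ((ψ x : ℂ) * (ε / (‖P x‖ ^ 2 + ε) ^ 2)) * hqx
    rw [setIntegral_congr_fun hVm hpt, integral_add, integral_const_mul,
      integral_complex_ofReal] at h0
    · exact eq_neg_of_add_eq_zero_left h0
    · refine hψ.integrableOn_of_eq_zero hVm
        (hHs.continuousOn.mul (contDiffOn_jac hV hΨs hFs).continuousOn) fun x hx hxK => ?_
      simp only [jac, dbar_of_eventuallyEq_zero (hΨ0 x hx hxK)]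
      ring
    · exact ((hJi ε hε).ofReal).const_mul _
  set R := ∫ x in V, resDensity v₁ v₂ b P X (fun _ => 1) Ψ x ∂μ with hR
  -- The residue density itself dominates, since `‖regInv P ε‖ ≤ ‖P⁻¹‖`.
  have hlim : Tendsto (fun ε => ∫ x in V, (b x)⁻¹ * regInv P ε x * jac v₁ v₂ Ψ F x ∂μ)
      (𝓝[>] 0) (𝓝 R) := by
    have hint := integrableOn_resDensity v₁ v₂ hd hP hψ
    refine tendsto_integral_filter_of_dominated_convergence
      (fun x => ‖resDensity v₁ v₂ b P X (fun _ => 1) Ψ x‖) ?_ ?_ hint.norm ?_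
    · filter_upwards [self_mem_nhdsWithin] with ε hε
      exact ((hbi.continuousOn.mul (contDiffOn_regInv hP.smooth hε).continuousOn).mul
        (contDiffOn_jac hV hΨs hFs).continuousOn).aestronglyMeasurable hVm
    · filter_upwards [self_mem_nhdsWithin] with ε hε
      refine Eventually.of_forall fun x => ?_
      simp only [resDensity, norm_mul, mul_inv]
      gcongr
      exact regInv_norm_le P hε x
    · refine Eventually.of_forall fun x => ?_
      simp only [resDensity, mul_inv]
      exact ((tendsto_regInv P x).const_mul _).mul_const _
  have hlimJ : Tendsto J (𝓝[>] 0) (𝓝 (-R.im)) := by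
    have h1 := ((Complex.continuous_im.tendsto R).comp hlim).neg
    refine h1.congr' ?_
    filter_upwards [self_mem_nhdsWithin] with ε hε
    simp [hA ε hε]
  have hnn : ∀ ε, 0 < ε → ∀ x ∈ V, 0 ≤ ψ x * (ε / (‖P x‖ ^ 2 + ε) ^ 2) * q x :=
    fun ε hε x hx => mul_nonneg (mul_nonneg (hψ0 x hx) (by positivity)) (hq0 x hx)
  constructor
  · have h1 : 0 ≤ -R.im := by
      refine ge_of_tendsto hlimJ ?_
      filter_upwards [self_mem_nhdsWithin] with ε hε
      exact setIntegral_nonneg hVm (hnn ε hε)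
    linarith
  · rintro ⟨y, hy, hPy, hdy, hψy, hqy⟩
    obtain ⟨v, hv⟩ : ∃ v, fderiv ℂ P y v ≠ 0 := by
      by_contra! h
      exact hdy (ContinuousLinearMap.ext h)
    set a := ψ y * q y / 2 with ha
    have ha0 : 0 < a := by positivity
    have hN : {x | x ∈ V ∧ a < ψ x * q x} ∈ 𝓝 y := by
      have hopen : IsOpen (V ∩ {x | a < ψ x * q x}) :=
        (hψc.mul hqc).isOpen_inter_preimage hV isOpen_Ioi
      refine hopen.mem_nhds ⟨hy, ?_⟩
      have : 0 < ψ y * q y := by positivity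
      simp only [mem_ofPred_eq, ha]
      linarith
    obtain ⟨c, hc0, ε₀, hε₀, hc⟩ := exists_pos_le_lintegral_kernel μ hV hP.smooth hy hPy hv hN
    -- The bound `c` may be infinite; its minimum with `1` is a positive real number.
    have hc' : 0 < min c 1 := lt_min hc0 one_pos
    have hctop : min c 1 ≠ ⊤ := ((min_le_right _ _).trans_lt ENNReal.one_lt_top).ne
    have hlow : ∀ ε, 0 < ε → ε < ε₀ → a * (min c 1).toReal ≤ J ε := by
      intro ε hε hεε₀
      have h1 : ENNReal.ofReal (J ε) =
          ∫⁻ x in V, ENNReal.ofReal (ψ x * (ε / (‖P x‖ ^ 2 + ε) ^ 2) * q x) ∂μ :=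
        ofReal_integral_eq_lintegral_ofReal (hJi ε hε)
          ((ae_restrict_iff' hVm).2 (Eventually.of_forall (hnn ε hε)))
      have h2 : ENNReal.ofReal a * min c 1 ≤ ENNReal.ofReal (J ε) := by
        calc ENNReal.ofReal a * min c 1
            ≤ ENNReal.ofReal a * ∫⁻ x in {x | x ∈ V ∧ a < ψ x * q x},
                ENNReal.ofReal (ε / (‖P x‖ ^ 2 + ε) ^ 2) ∂μ := by
              gcongr
              exact (min_le_left _ _).trans (hc ε hε hεε₀)
          _ = ∫⁻ x in {x | x ∈ V ∧ a < ψ x * q x}, ENNReal.ofReal a *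
                ENNReal.ofReal (ε / (‖P x‖ ^ 2 + ε) ^ 2) ∂μ :=
              (lintegral_const_mul' _ _ ENNReal.ofReal_ne_top).symm
          _ ≤ ∫⁻ x in {x | x ∈ V ∧ a < ψ x * q x},
                ENNReal.ofReal (ψ x * (ε / (‖P x‖ ^ 2 + ε) ^ 2) * q x) ∂μ := by
              have hm : MeasurableSet {x | x ∈ V ∧ a < ψ x * q x} :=
                ((hψc.mul hqc).isOpen_inter_preimage hV isOpen_Ioi).measurableSet
              refine setLIntegral_mono' hm fun x hx => ?_
              rw [← ENNReal.ofReal_mul ha0.le]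
              refine ENNReal.ofReal_le_ofReal ?_
              have : 0 ≤ ε / (‖P x‖ ^ 2 + ε) ^ 2 := by positivity
              nlinarith [hx.2]
          _ ≤ ENNReal.ofReal (J ε) := by
              rw [h1]
              exact lintegral_mono_set fun x hx => hx.1
      have h3 : 0 ≤ J ε := setIntegral_nonneg hVm (hnn ε hε)
      rw [← ENNReal.ofReal_toReal hctop, ← ENNReal.ofReal_mul ha0.le,
        ENNReal.ofReal_le_ofReal_iff h3] at h2
      exact h2
    have h4 : a * (min c 1).toReal ≤ -R.im := by
      refine ge_of_tendsto hlimJ ?_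
      have : Iio ε₀ ∈ 𝓝[>] (0 : ℝ) := nhdsWithin_le_nhds (Iio_mem_nhds hε₀)
      filter_upwards [self_mem_nhdsWithin, this] with ε hε hεε₀
      exact hlow ε hε hεε₀
    have h5 : 0 < a * (min c 1).toReal := mul_pos ha0 (ENNReal.toReal_pos hc'.ne' hctop)
    linarith

end Positivity

/-! ### Invariance of the residue pairing under holomorphic coordinate changes. -/

section ChangeOfVariables
open Metric Set Filter MeasureTheory

variable {E : Type*} [NormedAddCommGroup E] [NormedSpace ℂ E]

theorem dbar_comp {F : Type*} [NormedAddCommGroup F] [NormedSpace ℂ F] {g : E → F} {φ : E → E}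
    {x : E} (hφ : DifferentiableAt ℂ φ x) (hg : DifferentiableAt ℝ g (φ x)) (v : E) :
    dbar (fun y => g (φ y)) x v = dbar g (φ x) (fderiv ℂ φ x v) := by
  have h := hg.hasFDerivAt.comp x (hφ.hasFDerivAt.restrictScalars ℝ)
  have h' : fderiv ℝ (fun y => g (φ y)) x = _ := h.fderiv
  simp [dbar, h']

/-- `∂̄` is conjugate linear in the direction, so a `(0,2)`-form is multiplied by the conjugate of
the complex determinant. -/
theorem jac_comp (v : Module.Basis (Fin 2) ℂ E) {g F : E → ℂ} {φ : E → E} {x : E}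
    (hφ : DifferentiableAt ℂ φ x) (hg : DifferentiableAt ℝ g (φ x))
    (hF : DifferentiableAt ℝ F (φ x)) :
    jac (v 0) (v 1) (fun y => g (φ y)) (fun y => F (φ y)) x =
      starRingEnd ℂ (LinearMap.det (fderiv ℂ φ x : E →ₗ[ℂ] E)) * jac (v 0) (v 1) g F (φ x) := by
  set A := fderiv ℂ φ x with hA
  have hv : ∀ i, A (v i) = v.repr (A (v i)) 0 • v 0 + v.repr (A (v i)) 1 • v 1 := fun i => by
    conv_lhs => rw [← v.sum_repr (A (v i)), Fin.sum_univ_two]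
  rw [← LinearMap.det_toMatrix v, Matrix.det_fin_two]
  simp only [LinearMap.toMatrix_apply, ContinuousLinearMap.coe_coe]
  simp only [jac, dbar_comp hφ hg, dbar_comp hφ hF, ← hA]
  have hdb : ∀ (k : E → ℂ) i, dbar k (φ x) (A (v i)) =
      starRingEnd ℂ (v.repr (A (v i)) 0) * dbar k (φ x) (v 0) +
        starRingEnd ℂ (v.repr (A (v i)) 1) * dbar k (φ x) (v 1) := fun k i => by
    conv_lhs => rw [hv i, dbar_add_right, dbar_smul_right, dbar_smul_right]
    rfl
  simp only [hdb, map_sub, map_mul]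
  ring

theorem abs_det_restrictScalars (A : E →L[ℂ] E) :
    |(A.restrictScalars ℝ).det| = Complex.normSq (LinearMap.det (A : E →ₗ[ℂ] E)) := by
  have h : LinearMap.det ((A : E →ₗ[ℂ] E).restrictScalars ℝ) =
      Algebra.norm ℝ (LinearMap.det (A : E →ₗ[ℂ] E)) := LinearMap.det_restrictScalars
  rw [Algebra.norm_complex_apply] at h
  have h2 : (A.restrictScalars ℝ).det = Complex.normSq (LinearMap.det (A : E →ₗ[ℂ] E)) := h
  rw [h2, abs_of_nonneg (Complex.normSq_nonneg _)]

variable [FiniteDimensional ℂ E] [MeasurableSpace E] [BorelSpace E] (μ : Measure E)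
  [μ.IsAddHaarMeasure]

/-- The residue pairing does not depend on the coordinates. -/
theorem integral_resDensity_comp (v : Module.Basis (Fin 2) ℂ E) {V V' : Set E} {φ : E → E}
    (hV : IsOpen V) (hφ : ContDiffOn ℂ ∞ φ V) (hinj : InjOn φ V) (himg : φ '' V = V')
    {b b' P P' f f' g g' : E → ℂ} {X X' : E → E} (hd : IsPoissonData V' b' X')
    (hP : ContDiffOn ℂ ∞ P' V') (hf : ContDiffOn ℝ ∞ f' V') (hg : ContDiffOn ℝ ∞ g' V')
    (hbφ : ∀ x ∈ V, b' (φ x) = LinearMap.det (fderiv ℂ φ x : E →ₗ[ℂ] E) * b x)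
    (hXφ : ∀ x ∈ V, X' (φ x) = fderiv ℂ φ x (X x)) (hPφ : ∀ x ∈ V, P x = P' (φ x))
    (hfφ : ∀ x ∈ V, f x = f' (φ x)) (hgφ : ∀ x ∈ V, g x = g' (φ x)) :
    ∫ x in V', resDensity (v 0) (v 1) b' P' X' f' g' x ∂μ =
      ∫ x in V, resDensity (v 0) (v 1) b P X f g x ∂μ := by
  have hmaps : ∀ x ∈ V, φ x ∈ V' := fun x hx => himg ▸ mem_image_of_mem φ hx
  have hφd : ∀ x ∈ V, DifferentiableAt ℂ φ x := fun x hx =>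
    (hφ.contDiffAt (hV.mem_nhds hx)).differentiableAt (by simp)
  have hPd : ∀ x ∈ V', DifferentiableAt ℂ P' x := fun x hx =>
    (hP.contDiffAt (hd.isOpen.mem_nhds hx)).differentiableAt (by simp)
  rw [← himg, integral_image_eq_integral_abs_det_fderiv_smul μ hV.measurableSet
    (fun x hx => ((hφd x hx).hasFDerivAt.restrictScalars ℝ).hasFDerivWithinAt) hinj]
  refine setIntegral_congr_fun hV.measurableSet fun x hx => ?_
  have hev : ∀ {k k' : E → ℂ}, (∀ x ∈ V, k x = k' (φ x)) → k =ᶠ[𝓝 x] fun y => k' (φ y) :=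
    fun h => by filter_upwards [hV.mem_nhds hx] with y hy using h y hy
  have hF : ∀ y ∈ V, f y * fderiv ℂ P y (X y) =
      (fun z => f' z * fderiv ℂ P' z (X' z)) (φ y) := by
    intro y hy
    have h1 : P =ᶠ[𝓝 y] fun y => P' (φ y) := by
      filter_upwards [hV.mem_nhds hy] with z hz using hPφ z hz
    have h2 : fderiv ℂ (fun y => P' (φ y)) y = _ :=
      ((hPd _ (hmaps y hy)).hasFDerivAt.comp y (hφd y hy).hasFDerivAt).fderiv
    simp only [h1.fderiv_eq, h2, ContinuousLinearMap.comp_apply, hXφ y hy, hfφ y hy]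
  have hr : ∀ {k : E → ℂ}, ContDiffOn ℝ ∞ k V' → DifferentiableAt ℝ k (φ x) := fun hk =>
    (hk.contDiffAt (hd.isOpen.mem_nhds (hmaps x hx))).differentiableAt (by simp)
  have hj : jac (v 0) (v 1) g (fun y => f y * fderiv ℂ P y (X y)) x =
      starRingEnd ℂ (LinearMap.det (fderiv ℂ φ x : E →ₗ[ℂ] E)) *
        jac (v 0) (v 1) g' (fun z => f' z * fderiv ℂ P' z (X' z)) (φ x) := by
    rw [← jac_comp v (hφd x hx) (hr hg)
      (hr (hf.mul (contDiffOn_fderiv_apply hd.isOpen hP hd.smooth_vec)))]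
    simp only [jac, dbar_congr (hev hgφ), dbar_congr
      (hev (k := fun y => f y * fderiv ℂ P y (X y))
        (k' := fun z => f' z * fderiv ℂ P' z (X' z)) hF)]
  have hb := hd.ne_zero _ (hmaps x hx)
  rw [hbφ x hx] at hb
  have hdet := left_ne_zero_of_mul hb
  have hbx := right_ne_zero_of_mul hb
  simp only [resDensity]
  -- The volume contributes `|det|² = det · conj det`; `det` cancels against the change of `b`, and
  -- `conj det` is the change of the Jacobian.
  rw [hj, abs_det_restrictScalars, hbφ x hx, hPφ x hx, Complex.real_smul, ← Complex.mul_conj]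
  simp only [mul_inv]
  field_simp

end ChangeOfVariables

/-! ### Linear algebra of the contraction in dimension two. -/

section Contraction

theorem alt_comp_pair {R V W F : Type*} [Ring R] [AddCommGroup V] [Module R V] [TopologicalSpace V]
    [AddCommGroup W] [Module R W] [TopologicalSpace W] [AddCommGroup F] [Module R F]
    [TopologicalSpace F] (b : W [⋀^Fin 2]→L[R] F) (A : V →L[R] W) (l m : V) :
    b.compContinuousLinearMap A ![l, m] = b ![A l, A m] := by
  rw [ContinuousAlternatingMap.compContinuousLinearMap_apply]
  congr 1
  ext i
  fin_cases i <;> simp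

theorem alt_swap {R V W : Type*} [Ring R] [AddCommGroup V] [Module R V] [TopologicalSpace V]
    [AddCommGroup W] [Module R W] [TopologicalSpace W] (b : V [⋀^Fin 2]→L[R] W) (l m : V) :
    b ![m, l] = -b ![l, m] := by
  have h := b.toAlternatingMap.map_swap ![l, m] (i := 0) (j := 1) (by simp)
  have h2 : ![l, m] ∘ Equiv.swap (0 : Fin 2) 1 = ![m, l] := by
    ext i; fin_cases i <;> simp
  rw [h2] at h
  exact h

theorem alt_self {R V W : Type*} [Ring R] [AddCommGroup V] [Module R V] [TopologicalSpace V]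
    [AddCommGroup W] [Module R W] [TopologicalSpace W] (b : V [⋀^Fin 2]→L[R] W) (l : V) :
    b ![l, l] = 0 :=
  b.map_eq_zero_of_eq ![l, l] (i := 0) (j := 1) (by simp) (by simp)

variable {E T : Type*} [AddCommGroup E] [Module ℂ E] [TopologicalSpace E]
  [IsTopologicalAddGroup E] [ContinuousSMul ℂ E] [T2Space E] [FiniteDimensional ℂ E]
  [AddCommGroup T] [Module ℂ T] [TopologicalSpace T]
  [IsTopologicalAddGroup T] [ContinuousSMul ℂ T] [T2Space T] [FiniteDimensional ℂ T]

theorem contract01_comp (w : T [⋀^Fin 2]→L[ℝ] ℝ) (A : E →L[ℂ] T) (v u : E) :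
    contract01 (w.compContinuousLinearMap (A.restrictScalars ℝ)) v u =
      contract01 w (A v) (A u) := by
  simp only [contract01_apply, alt_comp_pair, ContinuousLinearMap.coe_restrictScalars', map_smul]

/-- The contraction is natural with respect to linear isomorphisms. -/
theorem contraction_comp (β : (T →L[ℂ] ℂ) [⋀^Fin 2]→L[ℂ] ℂ) (w : T [⋀^Fin 2]→L[ℝ] ℝ)
    (A : T →L[ℂ] E) (B : E →L[ℂ] T) (hBA : ∀ u, B (A u) = u) (v : E) :
    contraction (β.compContinuousLinearMap (ContinuousLinearMap.precomp ℂ A))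
      (w.compContinuousLinearMap (B.restrictScalars ℝ)) v = A (contraction β w (B v)) := by
  refine eq_of_forall_dual fun m => ?_
  rw [contraction_apply, contraction_apply, apply_sharp, alt_comp_pair]
  have h1 : ContinuousLinearMap.precomp ℂ A
      (contract01 (w.compContinuousLinearMap (B.restrictScalars ℝ)) v) = contract01 w (B v) := by
    ext u
    simp only [ContinuousLinearMap.precomp_apply, ContinuousLinearMap.comp_apply, contract01_comp,
      hBA]
  rw [h1, ← apply_sharp]
  rfl

/-- The continuous coordinate functionals of a basis. -/
def coordCLM {ι : Type*} (v : Module.Basis ι ℂ E) (i : ι) : E →L[ℂ] ℂ :=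
  LinearMap.toContinuousLinearMap (v.coord i)

theorem coordCLM_apply {ι : Type*} (v : Module.Basis ι ℂ E) (i : ι) (x : E) :
    coordCLM v i x = v.repr x i := rfl

theorem bivector_eq (v : Module.Basis (Fin 2) ℂ E) (β : (E →L[ℂ] ℂ) [⋀^Fin 2]→L[ℂ] ℂ)
    (l m : E →L[ℂ] ℂ) : β ![l, m] =
      β ![coordCLM v 0, coordCLM v 1] * (l (v 0) * m (v 1) - l (v 1) * m (v 0)) := by
  have h : ∀ l : E →L[ℂ] ℂ, l = l (v 0) • coordCLM v 0 + l (v 1) • coordCLM v 1 := by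
    intro l
    ext x
    conv_lhs => rw [← v.sum_repr x, Fin.sum_univ_two]
    simp only [map_add, map_smul, smul_eq_mul, add_apply, smul_apply, coordCLM_apply]
    ring
  conv_lhs => rw [h l, h m]
  simp only [alt_add_left, alt_add_right, alt_smul_left, alt_smul_right, alt_self, smul_eq_mul,
    alt_swap β (coordCLM v 0) (coordCLM v 1)]
  ring

theorem sharp_eq (v : Module.Basis (Fin 2) ℂ E) (β : (E →L[ℂ] ℂ) [⋀^Fin 2]→L[ℂ] ℂ)
    (l : E →L[ℂ] ℂ) : sharp β l =
      β ![coordCLM v 0, coordCLM v 1] • (l (v 0) • v 1 - l (v 1) • v 0) := by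
  refine eq_of_forall_dual fun m => ?_
  rw [apply_sharp, bivector_eq v]
  simp only [map_smul, map_sub, smul_eq_mul]

/-- The value of a form of type `(1,1)` on the diagonal. -/
theorem contract01_self {w : E [⋀^Fin 2]→L[ℝ] ℝ}
    (hw : ∀ u v, w ![Complex.I • u, Complex.I • v] = w ![u, v]) (u : E) :
    contract01 w u u = -(Complex.I / 2) * w ![u, Complex.I • u] := by
  rw [contract01_apply, hw, alt_self, alt_swap w u (Complex.I • u)]
  push_cast
  ring

end Contraction

/-! ### Smoothness and `∂̄`-closedness of `β · ω` in a chart. -/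

section Closedness

variable {E : Type*} [NormedAddCommGroup E] [NormedSpace ℂ E]

theorem contDiffOn_alt_apply {W : E → E [⋀^Fin 2]→L[ℝ] ℝ} {Ω : Set E}
    (hW : ContDiffOn ℝ ∞ W Ω) (u v : E) : ContDiffOn ℝ ∞ (fun x => W x ![u, v]) Ω :=
  (ContinuousAlternatingMap.apply ℝ E ℝ ![u, v]).contDiff.comp_contDiffOn hW

theorem dbar_clm_apply {A : E → E →L⋆[ℂ] E} {x : E} (hA : DifferentiableAt ℝ A x) (u v : E) :
    dbar A x u v = dbar (fun y => A y v) x u := by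
  let ev : (E →L⋆[ℂ] E) →L[ℝ] E :=
    { toFun := fun B => B v
      map_add' := fun _ _ => rfl
      map_smul' := fun _ _ => rfl
      cont := by fun_prop }
  have h1 : fderiv ℝ (fun y => A y v) x = ev.comp (fderiv ℝ A x) :=
    (ev.hasFDerivAt.comp x hA.hasFDerivAt).fderiv
  simp only [dbar, h1]
  rfl

theorem dbar_clm_comp {F G : Type*} [NormedAddCommGroup F] [NormedSpace ℂ F]
    [NormedAddCommGroup G] [NormedSpace ℂ G] (m : F →L[ℂ] G) {f : E → F} {x : E}
    (hf : DifferentiableAt ℝ f x) (v : E) : dbar (fun y => m (f y)) x v = m (dbar f x v) := by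
  have h : fderiv ℝ (fun y => m (f y)) x = (m.restrictScalars ℝ).comp (fderiv ℝ f x) :=
    ((m.restrictScalars ℝ).hasFDerivAt.comp x hf.hasFDerivAt).fderiv
  simp only [dbar, h, ContinuousLinearMap.comp_apply, ContinuousLinearMap.coe_restrictScalars',
    map_smul, map_add]

theorem contDiffOn_bivector_apply {B : E → (E →L[ℂ] ℂ) [⋀^Fin 2]→L[ℂ] ℂ} {Ω : Set E}
    (hΩ : IsOpen Ω) (hB : AnalyticOnNhd ℂ B Ω) (l m : E →L[ℂ] ℂ) :
    ContDiffOn ℂ ∞ (fun x => B x ![l, m]) Ω :=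
  (ContinuousAlternatingMap.apply ℂ (E →L[ℂ] ℂ) ℂ ![l, m]).contDiff.comp_contDiffOn
    (hB.contDiffOn hΩ.uniqueDiffOn)

variable [FiniteDimensional ℂ E]

/-- In finite dimension `A x` is a fixed real linear function of its values on a basis. -/
theorem contDiffOn_conjLinear {A : E → E →L⋆[ℂ] E} {Ω : Set E}
    (hA : ∀ v, ContDiffOn ℝ ∞ (fun x => A x v) Ω) : ContDiffOn ℝ ∞ A Ω := by
  let v := Module.finBasis ℂ E
  let c : Fin (Module.finrank ℂ E) → E →L⋆[ℂ] ℂ := fun i =>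
    ((starL ℂ : ℂ ≃L⋆[ℂ] ℂ) : ℂ →L⋆[ℂ] ℂ).comp (coordCLM v i)
  let T : Fin (Module.finrank ℂ E) → E →L[ℂ] (E →L⋆[ℂ] E) := fun i =>
    LinearMap.toContinuousLinearMap
      { toFun := fun y => (ContinuousLinearMap.toSpanSingleton ℂ y).comp (c i)
        map_add' := fun y z => by ext u; simp
        map_smul' := fun r y => by ext u; simp [smul_comm r] }
  have h : A = fun x => ∑ i, T i (A x (v i)) := by
    ext x u
    conv_lhs => rw [← v.sum_repr u, map_sum]
    rw [sum_apply]
    refine Finset.sum_congr rfl fun i _ => ?_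
    rw [map_smulₛₗ]
    rfl
  rw [h]
  exact ContDiffOn.sum fun i _ =>
    ((T i).restrictScalars ℝ).contDiff.comp_contDiffOn (hA (v i))

theorem contDiffOn_contract01 {W : E → E [⋀^Fin 2]→L[ℝ] ℝ} {Ω : Set E}
    (hW : ContDiffOn ℝ ∞ W Ω) (u v : E) : ContDiffOn ℝ ∞ (fun x => contract01 (W x) u v) Ω := by
  have h := fun u v => Complex.ofRealCLM.contDiff.comp_contDiffOn (contDiffOn_alt_apply hW u v)
  simp only [contract01_apply]
  exact contDiffOn_const.mul ((((h _ _).sub (contDiffOn_const.mul (h _ _))).add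
    (contDiffOn_const.mul (h _ _))).add (h _ _))

/-- The form `w(·⁰¹, t¹⁰)` is `∂̄`-closed for a closed form `w` of type `(1,1)`. -/
theorem dbar_contract01_comm {W : E → E [⋀^Fin 2]→L[ℝ] ℝ} {x : E}
    (hW : DifferentiableAt ℝ W x) (hcl : extDeriv W x = 0)
    (hinv : ∀ᶠ y in 𝓝 x, ∀ u v, W y ![Complex.I • u, Complex.I • v] = W y ![u, v]) (u v t : E) :
    dbar (fun y => contract01 (W y) v t) x u = dbar (fun y => contract01 (W y) u t) x v := by
  set D : E → E → E → ℝ := fun a p q => fderiv ℝ (fun y => W y ![p, q]) x a with hD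
  have hd : ∀ p q, DifferentiableAt ℝ (fun y => W y ![p, q]) x := fun p q =>
    (ContinuousAlternatingMap.apply ℝ E ℝ ![p, q]).differentiableAt.comp x hW
  have hI : ∀ a p q, D a (Complex.I • p) (Complex.I • q) = D a p q := by
    intro a p q
    have h : (fun y => W y ![Complex.I • p, Complex.I • q]) =ᶠ[𝓝 x] fun y => W y ![p, q] := by
      filter_upwards [hinv] with y hy using hy p q
    simp only [hD, h.fderiv_eq]
  have hneg : ∀ a p q, D a (Complex.I • p) q = -D a p (Complex.I • q) := by
    intro a p q
    have h : (fun y => W y ![Complex.I • p, q]) =ᶠ[𝓝 x] fun y => -W y ![p, Complex.I • q] := by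
      filter_upwards [hinv] with y hy
      rw [← hy (Complex.I • p) q, smul_smul, Complex.I_mul_I, neg_one_smul, ← neg_one_smul ℝ p,
        alt_smul_left, neg_one_smul]
    simp only [hD, h.fderiv_eq, fderiv_fun_neg]
    rfl
  have hc : ∀ a p q, D a p q - D p a q + D q a p = 0 := by
    intro a p q
    have h := extDeriv_apply hW ![a, p, q]
    rw [hcl] at h
    have h0 : (0 : Fin 3).removeNth ![a, p, q] = ![p, q] := by ext i; fin_cases i <;> rfl
    have h1 : (1 : Fin 3).removeNth ![a, p, q] = ![a, q] := by ext i; fin_cases i <;> rfl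
    have h2 : (2 : Fin 3).removeNth ![a, p, q] = ![a, p] := by ext i; fin_cases i <;> rfl
    rw [Fin.sum_univ_three, h0, h1, h2] at h
    simp at h
    simp only [hD]
    linarith
  have hC : ∀ p q a, fderiv ℝ (fun y => contract01 (W y) p q) x a = (1 / 4 : ℂ) *
      ((D a p q : ℂ) - Complex.I * D a p (Complex.I • q) + Complex.I * D a (Complex.I • p) q +
        D a (Complex.I • p) (Complex.I • q)) := by
    intro p q a
    have h := fun p q => Complex.ofRealCLM.hasFDerivAt.comp x (hd p q).hasFDerivAt
    have h1 := ((((h p q).sub ((h p (Complex.I • q)).const_mul Complex.I)).add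
      ((h (Complex.I • p) q).const_mul Complex.I)).add
        (h (Complex.I • p) (Complex.I • q))).const_mul (1 / 4 : ℂ)
    have h2 : HasFDerivAt (fun y => contract01 (W y) p q) _ x := h1
    rw [h2.fderiv]
    simp [hD]
    ring
  have hcC : ∀ a p q, (D a p q : ℂ) - D p a q + D q a p = 0 := fun a p q => by
    exact_mod_cast hc a p q
  have e₁ := hcC u v t
  have e₂ := hcC u v (Complex.I • t)
  have e₃ := hcC u (Complex.I • v) t
  have e₄ := hcC u (Complex.I • v) (Complex.I • t)
  have e₅ := hcC (Complex.I • u) v t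
  have e₆ := hcC (Complex.I • u) v (Complex.I • t)
  have e₇ := hcC (Complex.I • u) (Complex.I • v) t
  have e₈ := hcC (Complex.I • u) (Complex.I • v) (Complex.I • t)
  simp only [dbar, hC, hI, hneg, smul_eq_mul] at e₁ e₂ e₃ e₄ e₅ e₆ e₇ e₈ ⊢
  push_cast at e₁ e₂ e₃ e₄ e₅ e₆ e₇ e₈ ⊢
  -- The coefficients come from expanding `dW(u + iJu, v + iJv, t - iJt) = 0`, the `(1,2)`-part of
  -- closedness, with a factor `1 / 2` for each argument.
  linear_combination (1 / 8 : ℂ) * (e₁ - Complex.I * e₂ + Complex.I * e₃ + e₄ + Complex.I * e₅ +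
    e₆ - e₇ + Complex.I * e₈) + ((1 / 4 : ℂ) * D (Complex.I • v) u (Complex.I • t) -
      (1 / 4 : ℂ) * D (Complex.I • u) v (Complex.I • t)) * Complex.I_mul_I

variable {B : E → (E →L[ℂ] ℂ) [⋀^Fin 2]→L[ℂ] ℂ} {W : E → E [⋀^Fin 2]→L[ℝ] ℝ} {Ω : Set E}

theorem contDiffOn_contraction_apply (hE : Module.finrank ℂ E = 2) (hΩ : IsOpen Ω)
    (hB : AnalyticOnNhd ℂ B Ω) (hW : ContDiffOn ℝ ∞ W Ω) (u : E) :
    ContDiffOn ℝ ∞ (fun x => contraction (B x) (W x) u) Ω := by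
  let v : Module.Basis (Fin 2) ℂ E := Module.finBasisOfFinrankEq ℂ E hE
  have hb : ContDiffOn ℝ ∞ (fun x => B x ![coordCLM v 0, coordCLM v 1]) Ω :=
    (contDiffOn_bivector_apply hΩ hB _ _).restrict_scalars ℝ
  simp only [contraction_apply, sharp_eq v]
  exact hb.smul (((contDiffOn_contract01 hW u (v 0)).smul contDiffOn_const).sub
    ((contDiffOn_contract01 hW u (v 1)).smul contDiffOn_const))

theorem contDiffOn_contraction (hE : Module.finrank ℂ E = 2) (hΩ : IsOpen Ω)
    (hB : AnalyticOnNhd ℂ B Ω) (hW : ContDiffOn ℝ ∞ W Ω) :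
    ContDiffOn ℝ ∞ (fun x => contraction (B x) (W x)) Ω :=
  contDiffOn_conjLinear (contDiffOn_contraction_apply hE hΩ hB hW)

/-- The contraction of a holomorphic bivector field with a closed `(1,1)`-form is
`∂̄`-closed. -/
theorem dbar_contraction_comm (hE : Module.finrank ℂ E = 2) (hΩ : IsOpen Ω)
    (hB : AnalyticOnNhd ℂ B Ω) (hW : ContDiffOn ℝ ∞ W Ω) (hcl : ∀ x ∈ Ω, extDeriv W x = 0)
    (hinv : ∀ x ∈ Ω, ∀ u v, W x ![Complex.I • u, Complex.I • v] = W x ![u, v])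
    {x : E} (hx : x ∈ Ω) (u v : E) :
    dbar (fun x => contraction (B x) (W x)) x u v =
      dbar (fun x => contraction (B x) (W x)) x v u := by
  let e : Module.Basis (Fin 2) ℂ E := Module.finBasisOfFinrankEq ℂ E hE
  have hnb := hΩ.mem_nhds hx
  have hAd : DifferentiableAt ℝ (fun x => contraction (B x) (W x)) x :=
    ((contDiffOn_contraction hE hΩ hB hW).contDiffAt hnb).differentiableAt (by simp)
  have hWd : DifferentiableAt ℝ W x := (hW.contDiffAt hnb).differentiableAt (by simp)
  have hbd : DifferentiableAt ℂ (fun x => B x ![coordCLM e 0, coordCLM e 1]) x :=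
    ((contDiffOn_bivector_apply hΩ hB _ _).contDiffAt hnb).differentiableAt (by simp)
  have hc : ∀ p q, DifferentiableAt ℝ (fun x => contract01 (W x) p q) x := fun p q =>
    ((contDiffOn_contract01 hW p q).contDiffAt hnb).differentiableAt (by simp)
  have hinv' : ∀ᶠ y in 𝓝 x, ∀ u v, W y ![Complex.I • u, Complex.I • v] = W y ![u, v] := by
    filter_upwards [hnb] with y hy using hinv y hy
  rw [dbar_clm_apply hAd, dbar_clm_apply hAd]
  refine eq_of_forall_dual fun m => ?_
  -- The coefficient of the bivector is holomorphic and comes out of `∂̄`, so only derivatives of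
  -- `contract01` remain, which are symmetric.
  have hm : ∀ u v, m (dbar (fun y => contraction (B y) (W y) u) x v) =
      B x ![coordCLM e 0, coordCLM e 1] * (dbar (fun y => contract01 (W y) u (e 0)) x v * m (e 1) -
        dbar (fun y => contract01 (W y) u (e 1)) x v * m (e 0)) := by
    intro u v
    have hA : DifferentiableAt ℝ (fun y => contraction (B y) (W y) u) x :=
      (((contDiffOn_contraction_apply hE hΩ hB hW u).contDiffAt hnb).differentiableAt (by simp))
    have hbr := hbd.restrictScalars ℝ
    rw [← dbar_clm_comp m hA]
    simp only [contraction_apply, sharp_eq e, map_smul, map_sub, smul_eq_mul]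
    have h1 := (hc u (e 0)).fun_mul (differentiableAt_const (m (e 1)))
    have h2 := (hc u (e 1)).fun_mul (differentiableAt_const (-m (e 0)))
    simp only [sub_eq_add_neg, ← mul_neg]
    rw [dbar_mul hbr (h1.fun_add h2), dbar_eq_zero hbd, dbar_add h1 h2,
      dbar_mul (hc u (e 0)) (differentiableAt_const _),
      dbar_mul (hc u (e 1)) (differentiableAt_const _),
      dbar_eq_zero (differentiableAt_const _), dbar_eq_zero (differentiableAt_const _)]
    ring
  rw [hm, hm, dbar_contract01_comm hWd (hcl x hx) hinv' u v,
    dbar_contract01_comm hWd (hcl x hx) hinv' u v]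

end Closedness

/-! ### Coordinate expressions and their transition rules. -/

section Charts

variable {E : Type*} [NormedAddCommGroup E] [NormedSpace ℂ E]
  {M : Type*} [TopologicalSpace M] [ChartedSpace E M]

theorem bivectorInChart_apply (e : OpenPartialHomeomorph M E)
    (β : ∀ p : M, (TangentSpace 𝓘(ℂ, E) p →L[ℂ] ℂ) [⋀^Fin 2]→L[ℂ] ℂ) (x : E) (l m : E →L[ℂ] ℂ) :
    bivectorInChart e β x ![l, m] =
      β (e.symm x) ![l.comp (mfderiv 𝓘(ℂ, E) 𝓘(ℂ, E) e (e.symm x)),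
        m.comp (mfderiv 𝓘(ℂ, E) 𝓘(ℂ, E) e (e.symm x))] :=
  alt_comp_pair _ _ _ _

theorem form2InChart_apply (e : OpenPartialHomeomorph M E)
    (w : ∀ p : M, TangentSpace 𝓘(ℂ, E) p [⋀^Fin 2]→L[ℝ] ℝ) (x u v : E) :
    form2InChart e w x ![u, v] =
      w (e.symm x) ![mfderiv 𝓘(ℂ, E) 𝓘(ℂ, E) e.symm x u, mfderiv 𝓘(ℂ, E) 𝓘(ℂ, E) e.symm x v] :=
  alt_comp_pair _ _ _ _

theorem mfderiv_I_smul (f : E → M) (x u : E) : mfderiv 𝓘(ℂ, E) 𝓘(ℂ, E) f x (Complex.I • u) =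
    Complex.I • mfderiv 𝓘(ℂ, E) 𝓘(ℂ, E) f x u :=
  (mfderiv 𝓘(ℂ, E) 𝓘(ℂ, E) f x).map_smul Complex.I u

theorem form2InChart_invariant (w : KaehlerForm E M) (e : OpenPartialHomeomorph M E) (x u v : E) :
    form2InChart e w.toFun x ![Complex.I • u, Complex.I • v] =
      form2InChart e w.toFun x ![u, v] := by
  rw [form2InChart_apply, form2InChart_apply, mfderiv_I_smul, mfderiv_I_smul]
  exact w.invariant _ _ _

variable [IsManifold 𝓘(ℂ, E) ω M] {e e' : OpenPartialHomeomorph M E}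

theorem mdifferentiable_chart_of_mem_atlas (he : e ∈ atlas E M) :
    e.MDifferentiable 𝓘(ℂ, E) 𝓘(ℂ, E) :=
  haveI : IsManifold 𝓘(ℂ, E) 1 M := IsManifold.of_le (n := ω) (by simp)
  mdifferentiable_of_mem_atlas he

theorem mfderiv_symm_mfderiv (he : e ∈ atlas E M) {x : E} (hx : x ∈ e.target)
    (u : TangentSpace 𝓘(ℂ, E) (e.symm x)) :
    mfderiv 𝓘(ℂ, E) 𝓘(ℂ, E) e.symm x (mfderiv 𝓘(ℂ, E) 𝓘(ℂ, E) e (e.symm x) u) = u := by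
  have h := (mdifferentiable_chart_of_mem_atlas he).symm_comp_deriv (e.map_target hx)
  rw [e.right_inv hx] at h
  exact congrArg (fun L => L u) h

theorem mfderiv_mfderiv_symm (he : e ∈ atlas E M) {x : E} (hx : x ∈ e.target) (u : E) :
    mfderiv 𝓘(ℂ, E) 𝓘(ℂ, E) e (e.symm x) (mfderiv 𝓘(ℂ, E) 𝓘(ℂ, E) e.symm x u) = u := by
  have h := (mdifferentiable_chart_of_mem_atlas he).comp_symm_deriv hx
  exact congrArg (fun L => L u) h

theorem contDiffOn_transition (he : e ∈ atlas E M) (he' : e' ∈ atlas E M) {V : Set E}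
    (hV : V ⊆ e.target) (hV' : ∀ x ∈ V, e.symm x ∈ e'.source) :
    ContDiffOn ℂ ∞ (fun x => e' (e.symm x)) V := by
  have h1 : ContMDiffOn 𝓘(ℂ, E) 𝓘(ℂ, E) ω e' e'.source :=
    contMDiffOn_of_mem_maximalAtlas (IsManifold.subset_maximalAtlas he')
  have h2 : ContMDiffOn 𝓘(ℂ, E) 𝓘(ℂ, E) ω e.symm e.target :=
    contMDiffOn_symm_of_mem_maximalAtlas (IsManifold.subset_maximalAtlas he)
  have h3 : ContMDiffOn 𝓘(ℂ, E) 𝓘(ℂ, E) ω (fun x => e' (e.symm x)) V := h1.comp (h2.mono hV) hV'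
  exact (contMDiffOn_iff_contDiffOn.1 h3).of_le (by simp)

theorem fderiv_transition (he : e ∈ atlas E M) (he' : e' ∈ atlas E M) {x : E} (hx : x ∈ e.target)
    (hx' : e.symm x ∈ e'.source) (u : TangentSpace 𝓘(ℂ, E) (e.symm x)) :
    fderiv ℂ (fun y => e' (e.symm y)) x (mfderiv 𝓘(ℂ, E) 𝓘(ℂ, E) e (e.symm x) u) =
      mfderiv 𝓘(ℂ, E) 𝓘(ℂ, E) e' (e.symm x) u := by
  have h := mfderiv_comp x ((mdifferentiable_chart_of_mem_atlas he').mdifferentiableAt hx')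
    ((mdifferentiable_chart_of_mem_atlas he).mdifferentiableAt_symm hx)
  rw [mfderiv_eq_fderiv] at h
  have h2 : fderiv ℂ (fun y => e' (e.symm y)) x = _ := h
  rw [h2]
  change mfderiv 𝓘(ℂ, E) 𝓘(ℂ, E) e' (e.symm x) (mfderiv 𝓘(ℂ, E) 𝓘(ℂ, E) e.symm x
    (mfderiv 𝓘(ℂ, E) 𝓘(ℂ, E) e (e.symm x) u)) = _
  rw [mfderiv_symm_mfderiv he hx]

theorem vecInChart_transition (he : e ∈ atlas E M) (he' : e' ∈ atlas E M) {x : E}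
    (hx : x ∈ e.target) (hx' : e.symm x ∈ e'.source) (ξ : ∀ p : M, TangentSpace 𝓘(ℂ, E) p) :
    vecInChart e' ξ (e' (e.symm x)) =
      fderiv ℂ (fun y => e' (e.symm y)) x (vecInChart e ξ x) := by
  rw [vecInChart, vecInChart, fderiv_transition he he' hx hx', e'.left_inv hx']

theorem form2InChart_positive (he : e ∈ atlas E M) {x : E} (hx : x ∈ e.target)
    (w : KaehlerForm E M) {v : E} (hv : v ≠ 0) :
    0 < form2InChart e w.toFun x ![v, Complex.I • v] := by
  rw [form2InChart_apply, mfderiv_I_smul]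
  refine w.positive _ _ fun h => hv ?_
  rw [← mfderiv_mfderiv_symm he hx v, h]
  exact map_zero _

variable [FiniteDimensional ℂ E]

/-- In dimension two a bivector has a single coefficient, and a linear map acts on it by its
determinant. -/
theorem bivectorInChart_transition (v : Module.Basis (Fin 2) ℂ E) (he : e ∈ atlas E M)
    (he' : e' ∈ atlas E M) {x : E} (hx : x ∈ e.target) (hx' : e.symm x ∈ e'.source)
    (β : ∀ p : M, (TangentSpace 𝓘(ℂ, E) p →L[ℂ] ℂ) [⋀^Fin 2]→L[ℂ] ℂ) :
    bivectorInChart e' β (e' (e.symm x)) ![coordCLM v 0, coordCLM v 1] =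
      LinearMap.det (fderiv ℂ (fun y => e' (e.symm y)) x : E →ₗ[ℂ] E) *
        bivectorInChart e β x ![coordCLM v 0, coordCLM v 1] := by
  set A := fderiv ℂ (fun y => e' (e.symm y)) x with hA
  have h1 : bivectorInChart e' β (e' (e.symm x)) ![coordCLM v 0, coordCLM v 1] =
      bivectorInChart e β x ![(coordCLM v 0).comp A, (coordCLM v 1).comp A] := by
    rw [bivectorInChart_apply, bivectorInChart_apply, e'.left_inv hx']
    have h : ∀ l : E →L[ℂ] ℂ, l.comp (mfderiv 𝓘(ℂ, E) 𝓘(ℂ, E) e' (e.symm x)) =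
        (l.comp A).comp (mfderiv 𝓘(ℂ, E) 𝓘(ℂ, E) e (e.symm x)) := fun l => by
      ext u
      exact congrArg l (fderiv_transition he he' hx hx' u).symm
    exact congrArg₂ (fun l m => β (e.symm x) ![l, m]) (h _) (h _)
  rw [h1, bivector_eq v, ← LinearMap.det_toMatrix v, Matrix.det_fin_two]
  simp only [LinearMap.toMatrix_apply, ContinuousLinearMap.coe_coe, ContinuousLinearMap.comp_apply,
    coordCLM_apply]
  ring

theorem form01InChart_betaOmega (he : e ∈ atlas E M) {x : E} (hx : x ∈ e.target)
    (β : HolomorphicBivector E M) (w : KaehlerForm E M) :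
    form01InChart e (betaOmega β w) x =
      contraction (bivectorInChart e β.toFun x) (form2InChart e w.toFun x) := by
  ext v
  exact (contraction_comp (β.toFun (e.symm x)) (w.toFun (e.symm x))
    (mfderiv 𝓘(ℂ, E) 𝓘(ℂ, E) e (e.symm x)) (mfderiv 𝓘(ℂ, E) 𝓘(ℂ, E) e.symm x)
    (fun u => mfderiv_symm_mfderiv he hx u) v).symm

theorem betaOmega_mem_dolbeaultCocycles (hE : Module.finrank ℂ E = 2)
    (w : KaehlerForm E M) (β : HolomorphicBivector E M) :
    betaOmega β w ∈ dolbeaultCocycles E M := by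
  refine ⟨fun e he => ?_, fun e he x hx u v => ?_⟩
  · exact (contDiffOn_contraction hE e.open_target (β.holomorphic e he) (w.smooth e he)).congr
      fun x hx => form01InChart_betaOmega he hx β w
  · have h : form01InChart e (betaOmega β w) =ᶠ[𝓝 x]
        fun x => contraction (bivectorInChart e β.toFun x) (form2InChart e w.toFun x) := by
      filter_upwards [e.open_target.mem_nhds hx] with y hy using form01InChart_betaOmega he hy β w
    rw [dbar_congr h, dbar_congr h, sub_eq_zero]
    exact dbar_contraction_comm hE e.open_target (β.holomorphic e he) (w.smooth e he)
      (w.closed e he) (fun x _ => form2InChart_invariant w e x) hx u v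

end Charts

/-! ### Comparison of reduced equations, and the positive density. -/

section Pairing
open Metric Set Filter MeasureTheory

variable {E : Type*} [NormedAddCommGroup E] [NormedSpace ℂ E]

theorem eq_of_frequently_eq {α β : Type*} [TopologicalSpace α] [TopologicalSpace β] [T2Space β]
    {f g : α → β} {x : α} (hf : ContinuousAt f x) (hg : ContinuousAt g x)
    (h : ∃ᶠ y in 𝓝 x, f y = g y) : f x = g x := by
  by_contra hne
  have h1 : ∀ᶠ y in 𝓝 x, f y ≠ g y := (hf.prodMk hg).eventually_mem
    ((isClosed_diagonal (X := β)).isOpen_compl.mem_nhds hne)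
  exact h (h1.mono fun _ hy => hy)

/-- Two reduced equations of the same curve differ by a unit. -/
theorem IsReducedEquation.exists_unit [MeasurableSpace E] {μ : Measure E} {V Z : Set E}
    {P Q : E → ℂ} (hP : IsReducedEquation μ V P Z) (hQ : ContDiffOn ℂ ∞ Q V)
    (hQZ : ∀ x ∈ V, x ∈ Z → Q x = 0)
    (hdiv : ∀ x ∈ V, ∃ q : E → ℂ, ContinuousAt q x ∧ ∀ᶠ y in 𝓝 x, P y = q y * Q y) :
    ∃ u : E → ℂ, ContDiffOn ℂ ∞ u V ∧ (∀ x ∈ V, u x ≠ 0) ∧ ∀ x ∈ V, Q x = u x * P x := by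
  -- Near each point `P` divides `Q`, with a local quotient `q x`; the unit is glued from these as
  -- `x ↦ q x x`.
  have hloc : ∀ x, ∃ (N : Set E) (q : E → ℂ), x ∈ V → IsOpen N ∧ x ∈ N ∧ ContDiffOn ℂ ∞ q N ∧
      ∀ y ∈ N, Q y = q y * P y := by
    intro x
    by_cases hx : x ∈ V
    · obtain ⟨N, q, h1, h2, h3, h4⟩ := hP.exists_eq_mul x hx V Q hP.isOpen hx hQ hQZ
      exact ⟨N, q, fun _ => ⟨h1, h2, h3, h4⟩⟩
    · exact ⟨∅, 0, fun h => absurd h hx⟩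
  choose N q hq using hloc
  have hfreq : ∀ x ∈ V, ∃ᶠ y in 𝓝 x, P y ≠ 0 := fun x hx => by
    simpa [not_eventually] using hP.not_eventually_zero hx
  have hqc : ∀ x ∈ V, ∀ y ∈ N x, ContinuousAt (q x) y := fun x hx y hy =>
    (hq x hx).2.2.1.continuousOn.continuousAt ((hq x hx).1.mem_nhds hy)
  -- Local quotients agree where `P ≠ 0`, hence by continuity on overlaps, because `P` vanishes
  -- identically near no point.
  have hu : ∀ x ∈ V, ∀ y ∈ N x, y ∈ V → q y y = q x y := by
    intro x hx y hy hyV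
    refine eq_of_frequently_eq (hqc y hyV y (hq y hyV).2.1) (hqc x hx y hy) ?_
    have h1 : ∀ᶠ z in 𝓝 y, z ∈ N y ∧ z ∈ N x := by
      filter_upwards [(hq y hyV).1.mem_nhds (hq y hyV).2.1, (hq x hx).1.mem_nhds hy] with z h1 h2
        using ⟨h1, h2⟩
    refine ((hfreq y hyV).and_eventually h1).mono fun z hz => ?_
    have h2 := (hq y hyV).2.2.2 z hz.2.1
    rw [(hq x hx).2.2.2 z hz.2.2] at h2
    exact (mul_right_cancel₀ hz.1 h2).symm
  refine ⟨fun x => q x x, fun x hx => ?_, fun x hx h0 => ?_, fun x hx =>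
    (hq x hx).2.2.2 x (hq x hx).2.1⟩
  · have hNx := (hq x hx).1.mem_nhds (hq x hx).2.1
    have h1 : (fun x => q x x) =ᶠ[𝓝 x] q x := by
      filter_upwards [hNx, hP.isOpen.mem_nhds hx] with y hy hyV using hu x hx y hy hyV
    exact (((hq x hx).2.2.1.contDiffAt hNx).congr_of_eventuallyEq h1).contDiffWithinAt
  -- Conversely `Q` divides `P`, and the product of the two quotients is `1`.
  · obtain ⟨r, hr, hPr⟩ := hdiv x hx
    have h1 : r x * q x x = 1 := by
      refine eq_of_frequently_eq (f := fun y => r y * q x y) (g := fun _ => 1)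
        (hr.mul (hqc x hx x (hq x hx).2.1)) continuousAt_const ?_
      refine ((hfreq x hx).and_eventually
        (hPr.and ((hq x hx).1.mem_nhds (hq x hx).2.1))).mono fun y hy => ?_
      have h2 := hy.2.1
      rw [(hq x hx).2.2.2 y hy.2.2] at h2
      refine mul_right_cancel₀ hy.1 ?_
      rw [one_mul, mul_assoc]
      exact h2.symm
    simp only at h0
    rw [h0, mul_zero] at h1
    exact zero_ne_one h1

theorem dbar_sum {ι F : Type*} [NormedAddCommGroup F] [NormedSpace ℂ F] (s : Finset ι)
    {f : ι → E → F} {x : E} (hf : ∀ i ∈ s, DifferentiableAt ℝ (f i) x) (v : E) :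
    dbar (fun y => ∑ i ∈ s, f i y) x v = ∑ i ∈ s, dbar (f i) x v := by
  simp only [dbar, fderiv_fun_sum hf, sum_apply, Finset.smul_sum, Finset.sum_add_distrib,
    smul_add]

variable {ι : Type*} {v₁ v₂ : E} {b P : E → ℂ} {X : E → E} {x : E}

theorem resDensity_sum_left (s : Finset ι) {f : ι → E → ℂ} {g : E → ℂ}
    (hf : ∀ i ∈ s, DifferentiableAt ℝ (fun y => f i y * fderiv ℂ P y (X y)) x) :
    resDensity v₁ v₂ b P X (fun y => ∑ i ∈ s, f i y) g x =
      ∑ i ∈ s, resDensity v₁ v₂ b P X (f i) g x := by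
  simp only [resDensity, jac, Finset.sum_mul, dbar_sum s hf, Finset.mul_sum,
    ← Finset.sum_sub_distrib, mul_sub]

theorem resDensity_sum_right (s : Finset ι) {f : E → ℂ} {g : ι → E → ℂ}
    (hg : ∀ i ∈ s, DifferentiableAt ℝ (g i) x) :
    resDensity v₁ v₂ b P X f (fun y => ∑ i ∈ s, g i y) x =
      ∑ i ∈ s, resDensity v₁ v₂ b P X f (g i) x := by
  simp only [resDensity, jac, dbar_sum s hg, Finset.sum_mul, Finset.mul_sum,
    ← Finset.sum_sub_distrib, mul_sub]

/-- The vector spanning the kernel of `dP`. -/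
def kerVec (v : Module.Basis (Fin 2) ℂ E) (P : E → ℂ) (x : E) : E :=
  fderiv ℂ P x (v 1) • v 0 - fderiv ℂ P x (v 0) • v 1

theorem kerVec_ne_zero (v : Module.Basis (Fin 2) ℂ E) {P : E → ℂ} {x : E}
    (h : fderiv ℂ P x ≠ 0) : kerVec v P x ≠ 0 := by
  intro h0
  refine h (ContinuousLinearMap.ext fun y => ?_)
  have h1 : fderiv ℂ P x (v 1) = 0 := by
    simpa [kerVec] using congrArg (fun z => v.repr z 0) h0
  have h2 : fderiv ℂ P x (v 0) = 0 := by
    simpa [kerVec] using congrArg (fun z => v.repr z 1) h0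
  rw [← v.sum_repr y, Fin.sum_univ_two]
  simp [h1, h2]

variable [FiniteDimensional ℂ E]

/-- Applying `dP` to the contraction gives `b` times `contract01` evaluated on `kerVec v P x`, and
`b` cancels. The conjugate factors from `P̄` put the same vector in the other, conjugate linear
argument. This vector spans the kernel of `dP` if `dP ≠ 0`, so at a regular point of `P = 0` the
form is evaluated on a tangent vector of the curve. -/
theorem inv_mul_jac_conj_eq (v : Module.Basis (Fin 2) ℂ E) {V : Set E} (hV : IsOpen V)
    (hP : ContDiffOn ℂ ∞ P V) (hx : x ∈ V) (hX : DifferentiableAt ℝ X x)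
    {B : (E →L[ℂ] ℂ) [⋀^Fin 2]→L[ℂ] ℂ} {W : E [⋀^Fin 2]→L[ℝ] ℝ}
    (hdb : ∀ u, dbar X x u = contraction B W u)
    (hinv : ∀ u v, W ![Complex.I • u, Complex.I • v] = W ![u, v])
    (hb : B ![coordCLM v 0, coordCLM v 1] ≠ 0) :
    (B ![coordCLM v 0, coordCLM v 1])⁻¹ * jac (v 0) (v 1) (fun y => starRingEnd ℂ (P y))
        (fun y => fderiv ℂ P y (X y)) x =
      Complex.I * ((1 / 2 * W ![kerVec v P x, Complex.I • kerVec v P x] : ℝ) : ℂ) := by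
  have hPd : DifferentiableAt ℂ P x := (hP.contDiffAt (hV.mem_nhds hx)).differentiableAt (by simp)
  have h1 : ∀ u, dbar (fun y => fderiv ℂ P y (X y)) x u =
      B ![coordCLM v 0, coordCLM v 1] * contract01 W u (kerVec v P x) := by
    intro u
    rw [dbar_fderiv_apply hV hP hx hX, hdb, contraction_apply, apply_sharp, bivector_eq v]
    simp only [kerVec, map_sub, map_smul, smul_eq_mul]
    ring
  have h2 : ∀ t, contract01 W (kerVec v P x) t = starRingEnd ℂ (fderiv ℂ P x (v 1)) *
      contract01 W (v 0) t - starRingEnd ℂ (fderiv ℂ P x (v 0)) * contract01 W (v 1) t := by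
    intro t
    rw [kerVec, sub_eq_add_neg, ← neg_smul, contract01_add, contract01_smul, contract01_smul]
    simp only [add_apply, smul_apply, smul_eq_mul, map_neg]
    ring
  have h3 := contract01_self hinv (kerVec v P x)
  simp only [jac, h1, dbar_conj hPd]
  rw [h2] at h3
  push_cast
  field_simp
  linear_combination (-2 : ℂ) * h3

end Pairing

/-! ### The residue pairing on the manifold and its independence of the chart. -/

section ManifoldPairing
open Metric Set Filter MeasureTheory

theorem eventuallyEq_comp_symm {E M : Type*} [TopologicalSpace E] [TopologicalSpace M]
    {e : OpenPartialHomeomorph M E} {x : E} (hx : x ∈ e.target) {f : M → ℂ}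
    (hf : f =ᶠ[𝓝 (e.symm x)] fun _ => 0) :
    (fun y => f (e.symm y)) =ᶠ[𝓝 x] fun _ => 0 :=
  (e.symm.continuousAt hx).eventually hf

variable {E : Type*} [NormedAddCommGroup E] [NormedSpace ℂ E]
  {M : Type*} [TopologicalSpace M] [ChartedSpace E M]

variable (E) in
/-- Smooth complex valued functions on `M`. -/
def IsSmoothFun (f : M → ℂ) : Prop :=
  ∀ e ∈ atlas E M, ContDiffOn ℝ ∞ (fun x => f (e.symm x)) e.target

variable (E) in
/-- Two smooth functions such that locally one of them vanishes, outside a compact set `K`. -/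
structure IsSupportedOn (K : Set M) (f g : M → ℂ) : Prop where
  smooth_left : IsSmoothFun E f
  smooth_right : IsSmoothFun E g
  isCompact : IsCompact K
  eventually_zero : ∀ p ∉ K, (f =ᶠ[𝓝 p] fun _ => 0) ∨ g =ᶠ[𝓝 p] fun _ => 0

theorem IsSupportedOn.isSupportedPair {K : Set M} {f g : M → ℂ} (h : IsSupportedOn E K f g)
    {e : OpenPartialHomeomorph M E} (he : e ∈ atlas E M) {V : Set E} (hV : V ⊆ e.target)
    (hK : K ⊆ e.source ∩ e ⁻¹' V) :
    IsSupportedPair V (e '' K) (fun x => f (e.symm x)) (fun x => g (e.symm x)) where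
  smooth_left := (h.smooth_left e he).mono hV
  smooth_right := (h.smooth_right e he).mono hV
  isCompact := h.isCompact.image_of_continuousOn (e.continuousOn.mono fun _ hp => (hK hp).1)
  subset := by
    rintro _ ⟨p, hp, rfl⟩
    exact (hK hp).2
  eventually_zero x hx hxK :=
    (h.eventually_zero (e.symm x) fun hp => hxK ⟨_, hp, e.right_inv (hV hx)⟩).imp
      (eventuallyEq_comp_symm (hV hx)) (eventuallyEq_comp_symm (hV hx))

variable [FiniteDimensional ℂ E]

/-- The coefficient of a bivector field in a chart. -/
def coeffInChart (v : Module.Basis (Fin 2) ℂ E)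
    (β : ∀ p : M, (TangentSpace 𝓘(ℂ, E) p →L[ℂ] ℂ) [⋀^Fin 2]→L[ℂ] ℂ)
    (e : OpenPartialHomeomorph M E) (x : E) : ℂ :=
  bivectorInChart e β x ![coordCLM v 0, coordCLM v 1]

variable [MeasurableSpace E]

/-- The residue pairing in a chart. -/
def pairing (μ : Measure E) (v : Module.Basis (Fin 2) ℂ E)
    (β : ∀ p : M, (TangentSpace 𝓘(ℂ, E) p →L[ℂ] ℂ) [⋀^Fin 2]→L[ℂ] ℂ)
    (ξ : ∀ p : M, TangentSpace 𝓘(ℂ, E) p) (e : OpenPartialHomeomorph M E) (V : Set E) (P : E → ℂ)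
    (f g : M → ℂ) : ℂ :=
  ∫ x in V, resDensity (v 0) (v 1) (coeffInChart v β e) P (vecInChart e ξ)
    (fun x => f (e.symm x)) (fun x => g (e.symm x)) x ∂μ

/-- A chart of `M` in which `C` has a reduced equation and in which `β` has no zeros. -/
structure IsCurveChart (μ : Measure E) (v : Module.Basis (Fin 2) ℂ E)
    (β : ∀ p : M, (TangentSpace 𝓘(ℂ, E) p →L[ℂ] ℂ) [⋀^Fin 2]→L[ℂ] ℂ)
    (ξ : ∀ p : M, TangentSpace 𝓘(ℂ, E) p) (C : Set M) (e : OpenPartialHomeomorph M E)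
    (V : Set E) (P : E → ℂ) : Prop where
  mem_atlas : e ∈ atlas E M
  subset : V ⊆ e.target
  equation : IsReducedEquation μ V P (e.symm ⁻¹' C)
  data : IsPoissonData V (coeffInChart v β e) (vecInChart e ξ)

variable {μ : Measure E} {v : Module.Basis (Fin 2) ℂ E}
  {β : ∀ p : M, (TangentSpace 𝓘(ℂ, E) p →L[ℂ] ℂ) [⋀^Fin 2]→L[ℂ] ℂ}
  {ξ : ∀ p : M, TangentSpace 𝓘(ℂ, E) p} {C K : Set M} {e e' : OpenPartialHomeomorph M E}
  {V V' : Set E} {P P' : E → ℂ} {f g : M → ℂ}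

theorem pairing_one_right (f : M → ℂ) : pairing μ v β ξ e V P f (fun _ => 1) = 0 := by
  have h : ∀ x u : E, dbar (fun _ : E => (1 : ℂ)) x u = 0 := fun x u =>
    dbar_eq_zero (differentiableAt_const _) u
  simp [pairing, resDensity, jac, h]

variable [BorelSpace E]

theorem IsCurveChart.pairing_restrict (h : IsCurveChart μ v β ξ C e V P)
    (hfg : IsSupportedOn E K f g) {V₀ : Set E} (hV₀ : V₀ ⊆ V) (hK : K ⊆ e.source ∩ e ⁻¹' V₀) :
    pairing μ v β ξ e V P f g = pairing μ v β ξ e V₀ P f g := by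
  refine setIntegral_eq_of_subset_of_forall_sdiff_eq_zero h.data.isOpen.measurableSet hV₀
    fun x hx => ?_
  refine (hfg.isSupportedPair h.mem_atlas h.subset fun p hp => ⟨(hK hp).1,
    hV₀ (hK hp).2⟩).resDensity_eq_zero _ _ _ _ _ hx.1 ?_
  rintro ⟨p, hp, rfl⟩
  exact hx.2 (hK hp).2

/-- The residue pairing does not depend on the chart and on the equation. -/
theorem IsCurveChart.pairing_eq [IsManifold 𝓘(ℂ, E) ω M] [μ.IsAddHaarMeasure]
    (h : IsCurveChart μ v β ξ C e V P) (h' : IsCurveChart μ v β ξ C e' V' P')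
    (hfg : IsSupportedOn E K f g)
    (hK : K ⊆ e.source ∩ e ⁻¹' V) (hK' : K ⊆ e'.source ∩ e' ⁻¹' V') :
    pairing μ v β ξ e' V' P' f g = pairing μ v β ξ e V P f g := by
  -- `V₀` and `V₀'` are the overlap of the two domains as seen in the two charts; the pair is
  -- supported there.
  set V₀ := V ∩ e.symm ⁻¹' (e'.source ∩ e' ⁻¹' V') with hV₀
  set V₀' := V' ∩ e'.symm ⁻¹' (e.source ∩ e ⁻¹' V) with hV₀'
  have hopen : IsOpen V₀ := (e.symm.continuousOn.mono h.subset).isOpen_inter_preimage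
    h.data.isOpen (e'.isOpen_inter_preimage h'.data.isOpen)
  have hopen' : IsOpen V₀' := (e'.symm.continuousOn.mono h'.subset).isOpen_inter_preimage
    h'.data.isOpen (e.isOpen_inter_preimage h.data.isOpen)
  have hsub : V₀ ⊆ V := inter_subset_left
  have hsub' : V₀' ⊆ V' := inter_subset_left
  have hK₀ : K ⊆ e.source ∩ e ⁻¹' V₀ := fun p hp => by
    refine ⟨(hK hp).1, (hK hp).2, ?_⟩
    rw [mem_preimage, e.left_inv (hK hp).1]
    exact hK' hp
  have hK₀' : K ⊆ e'.source ∩ e' ⁻¹' V₀' := fun p hp => by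
    refine ⟨(hK' hp).1, (hK' hp).2, ?_⟩
    rw [mem_preimage, e'.left_inv (hK' hp).1]
    exact hK hp
  rw [h.pairing_restrict hfg hsub hK₀, h'.pairing_restrict hfg hsub' hK₀']
  have hφ := contDiffOn_transition h.mem_atlas h'.mem_atlas (hsub.trans h.subset)
    fun x hx => hx.2.1
  have hφ' := contDiffOn_transition h'.mem_atlas h.mem_atlas (hsub'.trans h'.subset)
    fun x hx => hx.2.1
  have hl : ∀ x ∈ V₀, e'.symm (e' (e.symm x)) = e.symm x := fun x hx => e'.left_inv hx.2.1
  have hl' : ∀ x ∈ V₀', e.symm (e (e'.symm x)) = e'.symm x := fun x hx => e.left_inv hx.2.1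
  have hll : ∀ x ∈ V₀, e (e'.symm (e' (e.symm x))) = x := fun x hx => by
    rw [hl x hx, e.right_inv (h.subset hx.1)]
  have hll' : ∀ x ∈ V₀', e' (e.symm (e (e'.symm x))) = x := fun x hx => by
    rw [hl' x hx, e'.right_inv (h'.subset hx.1)]
  have hmaps : MapsTo (fun x => e' (e.symm x)) V₀ V₀' := fun x hx => by
    refine ⟨hx.2.2, ?_⟩
    rw [mem_preimage, hl x hx]
    refine ⟨e.map_target (h.subset hx.1), ?_⟩
    rw [mem_preimage, e.right_inv (h.subset hx.1)]
    exact hx.1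
  have hmaps' : MapsTo (fun x => e (e'.symm x)) V₀' V₀ := fun x hx => by
    refine ⟨hx.2.2, ?_⟩
    rw [mem_preimage, hl' x hx]
    refine ⟨e'.map_target (h'.subset hx.1), ?_⟩
    rw [mem_preimage, e'.right_inv (h'.subset hx.1)]
    exact hx.1
  have hinj : InjOn (fun x => e' (e.symm x)) V₀ := fun x hx y hy hxy => by
    have := congrArg (fun z => e (e'.symm z)) hxy
    simp only at this
    rwa [hll x hx, hll y hy] at this
  have himg : (fun x => e' (e.symm x)) '' V₀ = V₀' :=
    Subset.antisymm hmaps.image_subset fun x hx => ⟨_, hmaps' hx, hll' x hx⟩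
  have hPs' : ContDiffOn ℂ ∞ P' V₀' := h'.equation.smooth.mono hsub'
  have hQ : ContDiffOn ℂ ∞ (fun x => P' (e' (e.symm x))) V₀ := hPs'.comp hφ hmaps
  have hred := h.equation.mono hopen hsub
  have hpair := hfg.isSupportedPair h.mem_atlas (hsub.trans h.subset) hK₀
  have hpair' := hfg.isSupportedPair h'.mem_atlas (hsub'.trans h'.subset) hK₀'
  -- In the chart `e` the transported equation `P'` differs from `P` by a unit: each divides the
  -- other, since each generates the ideal of `C`.
  obtain ⟨u, hu, hu0, hQu⟩ := hred.exists_unit hQ (fun x hx hxC => by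
    refine (h'.equation.eq_zero_iff _ hx.2.2).2 ?_
    rw [mem_preimage, hl x hx]
    exact hxC) (fun x hx => by
    obtain ⟨N, q, hN, hxN, hq, hqP⟩ := h'.equation.exists_eq_mul _ hx.2.2 V₀'
      (fun z => P (e (e'.symm z))) hopen' (hmaps hx)
      ((h.equation.smooth.mono hsub).comp hφ' hmaps') fun y hy hyC => by
        refine (h.equation.eq_zero_iff _ (hmaps' hy).1).2 ?_
        rw [mem_preimage, hl' y hy]
        exact hyC
    have hc : ContinuousAt (fun x => e' (e.symm x)) x :=
      hφ.continuousOn.continuousAt (hopen.mem_nhds hx)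
    refine ⟨fun y => q (e' (e.symm y)), ?_, ?_⟩
    · exact ContinuousAt.comp (f := fun y => e' (e.symm y)) (g := q)
        (hq.continuousOn.continuousAt (hN.mem_nhds hxN)) hc
    · filter_upwards [hopen.mem_nhds hx, hc (hN.mem_nhds hxN)] with y hy hyN
      have := hqP _ hyN
      rwa [hll y hy] at this)
  have hd := h.data.mono hopen hsub
  -- The coordinate change replaces `P'` by its pullback, and the unit then replaces the pullback by
  -- `P`.
  refine (integral_resDensity_comp μ v hopen hφ hinj himg (h'.data.mono hopen' hsub') hPs'
    hpair'.smooth_left hpair'.smooth_right (b := coeffInChart v β e) (X := vecInChart e ξ)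
    (P := fun x => P' (e' (e.symm x))) (f := fun x => f (e.symm x)) (g := fun x => g (e.symm x))
    (fun x hx => bivectorInChart_transition v h.mem_atlas h'.mem_atlas (h.subset hx.1) hx.2.1 β)
    (fun x hx => vecInChart_transition h.mem_atlas h'.mem_atlas (h.subset hx.1) hx.2.1 ξ)
    (fun _ _ => rfl) (fun x hx => by rw [hl x hx]) fun x hx => by rw [hl x hx]).trans ?_
  exact integral_resDensity_unit μ hd hred.smooth hred.measure_zeros
    (integrableOn_resDensity _ _ hd hred hpair) hpair hu hu0 hQu

/-- The residue pairing vanishes if one of the functions vanishes near `C`. -/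
theorem IsCurveChart.pairing_eq_zero [μ.IsAddHaarMeasure] (h : IsCurveChart μ v β ξ C e V P)
    (hfg : IsSupportedOn E K f g) (hK : K ⊆ e.source ∩ e ⁻¹' V)
    (h0 : ∀ p ∈ C, (f =ᶠ[𝓝 p] fun _ => 0) ∨ g =ᶠ[𝓝 p] fun _ => 0) :
    pairing μ v β ξ e V P f g = 0 :=
  integral_resDensity_eq_zero μ _ _ h.data h.equation.smooth
    (hfg.isSupportedPair h.mem_atlas h.subset hK) fun x hx hPx =>
      (h0 (e.symm x) ((h.equation.eq_zero_iff x hx).1 hPx)).imp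
        (eventuallyEq_comp_symm (h.subset hx)) (eventuallyEq_comp_symm (h.subset hx))

theorem IsCurveChart.pairing_sum_left {ι : Type*} {s : Finset ι} {f : ι → M → ℂ}
    (h : IsCurveChart μ v β ξ C e V P) (hfg : ∀ i ∈ s, IsSupportedOn E K (f i) g)
    (hK : K ⊆ e.source ∩ e ⁻¹' V) :
    pairing μ v β ξ e V P (fun p => ∑ i ∈ s, f i p) g = ∑ i ∈ s, pairing μ v β ξ e V P (f i) g := by
  have hpair := fun i hi => (hfg i hi).isSupportedPair h.mem_atlas h.subset hK
  simp only [pairing]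
  rw [← integral_finsetSum _ fun i hi =>
    integrableOn_resDensity _ _ h.data h.equation (hpair i hi)]
  refine setIntegral_congr_fun h.data.isOpen.measurableSet fun x hx => ?_
  refine resDensity_sum_left s fun i hi => ?_
  exact (((hpair i hi).smooth_left.mul (contDiffOn_fderiv_apply h.data.isOpen h.equation.smooth
    h.data.smooth_vec)).contDiffAt (h.data.isOpen.mem_nhds hx)).differentiableAt (by simp)

theorem IsCurveChart.pairing_sum_right {ι : Type*} {s : Finset ι} {g : ι → M → ℂ}
    (h : IsCurveChart μ v β ξ C e V P) (hfg : ∀ i ∈ s, IsSupportedOn E K f (g i))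
    (hK : K ⊆ e.source ∩ e ⁻¹' V) :
    pairing μ v β ξ e V P f (fun p => ∑ i ∈ s, g i p) = ∑ i ∈ s, pairing μ v β ξ e V P f (g i) := by
  have hpair := fun i hi => (hfg i hi).isSupportedPair h.mem_atlas h.subset hK
  simp only [pairing]
  rw [← integral_finsetSum _ fun i hi =>
    integrableOn_resDensity _ _ h.data h.equation (hpair i hi)]
  refine setIntegral_congr_fun h.data.isOpen.measurableSet fun x hx => ?_
  refine resDensity_sum_right s fun i hi => ?_
  exact ((hpair i hi).smooth_right.contDiffAt (h.data.isOpen.mem_nhds hx)).differentiableAt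
    (by simp)

end ManifoldPairing

/-! ### Charts around the curve, the vanishing sum, and the sign of each term. -/

section Conclusion
open Metric Set Filter MeasureTheory

variable {E : Type*} [NormedAddCommGroup E] [NormedSpace ℂ E]
  {M : Type*} [TopologicalSpace M] [ChartedSpace E M]

theorem IsSmoothFun.const (c : ℂ) : IsSmoothFun E (fun _ : M => c) :=
  fun _ _ => contDiffOn_const

/-- The real structure serves to obtain smooth partitions of unity. -/
theorem isManifold_real [IsManifold 𝓘(ℂ, E) ω M] : IsManifold 𝓘(ℝ, E) ∞ M := by
  refine isManifold_of_contDiffOn 𝓘(ℝ, E) ∞ M fun e e' he he' => ?_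
  have h := (contDiffOn_transition he he' (V := (e.symm.trans e').source)
    (fun x hx => hx.1) fun x hx => hx.2).restrict_scalars ℝ
  simpa [Function.comp_def] using h

theorem isSmoothFun_of_contMDiff [IsManifold 𝓘(ℝ, E) ∞ M] {ψ : M → ℝ}
    (hψ : ContMDiff 𝓘(ℝ, E) 𝓘(ℝ) ∞ ψ) : IsSmoothFun E fun p => (ψ p : ℂ) := by
  intro e he
  have h1 : ContMDiffOn 𝓘(ℝ, E) 𝓘(ℝ, E) ∞ e.symm e.target :=
    contMDiffOn_symm_of_mem_maximalAtlas (IsManifold.subset_maximalAtlas he)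
  have h2 : ContDiffOn ℝ ∞ (fun x => ψ (e.symm x)) e.target :=
    contMDiffOn_iff_contDiffOn.1 (hψ.comp_contMDiffOn h1)
  exact Complex.ofRealCLM.contDiff.comp_contDiffOn h2

variable [FiniteDimensional ℂ E] [IsManifold 𝓘(ℂ, E) ω M] {v : Module.Basis (Fin 2) ℂ E}

theorem coeffInChart_ne_zero {e : OpenPartialHomeomorph M E} (he : e ∈ atlas E M)
    {β : ∀ p : M, (TangentSpace 𝓘(ℂ, E) p →L[ℂ] ℂ) [⋀^Fin 2]→L[ℂ] ℂ} {x : E} (hx : x ∈ e.target)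
    (hβ : β (e.symm x) ≠ 0) : coeffInChart v β e x ≠ 0 := by
  intro h0
  refine hβ (ContinuousAlternatingMap.ext fun m => ?_)
  set B : E →L[ℂ] TangentSpace 𝓘(ℂ, E) (e.symm x) := mfderiv 𝓘(ℂ, E) 𝓘(ℂ, E) e.symm x with hB
  have h1 := bivectorInChart_apply e β x ((m 0).comp B) ((m 1).comp B)
  rw [bivector_eq v] at h1
  have h2 : ∀ i, ((m i).comp B).comp (mfderiv 𝓘(ℂ, E) 𝓘(ℂ, E) e (e.symm x)) = m i := by
    intro i
    ext u
    exact congrArg (m i) (mfderiv_symm_mfderiv he hx u)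
  have h3 : m = ![((m 0).comp B).comp (mfderiv 𝓘(ℂ, E) 𝓘(ℂ, E) e (e.symm x)),
      ((m 1).comp B).comp (mfderiv 𝓘(ℂ, E) 𝓘(ℂ, E) e (e.symm x))] := by
    ext i : 1
    fin_cases i
    · exact (h2 0).symm
    · exact (h2 1).symm
  rw [h3]
  refine h1.symm.trans ?_
  change coeffInChart v β e x * _ = 0
  rw [h0, zero_mul]

variable [MeasurableSpace E] [BorelSpace E] {μ : Measure E} [μ.IsAddHaarMeasure]

/-- The chart is cut down to where the equation of `C` is defined and the coefficient of `β` is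
nonzero; a reduced equation exists on a smaller neighbourhood. -/
theorem exists_isCurveChart (hE : Module.finrank ℂ E = 2) (β : HolomorphicBivector E M)
    {ξ : ∀ p : M, TangentSpace 𝓘(ℂ, E) p} (hξ : IsSmoothVec ξ) {C : Set M}
    (hC : IsCompactCurve E C) {p : M} (hp : p ∈ C) (hβ : β.toFun p ≠ 0) :
    ∃ (e : OpenPartialHomeomorph M E) (V : Set E) (P : E → ℂ), p ∈ e.source ∩ e ⁻¹' V ∧
      IsCurveChart μ v β.toFun ξ C e V P := by
  set e := chartAt E p with he
  have hmem : e ∈ atlas E M := chart_mem_atlas E p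
  have hps : p ∈ e.source := mem_chart_source E p
  obtain ⟨U, h, hU, hpU, hh, hUC, hne⟩ := hC.exists_equation p hp
  have hbs : ContDiffOn ℂ ∞ (coeffInChart v β.toFun e) e.target :=
    contDiffOn_bivector_apply e.open_target (β.holomorphic e hmem) _ _
  set O₁ := e.target ∩ e.symm ⁻¹' U with hO₁
  have hO₁o : IsOpen O₁ := e.symm.isOpen_inter_preimage hU
  set O := O₁ ∩ coeffInChart v β.toFun e ⁻¹' {0}ᶜ with hO
  have hOo : IsOpen O := (hbs.continuousOn.mono inter_subset_left).isOpen_inter_preimage hO₁o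
    isOpen_compl_singleton
  have hx : e p ∈ O := by
    refine ⟨⟨e.map_source hps, ?_⟩, ?_⟩
    · rw [mem_preimage, e.left_inv hps]
      exact hpU
    · refine coeffInChart_ne_zero hmem (e.map_source hps) ?_
      have h : ∀ q, q = p → β.toFun q ≠ 0 := by
        rintro _ rfl
        exact hβ
      exact h _ (e.left_inv hps)
  have hs : ContDiffOn ℂ ∞ (fun x => h (e.symm x)) O := by
    have h2 : ContMDiffOn 𝓘(ℂ, E) 𝓘(ℂ, E) ω e.symm e.target :=
      contMDiffOn_symm_of_mem_maximalAtlas (IsManifold.subset_maximalAtlas hmem)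
    have h3 : ContMDiffOn 𝓘(ℂ, E) 𝓘(ℂ, ℂ) ω (fun x => h (e.symm x)) O :=
      hh.comp (h2.mono fun x hx => hx.1.1) fun x hx => hx.1.2
    exact (contMDiffOn_iff_contDiffOn.1 h3).of_le (by simp)
  obtain ⟨V, P, hxV, hVO, hP⟩ := exists_isReducedEquation μ hE (Z := e.symm ⁻¹' C) hOo hs hx
    (by rw [e.left_inv hps]; exact (hUC p hpU).1 hp)
    (fun hev => hne (by
      filter_upwards [(e.continuousAt hps).eventually hev, e.open_source.mem_nhds hps] with q hq hqs
      rwa [e.left_inv hqs] at hq))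
    (fun x hx => hUC _ hx.1.2)
  have hVt : V ⊆ e.target := fun x hx => (hVO hx).1.1
  exact ⟨e, V, P, ⟨hps, hxV⟩, hmem, hVt, hP, hP.isOpen, hbs.mono hVt, fun x hx => (hVO hx).2,
    (hξ e hmem).mono hVt⟩

/-- The sum of the residue pairings over a partition of unity vanishes. -/
theorem sum_pairing_eq_zero {ι : Type*} [Fintype ι] [T2Space M]
    {β : ∀ p : M, (TangentSpace 𝓘(ℂ, E) p →L[ℂ] ℂ) [⋀^Fin 2]→L[ℂ] ℂ}
    {ξ : ∀ p : M, TangentSpace 𝓘(ℂ, E) p} {C : Set M} {e : ι → OpenPartialHomeomorph M E}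
    {V : ι → Set E} {P : ι → E → ℂ} (h : ∀ i, IsCurveChart μ v β ξ C (e i) (V i) (P i))
    {K : ι → Set M} (hKc : ∀ i, IsCompact (K i)) (hK : ∀ i, K i ⊆ (e i).source ∩ e i ⁻¹' V i)
    {Ψ : Option ι → M → ℂ} (hΨ : ∀ k, IsSmoothFun E (Ψ k)) (hsum : ∀ p, ∑ k, Ψ k p = 1)
    (hΨK : ∀ i, ∀ p ∉ K i, Ψ (some i) =ᶠ[𝓝 p] fun _ => 0)
    (hΨC : ∀ p ∈ C, Ψ none =ᶠ[𝓝 p] fun _ => 0) :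
    ∑ i, pairing μ v β ξ (e i) (V i) (P i) (fun _ => 1) (Ψ (some i)) = 0 := by
  have hone : (fun _ : M => (1 : ℂ)) = fun p => ∑ k, Ψ k p := funext fun p => (hsum p).symm
  have hl : ∀ i k, IsSupportedOn E (K i) (Ψ k) (Ψ (some i)) := fun i k =>
    ⟨hΨ k, hΨ _, hKc i, fun p hp => Or.inr (hΨK i p hp)⟩
  have hr : ∀ i k, IsSupportedOn E (K i) (Ψ (some i)) (Ψ k) := fun i k =>
    ⟨hΨ _, hΨ k, hKc i, fun p hp => Or.inl (hΨK i p hp)⟩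
  -- Expand the left function `1`. The term of `none` drops out because it vanishes near `C`; the
  -- term of `k` is supported in both domains and can be computed in the chart `k`.
  have h1 : ∀ i, pairing μ v β ξ (e i) (V i) (P i) (fun _ => 1) (Ψ (some i)) =
      ∑ k, pairing μ v β ξ (e k) (V k) (P k) (Ψ (some k)) (Ψ (some i)) := by
    intro i
    rw [hone, (h i).pairing_sum_left (fun k _ => hl i k) (hK i), Fintype.sum_option,
      (h i).pairing_eq_zero (hl i none) (hK i) fun p hp => Or.inl (hΨC p hp), zero_add]
    refine Finset.sum_congr rfl fun k _ => ?_
    refine (h k).pairing_eq (h i) (K := K k ∩ K i) ⟨hΨ _, hΨ _, (hKc k).inter (hKc i), ?_⟩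
      (inter_subset_left.trans (hK k)) (inter_subset_right.trans (hK i))
    intro p hp
    by_cases hpk : p ∈ K k
    · exact Or.inr (hΨK i p fun hpi => hp ⟨hpk, hpi⟩)
    · exact Or.inl (hΨK k p hpk)
  -- With the chart `k` fixed, the right functions add up to `1`, again up to one vanishing near
  -- `C`, and `∂̄1 = 0`.
  have h2 : ∀ k, ∑ i, pairing μ v β ξ (e k) (V k) (P k) (Ψ (some k)) (Ψ (some i)) = 0 := by
    intro k
    have h3 := (h k).pairing_sum_right (s := Finset.univ) (fun i _ => hr k i) (hK k)
    rwa [← hone, pairing_one_right, Fintype.sum_option,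
      (h k).pairing_eq_zero (hr k none) (hK k) fun p hp => Or.inr (hΨC p hp), zero_add,
      eq_comm] at h3
  rw [Finset.sum_congr rfl fun i _ => h1 i, Finset.sum_comm]
  exact Finset.sum_eq_zero fun k _ => h2 k

/-- The sign of the residue pairing if `β · ω = ∂̄ξ`. -/
theorem IsCurveChart.pairing_im {β : HolomorphicBivector E M} {w : KaehlerForm E M}
    {ξ : ∀ p : M, TangentSpace 𝓘(ℂ, E) p} (hξ : IsDbarOf (betaOmega β w) ξ)
    {C K : Set M} {e : OpenPartialHomeomorph M E} {V : Set E} {P : E → ℂ}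
    (h : IsCurveChart μ v β.toFun ξ C e V P) {ψ : M → ℝ} (hψ : ∀ p, 0 ≤ ψ p)
    (hψs : IsSupportedOn E K (fun _ => 1) fun p => (ψ p : ℂ)) (hK : K ⊆ e.source ∩ e ⁻¹' V) :
    (pairing μ v β.toFun ξ e V P (fun _ => 1) fun p => (ψ p : ℂ)).im ≤ 0 ∧
    ((∃ p ∈ C, 0 < ψ p) →
      (pairing μ v β.toFun ξ e V P (fun _ => 1) fun p => (ψ p : ℂ)).im < 0) := by
  have hpair := hψs.isSupportedPair h.mem_atlas h.subset hK
  set q : E → ℝ := fun x => 1 / 2 * form2InChart e w.toFun x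
    ![kerVec v P x, Complex.I • kerVec v P x] with hq
  have hq0 : ∀ x ∈ V, fderiv ℂ P x ≠ 0 → 0 < q x := fun x hx hd =>
    mul_pos (by norm_num) (form2InChart_positive h.mem_atlas (h.subset hx) w (kerVec_ne_zero v hd))
  have hq0' : ∀ x ∈ V, 0 ≤ q x := fun x hx => by
    by_cases hd : fderiv ℂ P x = 0
    · have : kerVec v P x = 0 := by simp [kerVec, hd]
      simp only [hq, this, smul_zero, alt_self, mul_zero, le_refl]
    · exact (hq0 x hx hd).le
  obtain ⟨h1, h2⟩ := integral_resDensity_im μ (v 0) (v 1) h.data h.equation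
    (ψ := fun x => ψ (e.symm x)) (q := q) hpair (fun x _ => hψ _) (fun x hx => by
      refine inv_mul_jac_conj_eq v h.data.isOpen h.equation.smooth hx
        ((h.data.smooth_vec.contDiffAt (h.data.isOpen.mem_nhds hx)).differentiableAt (by simp))
        (fun u => ?_) (form2InChart_invariant w e x) (h.data.ne_zero x hx)
      rw [← hξ e h.mem_atlas x (h.subset hx), form01InChart_betaOmega h.mem_atlas (h.subset hx)])
    hq0'
  refine ⟨h1, fun ⟨p, hpC, hp⟩ => h2 ?_⟩
  have hpK : p ∈ K := by
    by_contra hpK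
    rcases hψs.eventually_zero p hpK with h0 | h0
    · exact one_ne_zero h0.eq_of_nhds
    · have : (ψ p : ℂ) = 0 := h0.eq_of_nhds
      exact hp.ne' (by exact_mod_cast this)
  have hpe : e.symm (e p) = p := e.left_inv (hK hpK).1
  have hx : e p ∈ V := (hK hpK).2
  have hc : ContinuousAt (fun x => ψ (e.symm x)) (e p) := by
    have h3 : ContinuousAt (fun x => ((ψ (e.symm x) : ℂ)).re) (e p) :=
      Complex.continuous_re.continuousAt.comp
        (hpair.smooth_right.continuousOn.continuousAt (h.data.isOpen.mem_nhds hx))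
    exact h3
  have hN : {x | 0 < ψ (e.symm x)} ∩ V ∈ 𝓝 (e p) :=
    inter_mem (hc.eventually (lt_mem_nhds (by simpa only [hpe] using hp)))
      (h.data.isOpen.mem_nhds hx)
  -- The point `p` may be singular on `C`. Regular points are dense, so there is one nearby at which
  -- `ψ` is still positive.
  obtain ⟨y, hy, hPy, hdy⟩ := h.equation.exists_regular (e p) hx
    ((h.equation.eq_zero_iff _ hx).2 (by rw [mem_preimage, hpe]; exact hpC)) _ hN
  exact ⟨y, hy.2, hPy, hdy, hy.1, hq0 y hy.2 hdy⟩

end Conclusion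

/-! ### The contradiction from a primitive of `β · ω`. -/

section Obstruction
open Set Filter MeasureTheory

/-- If `β` has no zeros on a compact curve then `β · ω` is not `∂̄`-exact. -/
theorem not_isDbarOf_betaOmega {E : Type*} [NormedAddCommGroup E] [NormedSpace ℂ E]
    [FiniteDimensional ℂ E] (hE : Module.finrank ℂ E = 2) {M : Type*} [TopologicalSpace M]
    [ChartedSpace E M] [IsManifold 𝓘(ℂ, E) ω M] [T2Space M] [SecondCountableTopology M]
    (w : KaehlerForm E M) (β : HolomorphicBivector E M) {C : Set M}
    (hC : IsCompactCurve E C) (hβ : ∀ p ∈ C, β.toFun p ≠ 0)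
    {ξ : ∀ p : M, TangentSpace 𝓘(ℂ, E) p} (hξ : IsSmoothVec ξ) :
    ¬ IsDbarOf (betaOmega β w) ξ := by
  intro hdb
  let _ : MeasurableSpace E := borel E
  have : BorelSpace E := ⟨rfl⟩
  have : FiniteDimensional ℝ E := FiniteDimensional.complexToReal E
  have : IsManifold 𝓘(ℝ, E) ∞ M := isManifold_real
  have : LocallyCompactSpace M := ChartedSpace.locallyCompactSpace E M
  let μ : Measure E := Measure.addHaar
  let v : Module.Basis (Fin 2) ℂ E := Module.finBasisOfFinrankEq ℂ E hE
  have hex := fun p : C => exists_isCurveChart (μ := μ) (v := v) hE β hξ hC p.2 (hβ p p.2)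
  choose e V P hpU hch using hex
  choose L hLc hL using fun p : C => exists_compact_mem_nhds (p : M)
  -- The interior of the compact set `L p` forces functions supported in `U p` to have compact
  -- support.
  set U : C → Set M := fun p => ((e p).source ∩ e p ⁻¹' V p) ∩ interior (L p) with hU
  have hUo : ∀ p, IsOpen (U p) := fun p =>
    ((e p).isOpen_inter_preimage (hch p).data.isOpen).inter isOpen_interior
  obtain ⟨t, ht⟩ := hC.isCompact.elim_finite_subcover U hUo fun p hp =>
    mem_iUnion.2 ⟨⟨p, hp⟩, hpU ⟨p, hp⟩, mem_interior_iff_mem_nhds.2 (hL ⟨p, hp⟩)⟩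
  -- A partition of unity on a compact neighbourhood of `C` sums to `1` near `C`, not only on it.
  obtain ⟨K, hKc, hCK, hKU⟩ := exists_compact_between hC.isCompact
    (isOpen_biUnion fun p (_ : p ∈ t) => hUo p) ht
  obtain ⟨ψ, hψ⟩ := SmoothPartitionOfUnity.exists_isSubordinate 𝓘(ℝ, E) hKc.isClosed
    (fun i : t => U i) (fun i => hUo i) (by simpa [iUnion_subtype] using hKU)
  have hψsum : ∀ p ∈ K, ∑ i, ψ i p = 1 := fun p hp => by
    rw [← finsum_eq_sum_of_fintype]
    exact ψ.sum_eq_one hp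
  have hψs : ∀ i, IsSmoothFun E fun p => (ψ i p : ℂ) := fun i =>
    isSmoothFun_of_contMDiff (ψ i).contMDiff
  let S : t → Set M := fun i => tsupport (ψ i)
  have hSc : ∀ i, IsCompact (S i) := fun i => (hLc i).of_isClosed_subset (isClosed_tsupport _)
    ((hψ i).trans (inter_subset_right.trans interior_subset))
  have hSU : ∀ i, S i ⊆ (e i).source ∩ e i ⁻¹' V i := fun i => (hψ i).trans inter_subset_left
  have hS0 : ∀ i, ∀ p ∉ S i, (fun p => (ψ i p : ℂ)) =ᶠ[𝓝 p] fun _ => 0 := fun i p hp => by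
    filter_upwards [notMem_tsupport_iff_eventuallyEq.1 hp] with q hq
    simp [hq]
  -- The extra function completes the sum to `1` on all of `M` and vanishes near `C`.
  let Ψ : Option t → M → ℂ := fun k => k.elim (fun p => 1 - ∑ i, (ψ i p : ℂ)) fun i p => ψ i p
  have hzero := sum_pairing_eq_zero (μ := μ) (v := v) (fun i : t => hch i) hSc hSU (Ψ := Ψ)
    (fun k => by
      cases k with
      | none => exact fun e he => contDiffOn_const.sub (ContDiffOn.sum fun i _ => hψs i e he)
      | some i => exact hψs i)
    (fun p => by rw [Fintype.sum_option]; simp [Ψ])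
    hS0
    (fun p hp => by
      filter_upwards [isOpen_interior.mem_nhds (hCK hp)] with q hq
      simp only [Ψ, Option.elim_none, sub_eq_zero]
      exact_mod_cast (hψsum q (interior_subset hq)).symm)
  have hsign := fun i : t => (hch i).pairing_im hdb (ψ := ψ i) (fun p => ψ.nonneg i p)
    ⟨IsSmoothFun.const 1, hψs i, hSc i, fun p hp => Or.inr (hS0 i p hp)⟩ (hSU i)
  obtain ⟨p, hp⟩ := hC.nonempty
  obtain ⟨i, hi⟩ : ∃ i, 0 < ψ i p := by
    by_contra! hneg
    have := hψsum p (interior_subset (hCK hp))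
    linarith [Finset.sum_nonpos fun i (_ : i ∈ Finset.univ) => hneg i]
  have hlt := Finset.sum_lt_sum (s := Finset.univ) (fun j _ => (hsign j).1)
    ⟨i, Finset.mem_univ i, (hsign i).2 ⟨p, hp, hi⟩⟩
  rw [Finset.sum_const_zero, ← Complex.im_sum] at hlt
  exact hlt.ne (by rw [← Complex.zero_im]; exact congrArg Complex.im hzero)

end Obstruction

end KaehlerPoisson

end

theorem mainTheorem10 {E : Type*} [NormedAddCommGroup E] [NormedSpace ℂ E] [FiniteDimensional ℂ E]
    (hE : Module.finrank ℂ E = 2)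
    {M : Type*} [TopologicalSpace M] [T2Space M] [SecondCountableTopology M]
    [ChartedSpace E M] [IsManifold 𝓘(ℂ, E) ω M]
    (w : KaehlerPoisson.KaehlerForm E M) (β : KaehlerPoisson.HolomorphicBivector E M)
    (hβ : ∃ p, β.toFun p ≠ 0)
    (C : Set M) (hC : KaehlerPoisson.IsCompactCurve E C) (hCD : C ∩ β.divisorSupport = ∅) :
    ∃ hcl : KaehlerPoisson.betaOmega β w ∈ KaehlerPoisson.dolbeaultCocycles E M,
      KaehlerPoisson.dolbeaultClass ⟨KaehlerPoisson.betaOmega β w, hcl⟩ ≠ 0 := by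
  refine ⟨KaehlerPoisson.betaOmega_mem_dolbeaultCocycles hE w β, fun h => ?_⟩
  obtain ⟨ξ, hξ, hdb⟩ := (Submodule.Quotient.mk_eq_zero _).1 h
  refine KaehlerPoisson.not_isDbarOf_betaOmega hE w β hC (fun p hp h0 => ?_) hξ hdb
  exact Set.notMem_empty p (hCD ▸ ⟨hp, h0⟩)
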